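/- Prime target subset sum. Given a prime $p$, nonzero residues $d_1,\dots,d_{p-1}\in\mathbb Z_p$ and a target $\tau\in\mathbb Z_p$, find $J\subseteq\{1,\dots,p-1\}$ with $\sum_{j\in J}d_j=\tau$. Machine model. A word RAM with a fixed finite number of registers and arrays, whose words have $O(\log p)$ bits. Reading or writing a word, comparing words, addition, truncated subtraction, multiplication, division with remainder, and modular inverses are unit-cost operations. Overflow, division by $0$, inversion of a non-unit and leaving an array are not allowed. Time is the number of elementary operations, and space is the number of registers and allocated array cells. Algorithm PrimeTarget. A component has a direction $v\in\mathbb Z_p^*$, a length $\ell\ge1$, an offset $\xi\in\mathbb Z_p$ and a reconstruction tree. It covers the residues $v,2v,\dots,\ell v$, and for every $0\le t\le\ell$ its tree encodes a set of input indices with sum $\xi+tv$. An owner array stores, for each residue covered by an installed component, that component and the coefficient $t$. 1. Start with no components. For $k=1,\dots,p-1$, insert $d_k$: (a) If an active component $C$ of direction $d_k$ and length $\ell$ exists, extend it to length $\ell+1$ (an extension node of its tree). If the new residue $(\ell+1)d_k$ is free, write it to the owner array. If it is not free, $C$ becomes the temporary component, and its old cells stay in the owner array as a held prefix. If there is no component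 of direction $d_k$, the temporary component is a new one of direction $d_k$, length $1$ and offset $0$ (a leaf). (b) While there is a temporary component $T=(v,\ell)$, scan its residues $tv$ that are not held, in increasing order of $t$, up to the first one that is owned. If there is none, install the unheld cells of $T$ and make $T$ active. Otherwise $xv=yw$ for an active component $D=(w,m)$, with $1\le x\le\ell$ and $1\le y\le m$. Remove $D$ from the active family and replace $T$ and $D$ by one temporary component with direction $g=v/y$, offset $\xi(T)+\xi(D)+Fg$ and length $L$. Here $F=0$, $L=m+\ell y$ if $x=1$; $F=0$, $L=\ell+mx$ if $y=1$; and $F=(x-1)(y-1)$, $L=mx+\ell y-2F$ if $x,y>1$. A merge node of the tree stores $\ell,m,x,y$ and $y^{-1}\bmod x$. If $x=1$, the cells of $D$ are kept as held prefix. If $y=1<x$, the held cells of $T$ stay held and those of $D$ are cleared. If $x,y>1$, both are cleared. If $L\ge p-1$, set the length to $p-1$, call the component full and stop the insertions. (c) Stop the insertions as soon as the total length of the active components is $p-1$. 2. Let $X$ be the sum of the offsets of all active components and of the full one, if any. If there is a full component, give it the coefficient $t\in\{0,\dots,p-1\}$ with $t\,v=\tau-X$, where $v$ is its direction. Otherwise,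 if $\tau\ne X$, give the owner of $\tau-X$ the coefficient stored in the owner array. All other coefficients are $0$. 3. Expand the trees from these coefficients with an explicit stack and output the union $J$ of the indices obtained. A leaf outputs its index if its coefficient is $1$. An extension node of a component of length $\ell$ passes on a coefficient $t\le\ell$, and for $t=\ell+1$ outputs its index and passes on $\ell$. A merge node converts $t$ into $0\le\alpha\le\ell$ and $0\le\beta\le m$ with $F+t=\alpha y+\beta x$ by a fixed constant-time formula. Theorem. There is an absolute constant $c$ such that for every prime $p$, all nonzero residues $d_1,\dots,d_{p-1}\in\mathbb Z_p$ and every $\tau\in\mathbb Z_p$, algorithm PrimeTarget, run on words of $c\lfloor\log_2p\rfloor$ bits with arbitrary initial contents of the memory outside the input, halts after at most $cp$ elementary steps, uses at most $cp$ words of memory, and outputs (as a $0/1$ array) a set $J\subseteq\{1,\dots,p-1\}$ with $\sum_{j\in J}d_j=\tau$. -/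

import Mathlib

/-! ## A word RAM with a structured programming language

A machine has a finite set `V` of registers and a finite set `A` of arrays; every register and
every array cell holds one machine word, a natural number below `2 ^ w`. Arithmetic, division with
remainder and modular inverses on words are unit-cost operations. -/

namespace WordRAM

/-- Contents of the registers and of the array cells. -/
structure State (V A : Type) where
  var : V → ℕ
  arr : A → ℕ → ℕ

/-- Arithmetic expressions; `get a i` reads cell `i` of array `a`, subtraction is truncated at `0`,
and `inv a n` is the inverse of `a` modulo `n`. -/
inductive Expr (V A : Type) : Type
  | num (n : ℕ)
  | var (x : V)
  | get (a : A) (i : Expr V A)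
  | add (a b : Expr V A)
  | sub (a b : Expr V A)
  | mul (a b : Expr V A)
  | div (a b : Expr V A)
  | mod (a b : Expr V A)
  | inv (a n : Expr V A)

/-- Tests used in branches and loops. -/
inductive Cond (V A : Type) : Type
  | eq (a b : Expr V A)
  | ne (a b : Expr V A)
  | lt (a b : Expr V A)
  | le (a b : Expr V A)
  | and (s t : Cond V A)

/-- Programs. -/
inductive Stmt (V A : Type) : Type
  | skip
  | assign (x : V) (e : Expr V A)
  | store (a : A) (i e : Expr V A)
  | seq (s t : Stmt V A)
  | cond (b : Cond V A) (s t : Stmt V A)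
  | loop (b : Cond V A) (s : Stmt V A)

variable {V A : Type}

instance (n : ℕ) : OfNat (Expr V A) n := ⟨Expr.num n⟩
instance : Add (Expr V A) := ⟨Expr.add⟩
instance : Sub (Expr V A) := ⟨Expr.sub⟩
instance : Mul (Expr V A) := ⟨Expr.mul⟩
instance : Div (Expr V A) := ⟨Expr.div⟩
instance : Mod (Expr V A) := ⟨Expr.mod⟩
instance : Coe V (Expr V A) := ⟨Expr.var⟩

namespace Expr

/-- The value of an expression. -/
def val (σ : State V A) : Expr V A → ℕ
  | num n => n
  | var x => σ.var x
  | get a i => σ.arr a (i.val σ)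
  | add a b => a.val σ + b.val σ
  | sub a b => a.val σ - b.val σ
  | mul a b => a.val σ * b.val σ
  | div a b => a.val σ / b.val σ
  | mod a b => a.val σ % b.val σ
  | inv a n => ((a.val σ : ZMod (n.val σ))⁻¹).val

/-- The evaluation is legal on a machine with `w`-bit words and arrays of `S` cells: every
intermediate result fits in a word, every array index is below `S`, no division by `0` occurs, and
only units are inverted. -/
def Ok (w S : ℕ) (σ : State V A) : Expr V A → Prop
  | num n => n < 2 ^ w
  | var x => σ.var x < 2 ^ w
  | get a i => i.Ok w S σ ∧ i.val σ < S ∧ σ.arr a (i.val σ) < 2 ^ w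
  | add a b => a.Ok w S σ ∧ b.Ok w S σ ∧ a.val σ + b.val σ < 2 ^ w
  | sub a b => a.Ok w S σ ∧ b.Ok w S σ
  | mul a b => a.Ok w S σ ∧ b.Ok w S σ ∧ a.val σ * b.val σ < 2 ^ w
  | div a b => a.Ok w S σ ∧ b.Ok w S σ ∧ b.val σ ≠ 0
  | mod a b => a.Ok w S σ ∧ b.Ok w S σ ∧ b.val σ ≠ 0
  | inv a n => a.Ok w S σ ∧ n.Ok w S σ ∧ n.val σ ≠ 0 ∧ (a.val σ).Coprime (n.val σ)

/-- The number of elementary operations performed by an evaluation. -/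
def cost : Expr V A → ℕ
  | num _ => 1
  | var _ => 1
  | get _ i => i.cost + 1
  | add a b => a.cost + b.cost + 1
  | sub a b => a.cost + b.cost + 1
  | mul a b => a.cost + b.cost + 1
  | div a b => a.cost + b.cost + 1
  | mod a b => a.cost + b.cost + 1
  | inv a n => a.cost + n.cost + 1

end Expr

namespace Cond

/-- The test succeeds. -/
def Holds (σ : State V A) : Cond V A → Prop
  | eq a b => a.val σ = b.val σ
  | ne a b => a.val σ ≠ b.val σ
  | lt a b => a.val σ < b.val σ
  | le a b => a.val σ ≤ b.val σ
  | and s t => s.Holds σ ∧ t.Holds σ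

/-- The test can be evaluated legally; both parts of a conjunction are evaluated. -/
def Ok (w S : ℕ) (σ : State V A) : Cond V A → Prop
  | eq a b => a.Ok w S σ ∧ b.Ok w S σ
  | ne a b => a.Ok w S σ ∧ b.Ok w S σ
  | lt a b => a.Ok w S σ ∧ b.Ok w S σ
  | le a b => a.Ok w S σ ∧ b.Ok w S σ
  | and s t => s.Ok w S σ ∧ t.Ok w S σ

/-- The number of elementary operations of a test. -/
def cost : Cond V A → ℕ
  | eq a b => a.cost + b.cost + 1
  | ne a b => a.cost + b.cost + 1
  | lt a b => a.cost + b.cost + 1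
  | le a b => a.cost + b.cost + 1
  | and s t => s.cost + t.cost + 1

end Cond

/-- `Exec w S P σ t σ'`: on a machine with `w`-bit words and arrays of `S` cells, the program `P`
started in `σ` halts in `σ'` after exactly `t` elementary steps, without ever overflowing a word,
leaving an array, dividing by `0` or inverting a non-unit. -/
inductive Exec [DecidableEq V] [DecidableEq A] (w S : ℕ) :
    Stmt V A → State V A → ℕ → State V A → Prop
  | skip (σ : State V A) : Exec w S .skip σ 1 σ
  | assign (x : V) (e : Expr V A) (σ : State V A) (he : e.Ok w S σ) :
      Exec w S (.assign x e) σ (e.cost + 1) ⟨Function.update σ.var x (e.val σ), σ.arr⟩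
  | store (a : A) (i e : Expr V A) (σ : State V A) (hi : i.Ok w S σ) (he : e.Ok w S σ)
      (hS : i.val σ < S) :
      Exec w S (.store a i e) σ (i.cost + e.cost + 1)
        ⟨σ.var, Function.update σ.arr a (Function.update (σ.arr a) (i.val σ) (e.val σ))⟩
  | seq {P Q : Stmt V A} {σ₁ σ₂ σ₃ : State V A} {t₁ t₂ : ℕ} (h₁ : Exec w S P σ₁ t₁ σ₂)
      (h₂ : Exec w S Q σ₂ t₂ σ₃) : Exec w S (.seq P Q) σ₁ (t₁ + t₂) σ₃
  | cond_true {b : Cond V A} {P Q : Stmt V A} {σ σ' : State V A} {t : ℕ} (hok : b.Ok w S σ)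
      (hb : b.Holds σ) (h : Exec w S P σ t σ') : Exec w S (.cond b P Q) σ (b.cost + 1 + t) σ'
  | cond_false {b : Cond V A} {P Q : Stmt V A} {σ σ' : State V A} {t : ℕ} (hok : b.Ok w S σ)
      (hb : ¬ b.Holds σ) (h : Exec w S Q σ t σ') : Exec w S (.cond b P Q) σ (b.cost + 1 + t) σ'
  | loop_done {b : Cond V A} {P : Stmt V A} {σ : State V A} (hok : b.Ok w S σ)
      (hb : ¬ b.Holds σ) : Exec w S (.loop b P) σ (b.cost + 1) σ
  | loop_step {b : Cond V A} {P : Stmt V A} {σ₁ σ₂ σ₃ : State V A} {t₁ t₂ : ℕ}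
      (hok : b.Ok w S σ₁) (hb : b.Holds σ₁) (h₁ : Exec w S P σ₁ t₁ σ₂)
      (h₂ : Exec w S (.loop b P) σ₂ t₂ σ₃) :
      Exec w S (.loop b P) σ₁ (b.cost + 1 + t₁ + t₂) σ₃

end WordRAM

/-! ## Algorithm `PrimeTarget` as a word-RAM program -/

namespace PrimeTarget

open WordRAM

/-- The registers of the program. -/
inductive Var : Type
  | p | tau                     -- input: the prime and the target
  | k | dk                      -- current input position and residue
  | total                       -- total length of the active components
  | done | merging              -- flags
  | nn                          -- number of reconstruction nodes created so far
  | full                        -- the full component, or 0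
  | T | h | v | l               -- temporary component, its held prefix, direction and length
  | D | w | m                   -- active component hit by it, its direction and length
  | x | y | g | F | L | inv     -- data of a merge
  | o                           -- offset of the merged component
  | c | r | t | j               -- scratch
  | X | s                       -- global shift, and target minus shift
  | sel | selt                  -- component that gets a non-zero coefficient, and the coefficient
  | sp                          -- stack height
  | n | a | b | z               -- scratch of the reconstruction
  deriving DecidableEq

instance : Fintype Var where
  elems := {
    .p, .tau, .k, .dk, .total, .done, .merging, .nn, .full, .T, .h, .v, .l, .D, .w, .m, .x, .y,
    .g, .F, .L, .inv, .o, .c, .r, .t, .j, .X, .s, .sel, .selt, .sp, .n, .a, .b, .z }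
  complete i := by cases i <;> decide

/-- The arrays of the program. -/
inductive Arr : Type
  | d                           -- input: the residues, in cells 1, ..., p - 1
  | out                         -- output: characteristic function of the subset
  | own | coef                  -- owner array: cell `r` holds component (0 if empty), coefficient
  | dir | len | off | root | act  -- component records: direction, length, offset, node, active?
  | kind | idx | chA | chB      -- nodes: kind (0 leaf, 1 extension, 2 merge), index, children
  | lenA | lenB | cx | cy | cinv  -- lengths of the children; the numbers x, y, 1/y mod x of a merge
  | stN | stT                   -- stack of pairs (node, coefficient)
  deriving DecidableEq

instance : Fintype Arr where
  elems := {
    .d, .out, .own, .coef, .dir, .len, .off, .root, .act, .kind, .idx, .chA, .chB, .lenA,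
    .lenB, .cx, .cy, .cinv, .stN, .stT }
  complete i := by cases i <;> decide

/-- Expressions, tests and programs over these registers and arrays. -/
abbrev E := Expr Var Arr
abbrev B := Cond Var Arr
abbrev P := Stmt Var Arr

infix:45 " ::= " => Stmt.assign (V := Var) (A := Arr)
infixr:35 " ;; " => Stmt.seq (V := Var) (A := Arr)

/-- Short names for the language constructs: read a cell, write a cell, branch, loop, tests. -/
abbrev rd (a : Arr) (i : E) : E := Expr.get a i
abbrev wr (a : Arr) (i e : E) : P := Stmt.store a i e
abbrev ifte (b : B) (s t : P) : P := Stmt.cond b s t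
abbrev while' (b : B) (s : P) : P := Stmt.loop b s
abbrev isEq (a b : E) : B := Cond.eq a b
abbrev isNe (a b : E) : B := Cond.ne a b
abbrev isLt (a b : E) : B := Cond.lt a b
abbrev isLe (a b : E) : B := Cond.le a b
abbrev modInv (a n : E) : E := Expr.inv a n
abbrev both (s t : B) : B := Cond.and s t

/-- Start with no component, an empty owner array and an empty output. -/
def setup : P :=
  .j ::= 0 ;;
  while' (isLt Var.j Var.p)
    (wr .own Var.j 0 ;; wr .coef Var.j 0 ;; wr .act Var.j 0 ;; wr .out Var.j 0 ;;
      .j ::= Var.j + 1) ;;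
  .total ::= 0 ;; .nn ::= 0 ;; .full ::= 0 ;; .done ::= 0 ;; .k ::= 1

/-- Insert the factor `{0, d_k}`. An active component has direction `d_k` exactly if it owns the
residue `d_k` with coefficient `1`; then it is extended in place if the new endpoint is free, and
otherwise detached, as temporary component with its old cells held. If there is none, a fresh
component of length `1` is the temporary component. -/
def insertStep : P :=
  .dk ::= rd .d Var.k ;;
  .nn ::= Var.nn + 1 ;;
  wr .idx Var.nn Var.k ;;
  .c ::= rd .own Var.dk ;;
  ifte (both (isNe Var.c 0) (isEq (rd .coef Var.dk) 1))
    (.l ::= rd .len Var.c ;;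
      .r ::= ((Var.l + 1) * Var.dk) % Var.p ;;
      wr .kind Var.nn 1 ;; wr .chA Var.nn (rd .root Var.c) ;; wr .lenA Var.nn Var.l ;;
      wr .root Var.c Var.nn ;; wr .len Var.c (Var.l + 1) ;;
      ifte (isEq (rd .own Var.r) 0)
        (wr .own Var.r Var.c ;; wr .coef Var.r (Var.l + 1) ;; .total ::= Var.total + 1 ;;
          .merging ::= 0)
        (wr .act Var.c 0 ;; .total ::= Var.total - Var.l ;; .T ::= Var.c ;; .h ::= Var.l ;;
          .merging ::= 1))
    (wr .kind Var.nn 0 ;;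
      wr .dir Var.k Var.dk ;; wr .len Var.k 1 ;; wr .off Var.k 0 ;; wr .root Var.k Var.nn ;;
      .T ::= Var.k ;; .h ::= 0 ;; .merging ::= 1)

/-- Scan the unheld covered residues of the temporary component in increasing coefficient order,
up to the first collision. -/
def scan : P :=
  .v ::= rd .dir Var.T ;; .l ::= rd .len Var.T ;;
  .t ::= Var.h + 1 ;;
  while' (both (isLe Var.t Var.l) (isEq (rd .own ((Var.t * Var.v) % Var.p)) 0)) (.t ::= Var.t + 1)

/-- No collision: the temporary component becomes active. -/
def install : P :=
  .j ::= Var.h + 1 ;;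
  while' (isLe Var.j Var.l)
    (.r ::= (Var.j * Var.v) % Var.p ;; wr .own Var.r Var.T ;; wr .coef Var.r Var.j ;;
      .j ::= Var.j + 1) ;;
  wr .act Var.T 1 ;; .total ::= Var.total + Var.l ;; .merging ::= 0

/-- Clear the owner cells with coefficients `1, ..., len` of a progression. -/
def clearCells (dir len : E) : P :=
  .j ::= 1 ;;
  while' (isLe Var.j len) (wr .own ((Var.j * dir) % Var.p) 0 ;; .j ::= Var.j + 1)

/-- Collision `x * v = y * w` with the active component `D`, which is removed; the two components
are replaced by one of direction `g = v / y`, the new temporary component. If `x = 1`, the record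
and the owner cells of `D` are kept as a held prefix (coefficient `1` of the temporary component
was scanned, so it held nothing); if `y = 1 < x`, the cells held by the temporary component remain
held and those of `D` are cleared; if `x, y > 1`, all these cells are cleared. -/
def mergeStep : P :=
  .r ::= (Var.t * Var.v) % Var.p ;;
  .D ::= rd .own Var.r ;; .x ::= Var.t ;; .y ::= rd .coef Var.r ;;
  .w ::= rd .dir Var.D ;; .m ::= rd .len Var.D ;;
  wr .act Var.D 0 ;; .total ::= Var.total - Var.m ;;
  .g ::= (Var.v * modInv Var.y Var.p) % Var.p ;;
  .o ::= (rd .off Var.T + rd .off Var.D) % Var.p ;;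
  .nn ::= Var.nn + 1 ;;
  wr .kind Var.nn 2 ;;
  wr .chA Var.nn (rd .root Var.T) ;; wr .chB Var.nn (rd .root Var.D) ;;
  wr .lenA Var.nn Var.l ;; wr .lenB Var.nn Var.m ;;
  wr .cx Var.nn Var.x ;; wr .cy Var.nn Var.y ;;
  ifte (isEq Var.x 1)
    (.F ::= 0 ;; .L ::= Var.m + Var.l * Var.y ;; .inv ::= 0 ;;
      .T ::= Var.D ;; .h ::= Var.m)
    (ifte (isEq Var.y 1)
      (.F ::= 0 ;; .L ::= Var.l + Var.m * Var.x ;; .inv ::= 0 ;;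
        clearCells Var.w Var.m)
      (.F ::= (Var.x - 1) * (Var.y - 1) ;;
        .L ::= Var.m * Var.x + Var.l * Var.y - 2 * Var.F ;;
        .inv ::= modInv Var.y Var.x ;;
        clearCells Var.w Var.m ;; clearCells Var.v Var.h ;; .h ::= 0)) ;;
  wr .cinv Var.nn Var.inv ;;
  wr .dir Var.T Var.g ;;
  wr .off Var.T ((Var.o + Var.F * Var.g) % Var.p) ;;
  wr .root Var.T Var.nn ;;
  ifte (isLe (Var.p - 1) Var.L)
    (wr .len Var.T (Var.p - 1) ;; wr .act Var.T 1 ;; .full ::= Var.T ;; .done ::= 1 ;;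
      .merging ::= 0)
    (wr .len Var.T Var.L)

/-- The main loop over the input residues. -/
def mainLoop : P :=
  while' (both (isEq Var.done 0) (isLt Var.k Var.p))
    (insertStep ;;
      while' (isEq Var.merging 1) (scan ;; ifte (isLt Var.l Var.t) install mergeStep) ;;
      ifte (isEq Var.total (Var.p - 1)) (.done ::= 1) .skip ;;
      .k ::= Var.k + 1)

/-- Compute the global shift `X` and choose the component and the coefficient that yield
`tau - X`; all other coefficients are `0`. -/
def chooseCoeff : P :=
  .X ::= 0 ;; .j ::= 1 ;;
  while' (isLt Var.j Var.p)
    (ifte (isEq (rd .act Var.j) 1) (.X ::= (Var.X + rd .off Var.j) % Var.p) .skip ;;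
      .j ::= Var.j + 1) ;;
  .s ::= (Var.tau + Var.p - Var.X) % Var.p ;;
  ifte (isNe Var.full 0)
    (.sel ::= Var.full ;;
      .selt ::= (Var.s * modInv (rd .dir Var.full) Var.p) % Var.p)
    (ifte (isEq Var.s 0)
      (.sel ::= 0 ;; .selt ::= 0)
      (.sel ::= rd .own Var.s ;; .selt ::= rd .coef Var.s))

/-- Push a node with a coefficient on the stack. -/
def push (node coeff : E) : P :=
  wr .stN Var.sp node ;; wr .stT Var.sp coeff ;; .sp ::= Var.sp + 1

/-- Convert the coefficient `t` of the merge node `n` into coefficients `a ≤ l` and `b ≤ m` of its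
children with `F + t = a * y + b * x`. -/
def splitCoeff : P :=
  .l ::= rd .lenA Var.n ;; .m ::= rd .lenB Var.n ;; .x ::= rd .cx Var.n ;; .y ::= rd .cy Var.n ;;
  ifte (isEq Var.x 1)
    (.a ::= Var.t / Var.y ;;
      ifte (isLt Var.l Var.a) (.a ::= Var.l) .skip ;;
      .b ::= Var.t - Var.a * Var.y)
    (ifte (isEq Var.y 1)
      (.b ::= Var.t / Var.x ;;
        ifte (isLt Var.m Var.b) (.b ::= Var.m) .skip ;;
        .a ::= Var.t - Var.b * Var.x)
      (.s ::= (Var.x - 1) * (Var.y - 1) + Var.t ;;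
        .a ::= (Var.s * rd .cinv Var.n) % Var.x ;;
        .b ::= (Var.s - Var.a * Var.y) / Var.x ;;
        .z ::= ((Var.b - Var.m) + (Var.y - 1)) / Var.y ;;
        .a ::= Var.a + Var.z * Var.x ;;
        .b ::= Var.b - Var.z * Var.y))

/-- Expand all active components (the full one included) down to the leaves. -/
def reconstruct : P :=
  .sp ::= 0 ;; .j ::= 1 ;;
  while' (isLt Var.j Var.p)
    (ifte (isEq (rd .act Var.j) 1)
        (ifte (isEq Var.j Var.sel) (push (rd .root Var.j) Var.selt) (push (rd .root Var.j) 0))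
        .skip ;;
      .j ::= Var.j + 1) ;;
  while' (isLt 0 Var.sp)
    (.sp ::= Var.sp - 1 ;; .n ::= rd .stN Var.sp ;; .t ::= rd .stT Var.sp ;;
      ifte (isEq (rd .kind Var.n) 0)
        (ifte (isEq Var.t 0) .skip (wr .out (rd .idx Var.n) 1))
        (ifte (isEq (rd .kind Var.n) 1)
          (ifte (isLe Var.t (rd .lenA Var.n))
            (push (rd .chA Var.n) Var.t)
            (wr .out (rd .idx Var.n) 1 ;; push (rd .chA Var.n) (rd .lenA Var.n)))
          (splitCoeff ;; push (rd .chA Var.n) Var.a ;; push (rd .chB Var.n) Var.b)))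

/-- Algorithm `PrimeTarget`. -/
def program : P :=
  setup ;; mainLoop ;; chooseCoeff ;; reconstruct

end PrimeTarget

/-! Correctness is a counting argument. The cells recorded for the active components are pairwise
distinct non-zero residues, so the active lengths sum to at most `p - 1` (`Owned.sum_le`). No
operation loses length: an insertion adds one, and a merge of lengths `l`, `m` without truncation
yields at least `l + m` (`le_mergeLen`). After `k` insertions the total length is thus at least `k`,
and the insertions end in one of two ways. Either there is a full component, whose progression
covers all residues because its direction is invertible, or the total length is `p - 1` and every
non-zero residue is owned. In both cases the target minus the global shift is zero or is reached by
a coefficient of a single component.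

A merge rests on the two-coin problem: for coprime `x ≤ l` and `y ≤ m`, every integer from `(x - 1)
* (y - 1)` to `m * x + l * y - (x - 1) * (y - 1)` has the form `a * y + b * x` with `a ≤ l` and `b ≤
m` (`split_of_one_lt`). Coprimality holds because the collision is the first one met by the scan: a
common factor could be cancelled modulo `p` and would give an earlier collision
(`Owned.coprime_of_collision`).

The linear time bound is amortized. A merge with `x > 1` scans at most `x` cells and clears at most
those of `D` and the held ones, but it gains at least `max m (x - 1)` in length. A merge with `x =
1` may gain no length; it costs constant time because the cells of `D` stay in place as a held
prefix, and the new tree node pays for it. Nodes are few: an insertion creates one node and at most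
one component, and a merge creates one node while the number of components drops by one, so there
are at most `2 * k` nodes. `busyPotential` and `idlePotential` combine nodes, lengths and recorded
cells; they stay below `11 * p`, and each unit of increase pays for `1000` steps
(`Busy.wp_mergeBody`). Expanding the trees is linear because they use disjoint non-empty sets of
indices (`Stacked.le_card`).

All this is carried through a total-correctness logic with exact costs (`WP`, `wp_loop`): the
postconditions hold the invariants `Forest` (trees) and `Owned` (owner array) together with the time
spent. -/

namespace WordRAM

variable {V A : Type} [DecidableEq V] [DecidableEq A] {w S : ℕ}

/-! ## Weakest preconditions -/

/-- The program `P` started in `σ` halts legally, after `t` steps and in a state `σ'` with `Q t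
σ'`. -/
def WP (w S : ℕ) (P : Stmt V A) (Q : ℕ → State V A → Prop) (σ : State V A) : Prop :=
  ∃ t σ', Exec w S P σ t σ' ∧ Q t σ'

theorem WP.mono {P : Stmt V A} {Q R : ℕ → State V A → Prop} {σ : State V A}
    (h : WP w S P Q σ) (hQR : ∀ t σ', Q t σ' → R t σ') : WP w S P R σ := by
  obtain ⟨t, σ', he, hq⟩ := h
  exact ⟨t, σ', he, hQR _ _ hq⟩

theorem wp_skip {Q : ℕ → State V A → Prop} {σ : State V A} :
    WP w S .skip Q σ ↔ Q 1 σ := by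
  constructor
  · rintro ⟨t, σ', he, hq⟩
    cases he
    exact hq
  · exact fun h => ⟨_, _, .skip _, h⟩

theorem wp_assign {x : V} {e : Expr V A} {Q : ℕ → State V A → Prop} {σ : State V A} :
    WP w S (.assign x e) Q σ ↔
      e.Ok w S σ ∧ Q (e.cost + 1) ⟨Function.update σ.var x (e.val σ), σ.arr⟩ := by
  constructor
  · rintro ⟨t, σ', he, hq⟩
    cases he with
    | assign _ _ _ he => exact ⟨he, hq⟩
  · exact fun h => ⟨_, _, .assign _ _ _ h.1, h.2⟩

theorem wp_store {a : A} {i e : Expr V A} {Q : ℕ → State V A → Prop} {σ : State V A} :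
    WP w S (.store a i e) Q σ ↔ (i.Ok w S σ ∧ e.Ok w S σ ∧ i.val σ < S) ∧
      Q (i.cost + e.cost + 1)
        ⟨σ.var, Function.update σ.arr a (Function.update (σ.arr a) (i.val σ) (e.val σ))⟩ := by
  constructor
  · rintro ⟨t, σ', he, hq⟩
    cases he with
    | store _ _ _ _ hi he hS => exact ⟨⟨hi, he, hS⟩, hq⟩
  · exact fun h => ⟨_, _, .store _ _ _ _ h.1.1 h.1.2.1 h.1.2.2, h.2⟩

theorem wp_seq {P R : Stmt V A} {Q : ℕ → State V A → Prop} {σ : State V A} :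
    WP w S (.seq P R) Q σ ↔
      WP w S P (fun t σ' => WP w S R (fun t' σ'' => Q (t + t') σ'') σ') σ := by
  constructor
  · rintro ⟨t, σ', he, hq⟩
    cases he with
    | seq h₁ h₂ => exact ⟨_, _, h₁, _, _, h₂, hq⟩
  · rintro ⟨t, σ', h₁, t', σ'', h₂, hq⟩
    exact ⟨_, _, .seq h₁ h₂, hq⟩

theorem wp_cond {b : Cond V A} {P R : Stmt V A} {Q : ℕ → State V A → Prop} {σ : State V A} :
    WP w S (.cond b P R) Q σ ↔ b.Ok w S σ ∧
      (b.Holds σ → WP w S P (fun t σ' => Q (b.cost + 1 + t) σ') σ) ∧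
      (¬ b.Holds σ → WP w S R (fun t σ' => Q (b.cost + 1 + t) σ') σ) := by
  constructor
  · rintro ⟨t, σ', he, hq⟩
    cases he with
    | cond_true hok hb h => exact ⟨hok, fun _ => ⟨_, _, h, hq⟩, fun h => absurd hb h⟩
    | cond_false hok hb h => exact ⟨hok, fun h => absurd h hb, fun _ => ⟨_, _, h, hq⟩⟩
  · rintro ⟨hok, h₁, h₂⟩
    by_cases hb : b.Holds σ
    · obtain ⟨t, σ', h, hq⟩ := h₁ hb
      exact ⟨_, _, .cond_true hok hb h, hq⟩
    · obtain ⟨t, σ', h, hq⟩ := h₂ hb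
      exact ⟨_, _, .cond_false hok hb h, hq⟩

/-- Loop rule: `I c σ` says that the loop may be entered in `σ` with a budget of `c` steps. -/
theorem wp_loop {b : Cond V A} {P : Stmt V A} {Q : ℕ → State V A → Prop}
    (I : ℕ → State V A → Prop)
    (step : ∀ c σ, I c σ → b.Ok w S σ ∧
      (b.Holds σ → WP w S P (fun t σ' => ∃ c', b.cost + 1 + t + c' ≤ c ∧ I c' σ') σ))
    {c : ℕ} {σ : State V A} (hI : I c σ)
    (exit : ∀ c' t σ', I c' σ' → ¬ b.Holds σ' → t + c' ≤ c + (b.cost + 1) → Q t σ') :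
    WP w S (.loop b P) Q σ := by
  -- Each iteration consumes a positive part of the budget, so the budget is itself the termination
  -- measure. What remains of it at the exit is handed back, which lets amortized bounds be chained.
  induction c using Nat.strong_induction_on generalizing σ Q with
  | _ c ih =>
    obtain ⟨hok, hs⟩ := step c σ hI
    by_cases hb : b.Holds σ
    · obtain ⟨t, σ', he, c', hc, hI'⟩ := hs hb
      obtain ⟨t', σ'', he', hq⟩ := ih c' (by omega) hI' (Q := fun t' σ'' => Q (b.cost + 1 + t + t')
          σ'')
        fun c'' t' σ'' h₁ h₂ h₃ => exit c'' _ σ'' h₁ h₂ (by omega)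
      exact ⟨_, _, .loop_step hok hb he he', hq⟩
    · exact ⟨_, _, .loop_done hok hb, exit c _ σ hI hb (by omega)⟩

/-- The inverse of `a` modulo `n`, as a natural number. -/
def modInvNat (a n : ℕ) : ℕ := ((a : ZMod n)⁻¹).val

/-- Evaluation of expressions and tests. -/
theorem eval_rules {V A : Type} (σ : State V A) :
    (Expr.val σ (0 : Expr V A) = 0 ∧ Expr.val σ (1 : Expr V A) = 1 ∧ Expr.val σ (2 : Expr V A) = 2)
        ∧
    (∀ x, Expr.val σ (Expr.var x) = σ.var x) ∧
    (∀ a i, Expr.val σ (Expr.get a i) = σ.arr a (i.val σ)) ∧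
    (∀ a b : Expr V A, (a + b).val σ = a.val σ + b.val σ) ∧
    (∀ a b : Expr V A, (a - b).val σ = a.val σ - b.val σ) ∧
    (∀ a b : Expr V A, (a * b).val σ = a.val σ * b.val σ) ∧
    (∀ a b : Expr V A, (a / b).val σ = a.val σ / b.val σ) ∧
    (∀ a b : Expr V A, (a % b).val σ = a.val σ % b.val σ) ∧
    (∀ a n : Expr V A, (Expr.inv a n).val σ = modInvNat (a.val σ) (n.val σ)) ∧
    (∀ a b : Expr V A, (Cond.eq a b).Holds σ ↔ a.val σ = b.val σ) ∧
    (∀ a b : Expr V A, (Cond.ne a b).Holds σ ↔ a.val σ ≠ b.val σ) ∧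
    (∀ a b : Expr V A, (Cond.lt a b).Holds σ ↔ a.val σ < b.val σ) ∧
    (∀ a b : Expr V A, (Cond.le a b).Holds σ ↔ a.val σ ≤ b.val σ) ∧
    (∀ s t : Cond V A, (Cond.and s t).Holds σ ↔ s.Holds σ ∧ t.Holds σ) :=
  ⟨⟨rfl, rfl, rfl⟩, fun _ => rfl, fun _ _ => rfl, fun _ _ => rfl, fun _ _ => rfl, fun _ _ => rfl,
    fun _ _ => rfl, fun _ _ => rfl, fun _ _ => rfl, fun _ _ => Iff.rfl, fun _ _ => Iff.rfl,
    fun _ _ => Iff.rfl, fun _ _ => Iff.rfl, fun _ _ => Iff.rfl⟩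

/-- Legality of expressions and tests. -/
theorem ok_rules {V A : Type} (w S : ℕ) (σ : State V A) :
    (Expr.Ok w S σ (0 : Expr V A) ↔ 0 < 2 ^ w) ∧ (Expr.Ok w S σ (1 : Expr V A) ↔ 1 < 2 ^ w) ∧
    (Expr.Ok w S σ (2 : Expr V A) ↔ 2 < 2 ^ w) ∧
    (∀ x, Expr.Ok w S σ (Expr.var x) ↔ σ.var x < 2 ^ w) ∧
    (∀ a i, Expr.Ok w S σ (Expr.get a i) ↔
      i.Ok w S σ ∧ i.val σ < S ∧ σ.arr a (i.val σ) < 2 ^ w) ∧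
    (∀ a b : Expr V A, (a + b).Ok w S σ ↔
      a.Ok w S σ ∧ b.Ok w S σ ∧ a.val σ + b.val σ < 2 ^ w) ∧
    (∀ a b : Expr V A, (a - b).Ok w S σ ↔ a.Ok w S σ ∧ b.Ok w S σ) ∧
    (∀ a b : Expr V A, (a * b).Ok w S σ ↔
      a.Ok w S σ ∧ b.Ok w S σ ∧ a.val σ * b.val σ < 2 ^ w) ∧
    (∀ a b : Expr V A, (a / b).Ok w S σ ↔ a.Ok w S σ ∧ b.Ok w S σ ∧ b.val σ ≠ 0) ∧
    (∀ a b : Expr V A, (a % b).Ok w S σ ↔ a.Ok w S σ ∧ b.Ok w S σ ∧ b.val σ ≠ 0) ∧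
    (∀ a n : Expr V A, (Expr.inv a n).Ok w S σ ↔
      a.Ok w S σ ∧ n.Ok w S σ ∧ n.val σ ≠ 0 ∧ (a.val σ).Coprime (n.val σ)) ∧
    (∀ a b : Expr V A, (Cond.eq a b).Ok w S σ ↔ a.Ok w S σ ∧ b.Ok w S σ) ∧
    (∀ a b : Expr V A, (Cond.ne a b).Ok w S σ ↔ a.Ok w S σ ∧ b.Ok w S σ) ∧
    (∀ a b : Expr V A, (Cond.lt a b).Ok w S σ ↔ a.Ok w S σ ∧ b.Ok w S σ) ∧
    (∀ a b : Expr V A, (Cond.le a b).Ok w S σ ↔ a.Ok w S σ ∧ b.Ok w S σ) ∧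
    (∀ s t : Cond V A, (Cond.and s t).Ok w S σ ↔ s.Ok w S σ ∧ t.Ok w S σ) :=
  ⟨Iff.rfl, Iff.rfl, Iff.rfl, fun _ => Iff.rfl, fun _ _ => Iff.rfl, fun _ _ => Iff.rfl,
    fun _ _ => Iff.rfl, fun _ _ => Iff.rfl, fun _ _ => Iff.rfl, fun _ _ => Iff.rfl,
    fun _ _ => Iff.rfl, fun _ _ => Iff.rfl, fun _ _ => Iff.rfl, fun _ _ => Iff.rfl,
    fun _ _ => Iff.rfl, fun _ _ => Iff.rfl⟩

/-- Cost of expressions and tests. -/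
theorem cost_rules {V A : Type} :
    ((0 : Expr V A).cost = 1 ∧ (1 : Expr V A).cost = 1 ∧ (2 : Expr V A).cost = 1) ∧
    (∀ x, Expr.cost (Expr.var x : Expr V A) = 1) ∧
    (∀ a i, Expr.cost (Expr.get a i : Expr V A) = i.cost + 1) ∧
    (∀ a b : Expr V A, (a + b).cost = a.cost + b.cost + 1) ∧
    (∀ a b : Expr V A, (a - b).cost = a.cost + b.cost + 1) ∧
    (∀ a b : Expr V A, (a * b).cost = a.cost + b.cost + 1) ∧
    (∀ a b : Expr V A, (a / b).cost = a.cost + b.cost + 1) ∧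
    (∀ a b : Expr V A, (a % b).cost = a.cost + b.cost + 1) ∧
    (∀ a n : Expr V A, (Expr.inv a n).cost = a.cost + n.cost + 1) ∧
    (∀ a b : Expr V A, (Cond.eq a b).cost = a.cost + b.cost + 1) ∧
    (∀ a b : Expr V A, (Cond.ne a b).cost = a.cost + b.cost + 1) ∧
    (∀ a b : Expr V A, (Cond.lt a b).cost = a.cost + b.cost + 1) ∧
    (∀ a b : Expr V A, (Cond.le a b).cost = a.cost + b.cost + 1) ∧
    (∀ s t : Cond V A, (Cond.and s t).cost = s.cost + t.cost + 1) :=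
  ⟨⟨rfl, rfl, rfl⟩, fun _ => rfl, fun _ _ => rfl, fun _ _ => rfl, fun _ _ => rfl, fun _ _ => rfl,
    fun _ _ => rfl, fun _ _ => rfl, fun _ _ => rfl, fun _ _ => rfl, fun _ _ => rfl,
    fun _ _ => rfl, fun _ _ => rfl, fun _ _ => rfl⟩

end WordRAM

namespace PrimeTarget

open WordRAM

/-! ## Merging two progressions -/

/-- The greedy choice: an uncapped quotient leaves a remainder below `y ≤ m`, and a quotient capped
at `l` leaves at most `m` by the bound on `t`. The case `y = 1` is the same with the two children
exchanged. -/
theorem split_of_x_eq_one {l m y t : ℕ} (hy : 1 ≤ y) (hym : y ≤ m) (ht : t ≤ m + l * y) :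
    min (t / y) l * y ≤ t ∧ t - min (t / y) l * y ≤ m := by
  have h₁ := Nat.div_mul_le_self t y
  have h₂ := Nat.lt_div_mul_add (a := t) (b := y) (by omega)
  rcases le_total (t / y) l with h | h
  · rw [min_eq_left h]
    omega
  · rw [min_eq_right h]
    have := Nat.mul_le_mul_right y h
    omega

/-- `a` solves `a * y ≡ s` modulo `x`, so `b` is an exact quotient, but it may exceed `m`. Trading
`y` units of `b` for `x` units of `a` keeps the sum; `z` is the least number of trades that brings
`b` down to `m`. By minimality `b` then stays above `m - y`, and the upper bound on `t` forces the
other coefficient to be at most `l`. -/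
theorem split_of_one_lt {l m x y t i : ℕ} (hx : 1 < x) (hy : 1 < y) (hxl : x ≤ l) (hym : y ≤ m)
    (hi : i * y ≡ 1 [MOD x]) (ht : t ≤ m * x + l * y - 2 * ((x - 1) * (y - 1))) :
    let s := (x - 1) * (y - 1) + t
    let a := s * i % x
    let b := (s - a * y) / x
    let z := (b - m + (y - 1)) / y
    a + z * x ≤ l ∧ b - z * y ≤ m ∧ z * y ≤ b ∧ a * y ≤ s ∧
      (x - 1) * (y - 1) + t = (a + z * x) * y + (b - z * y) * x := by
  intro s a b z
  have ha : a < x := Nat.mod_lt _ (by omega)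
  obtain ⟨x, rfl⟩ : ∃ x', x = x' + 1 := ⟨x - 1, by omega⟩
  obtain ⟨y, rfl⟩ : ∃ y', y = y' + 1 := ⟨y - 1, by omega⟩
  simp only [Nat.add_sub_cancel] at ht
  have hs₀ : s = x * y + t := rfl
  have ha₀ : a = s * i % (x + 1) := rfl
  have hz₀ : z = (b - m + y) / (y + 1) := rfl
  have hb₀ : b = (s - a * (y + 1)) / (x + 1) := rfl
  simp only [Nat.add_sub_cancel]
  rw [← hs₀]
  clear_value z
  clear_value b
  clear_value a
  clear_value s
  have hmod : a * (y + 1) ≡ s [MOD (x + 1)] := by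
    rw [ha₀]
    calc s * i % (x + 1) * (y + 1) ≡ s * i * (y + 1) [MOD (x + 1)] :=
        (Nat.mod_modEq _ _).mul_right _
      _ = s * (i * (y + 1)) := by ring
      _ ≡ s * 1 [MOD (x + 1)] := hi.mul_left _
      _ = s := mul_one s
  -- Here `x` and `y` are the original numbers minus one. Otherwise `a * (y + 1)` exceeds `s ≥ x *
  -- y` by a positive multiple of `x + 1`, so it is larger than `x * (y + 1)`, contrary to `a ≤ x`.
  have has : a * (y + 1) ≤ s := by
    by_contra hlt
    push Not at hlt
    have hd := (Nat.modEq_iff_dvd' hlt.le).1 hmod.symm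
    have h₁ := Nat.le_of_dvd (by omega) hd
    have h₂ : a * (y + 1) ≤ x * (y + 1) := Nat.mul_le_mul_right _ (by omega)
    have h₃ : x * (y + 1) = x * y + x := by ring
    omega
  obtain ⟨b', hb'⟩ := (Nat.modEq_iff_dvd' has).1 hmod
  have hb : b = b' := by
    rw [hb₀, hb', Nat.mul_div_cancel_left _ (by omega)]
  have hs : s = a * (y + 1) + b * (x + 1) := by
    have : (x + 1) * b' = b * (x + 1) := by rw [hb]; ring
    omega
  -- The truncated subtraction in the bound on `t` is a genuine one.
  have hF : 2 * (x * y) ≤ m * (x + 1) + l * (y + 1) := by nlinarith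
  have hsub : s + x * y ≤ m * (x + 1) + l * (y + 1) := by omega
  have hz₁ : z * (y + 1) ≤ b - m + y := hz₀ ▸ Nat.div_mul_le_self _ _
  have hz₂ : b - m + y < z * (y + 1) + (y + 1) := hz₀ ▸ Nat.lt_div_mul_add (by omega)
  have hzb : z * (y + 1) ≤ b := by
    rcases le_total b m with h | h
    · have : z = 0 := hz₀.trans (Nat.div_eq_of_lt (by omega))
      simp [this]
    · omega
  have hsum : s = (a + z * (x + 1)) * (y + 1) + (b - z * (y + 1)) * (x + 1) := by
    obtain ⟨q, hq⟩ := Nat.exists_eq_add_of_le hzb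
    rw [hs, hq, Nat.add_sub_cancel_left]
    ring
  refine ⟨?_, by omega, hzb, has, hsum⟩
  rcases le_total b m with h | h
  · have : z = 0 := hz₀.trans (Nat.div_eq_of_lt (by omega))
    rw [this]
    omega
  -- The reduced `b` lies at most `y` below `m`. If the other coefficient were at least `l + 1`, the
  -- sum would exceed `m * (x + 1) + l * (y + 1) - x * y` by at least one.
  · obtain ⟨e, he⟩ : ∃ e, b - z * (y + 1) + e = m ∧ e ≤ y := ⟨m - (b - z * (y + 1)), by omega,
      by omega⟩
    generalize a + z * (x + 1) = a' at *
    generalize b - z * (y + 1) = b'' at *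
    by_contra hlt
    push Not at hlt
    obtain ⟨he, hey⟩ := he
    subst he
    nlinarith [Nat.mul_le_mul_right (x + 1) hey, Nat.mul_le_mul_right (y + 1) hlt]

/-- Length of the progression obtained by a merge. -/
def mergeLen (l m x y : ℕ) : ℕ := m * x + l * y - 2 * ((x - 1) * (y - 1))

/-- The excess over `l + m` equals `(x - 1) + (y - 1) + (x - 1) * (m - y) + (y - 1) * (l - x)`. For
`x > 1` it is at least `m` and at least `x - 1`; these two gains pay for clearing and scanning. -/
theorem le_mergeLen {l m x y : ℕ} (hx : 1 ≤ x) (hxl : x ≤ l) (hy : 1 ≤ y) (hym : y ≤ m) :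
    l + m ≤ mergeLen l m x y ∧
      (1 < x → l + 2 * m ≤ mergeLen l m x y ∧ l + m + x ≤ mergeLen l m x y + 1) := by
  obtain ⟨a, rfl⟩ := Nat.exists_eq_add_of_le' hx
  obtain ⟨b, rfl⟩ := Nat.exists_eq_add_of_le' hy
  obtain ⟨e, rfl⟩ := Nat.exists_eq_add_of_le' hym
  obtain ⟨f, rfl⟩ := Nat.exists_eq_add_of_le' hxl
  have h : mergeLen (f + (a + 1)) (e + (b + 1)) (a + 1) (b + 1) =
      f + (a + 1) + (e + (b + 1)) + (a + b + a * e + b * f) := by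
    simp only [mergeLen, Nat.add_sub_cancel]
    rw [Nat.sub_eq_iff_eq_add (by nlinarith)]
    ring
  rw [h]
  refine ⟨by omega, fun ha => ?_⟩
  have h₁ : e ≤ a * e := Nat.le_mul_of_pos_left _ (by omega)
  have h₂ := Nat.zero_le (b * f)
  omega

/-! ## Reconstruction trees -/

/-- The arrays that hold the reconstruction nodes. -/
def nodeArrays : Finset Arr := {.kind, .idx, .chA, .chB, .lenA, .lenB, .cx, .cy, .cinv}

/-- `Enc d A n v l ξ I`: for every `t ≤ l` the tree with root `n` in the arrays `A` encodes a subset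
of `I` with sum `ξ + t * v`. -/
inductive Enc {p : ℕ} (d : ℕ → ZMod p) (A : Arr → ℕ → ℕ) :
    ℕ → ZMod p → ℕ → ZMod p → Finset ℕ → Prop
  | leaf {n : ℕ} {v : ZMod p} {I : Finset ℕ} (hk : A .kind n = 0) (hv : v = d (A .idx n))
      (hI : I = {A .idx n}) : Enc d A n v 1 0 I
  | extend {n l : ℕ} {v ξ : ZMod p} {I I' : Finset ℕ} (hk : A .kind n = 1) (hv : v = d (A .idx n))
      (hn : A .chA n < n) (hl : l = A .lenA n + 1) (hlp : A .lenA n < p) (hi : A .idx n ∉ I)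
      (hI : I' = insert (A .idx n) I) (h : Enc d A (A .chA n) v (A .lenA n) ξ I) :
      Enc d A n v l ξ I'
  | merge {n L : ℕ} {v w g ξ ζ o : ZMod p} {I J U : Finset ℕ} (hk : A .kind n = 2)
      (ha : A .chA n < n) (hb : A .chB n < n) (hla : A .lenA n < p) (hlb : A .lenB n < p)
      (hx : 1 ≤ A .cx n) (hxl : A .cx n ≤ A .lenA n) (hy : 1 ≤ A .cy n) (hym : A .cy n ≤ A .lenB n)
      (hi : 1 < A .cx n → 1 < A .cy n → A .cinv n * A .cy n ≡ 1 [MOD A .cx n])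
      (hip : A .cinv n < p) (hL : L ≤ mergeLen (A .lenA n) (A .lenB n) (A .cx n) (A .cy n))
      (hv : v = A .cy n * g) (hw : w = A .cx n * g)
      (ho : o = ξ + ζ + ((A .cx n - 1) * (A .cy n - 1) : ℕ) * g)
      (hd : Disjoint I J) (hU : U = I ∪ J)
      (hA : Enc d A (A .chA n) v (A .lenA n) ξ I) (hB : Enc d A (A .chB n) w (A .lenB n) ζ J) :
      Enc d A n g L o U

theorem Enc.nonempty {p : ℕ} {d : ℕ → ZMod p} {A : Arr → ℕ → ℕ} {n l : ℕ} {v ξ : ZMod p}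
    {I : Finset ℕ} (h : Enc d A n v l ξ I) : I.Nonempty := by
  induction h with
  | leaf _ _ hI => simp [hI]
  | extend _ _ _ _ _ _ hI => simp [hI]
  | merge _ _ _ _ _ _ _ _ _ _ _ _ _ _ _ _ hU _ _ ih => rw [hU]; exact ih.inl

/-- Children have smaller numbers than their parent, so a tree never refers to nodes beyond its root
and survives the creation of new ones. -/
theorem Enc.congr {p : ℕ} {d : ℕ → ZMod p} {A A' : Arr → ℕ → ℕ} {n l : ℕ} {v ξ : ZMod p}
    {I : Finset ℕ} (h : Enc d A n v l ξ I)
    (hA : ∀ a ∈ nodeArrays, ∀ i ≤ n, A' a i = A a i) : Enc d A' n v l ξ I := by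
  have key : ∀ {n : ℕ}, (∀ a ∈ nodeArrays, ∀ i ≤ n, A' a i = A a i) →
      A' .kind n = A .kind n ∧ A' .idx n = A .idx n ∧ A' .chA n = A .chA n ∧
      A' .chB n = A .chB n ∧ A' .lenA n = A .lenA n ∧ A' .lenB n = A .lenB n ∧
      A' .cx n = A .cx n ∧ A' .cy n = A .cy n ∧ A' .cinv n = A .cinv n := fun {n} h => by
    refine ⟨?_, ?_, ?_, ?_, ?_, ?_, ?_, ?_, ?_⟩ <;> exact h _ (by decide) n le_rfl
  induction h with
  | leaf hk hv hI =>
    obtain ⟨e₁, e₂, -⟩ := key hA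
    exact .leaf (e₁ ▸ hk) (e₂ ▸ hv) (e₂ ▸ hI)
  | extend hk hv hn hl hlp hi hI h ih =>
    obtain ⟨e₁, e₂, e₃, -, e₅, -⟩ := key hA
    rw [← e₁] at hk
    have ih := ih fun a ha i hi => hA a ha i (by omega)
    rw [← e₂] at hv hi hI
    rw [← e₃] at hn ih
    rw [← e₅] at hl hlp ih
    exact .extend hk hv hn hl hlp hi hI ih
  | merge hk ha hb hla hlb hx hxl hy hym hi hip hL hv hw ho hd hU _ _ ih₁ ih₂ =>
    obtain ⟨e₁, e₂, e₃, e₄, e₅, e₆, e₇, e₈, e₉⟩ := key hA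
    have ih₁ := ih₁ fun a ha i hi => hA a ha i (by omega)
    have ih₂ := ih₂ fun a ha i hi => hA a ha i (by omega)
    rw [← e₁] at hk
    simp only [← e₃, ← e₄, ← e₅, ← e₆, ← e₇, ← e₈, ← e₉] at *
    exact .merge hk ha hb hla hlb hx hxl hy hym hi hip hL hv hw ho hd hU ih₁ ih₂

/-! ## Components -/

/-- Component `c` has a legal record and a reconstruction tree that uses the indices in `I`. -/
structure Comp {p : ℕ} (d : ℕ → ZMod p) (A : Arr → ℕ → ℕ) (nn k c : ℕ) (I : Finset ℕ) : Prop where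
  id_pos : 1 ≤ c
  id_le : c ≤ k
  dir_pos : 1 ≤ A .dir c
  dir_lt : A .dir c < p
  len_pos : 1 ≤ A .len c
  len_lt : A .len c < p
  off_lt : A .off c < p
  root_le : A .root c ≤ nn
  sub : I ⊆ Finset.Icc 1 k
  enc : Enc d A (A .root c) (A .dir c) (A .len c) (A .off c) I

theorem Comp.congr {p : ℕ} {d : ℕ → ZMod p} {A A' : Arr → ℕ → ℕ} {nn nn' k k' c : ℕ}
    {I : Finset ℕ} (h : Comp d A nn k c I) (hnn : nn ≤ nn') (hk : k ≤ k')
    (hn : ∀ a ∈ nodeArrays, ∀ i ≤ nn, A' a i = A a i)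
    (hr : ∀ a ∈ ({.dir, .len, .off, .root} : Finset Arr), A' a c = A a c) :
    Comp d A' nn' k' c I := by
  have h₁ := hr .dir (by decide)
  have h₂ := hr .len (by decide)
  have h₃ := hr .off (by decide)
  have h₄ := hr .root (by decide)
  exact {
    id_pos := h.id_pos
    id_le := h.id_le.trans hk
    dir_pos := h₁ ▸ h.dir_pos
    dir_lt := h₁ ▸ h.dir_lt
    len_pos := h₂ ▸ h.len_pos
    len_lt := h₂ ▸ h.len_lt
    off_lt := h₃ ▸ h.off_lt
    root_le := h₄ ▸ h.root_le.trans hnn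
    sub := h.sub.trans (Finset.Icc_subset_Icc_right hk)
    enc := by
      rw [h₁, h₂, h₃, h₄]
      exact h.enc.congr fun a ha i hi => hn a ha i (hi.trans h.root_le) }

/-- The components in `C` are legal, and their trees use pairwise disjoint sets of indices. -/
structure Forest {p : ℕ} (d : ℕ → ZMod p) (A : Arr → ℕ → ℕ) (nn k : ℕ) (C : Finset ℕ)
    (I : ℕ → Finset ℕ) : Prop where
  comp : ∀ c ∈ C, Comp d A nn k c (I c)
  disj : ∀ c ∈ C, ∀ c' ∈ C, c ≠ c' → Disjoint (I c) (I c')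

/-- The components in `C` own exactly the residues `j * dir c` with `1 ≤ j ≤ H c`. -/
structure Owned (p : ℕ) (A : Arr → ℕ → ℕ) (C : Finset ℕ) (H : ℕ → ℕ) : Prop where
  of_ne : ∀ r, 0 < r → r < p → A .own r ≠ 0 → A .own r ∈ C ∧ 1 ≤ A .coef r ∧
    A .coef r ≤ H (A .own r) ∧ A .coef r * A .dir (A .own r) % p = r
  own_zero : A .own 0 = 0
  coef_lt : ∀ r < p, A .coef r < p
  cover : ∀ c ∈ C, ∀ j, 1 ≤ j → j ≤ H c →
    A .own (j * A .dir c % p) = c ∧ A .coef (j * A .dir c % p) = j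

/-- `own'` arises from `own` by clearing the cells `j * v` with `1 ≤ j ≤ l`. -/
def Cleared (p : ℕ) (own own' : ℕ → ℕ) (v l : ℕ) : Prop :=
  (∀ j, 1 ≤ j → j ≤ l → own' (j * v % p) = 0) ∧
    ∀ r, (∀ j, 1 ≤ j → j ≤ l → j * v % p ≠ r) → own' r = own r

theorem mul_mod_pos {p a b : ℕ} (hp : p.Prime) (ha : 1 ≤ a) (hap : a < p) (hb : 1 ≤ b)
    (hbp : b < p) : 0 < a * b % p := by
  rw [Nat.pos_iff_ne_zero]
  intro h
  rcases (hp.dvd_mul).1 (Nat.dvd_of_mod_eq_zero h) with h | h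
  · exact absurd (Nat.le_of_dvd ha h) (by omega)
  · exact absurd (Nat.le_of_dvd hb h) (by omega)

theorem mul_mod_inj {p a a' b : ℕ} (hp : p.Prime) (hap : a < p) (hap' : a' < p) (hb : 1 ≤ b)
    (hbp : b < p) (h : a * b % p = a' * b % p) : a = a' := by
  have hc : Nat.gcd p b = 1 := Nat.coprime_of_lt_prime (by omega) hbp hp
  have : a ≡ a' [MOD p] := Nat.ModEq.cancel_right_of_coprime hc h
  rwa [Nat.ModEq, Nat.mod_eq_of_lt hap, Nat.mod_eq_of_lt hap'] at this

namespace Owned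

variable {p : ℕ} {A A' : Arr → ℕ → ℕ} {C : Finset ℕ} {H H' : ℕ → ℕ}

theorem congr (h : Owned p A C H) (ho : A' .own = A .own) (hc : A' .coef = A .coef)
    (hd : ∀ c ∈ C, A' .dir c = A .dir c) (hH : ∀ c ∈ C, H' c = H c) : Owned p A' C H' where
  of_ne r hr hrp hne := by
    rw [ho] at hne ⊢
    obtain ⟨h₁, h₂, h₃, h₄⟩ := h.of_ne r hr hrp hne
    rw [hc, hd _ h₁, hH _ h₁]
    exact ⟨h₁, h₂, h₃, h₄⟩
  own_zero := by rw [ho, h.own_zero]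
  coef_lt := hc ▸ h.coef_lt
  cover c hcC j hj hjH := by
    rw [ho, hc, hd c hcC]
    exact h.cover c hcC j hj (hH c hcC ▸ hjH)

/-- The owner array inverts the map from pairs (component, coefficient) to residues, so this map is
injective into the `p - 1` non-zero residues; when the cardinalities agree it is onto. -/
theorem sum_le (h : Owned p A C H) (hp : p.Prime) (hC : ∀ c ∈ C, 1 ≤ c)
    (hdir : ∀ c ∈ C, 1 ≤ A .dir c ∧ A .dir c < p) (hH : ∀ c ∈ C, H c < p) :
    ∑ c ∈ C, H c ≤ p - 1 ∧
      (∑ c ∈ C, H c = p - 1 → ∀ r, 0 < r → r < p → A .own r ≠ 0) := by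
  set R := C.sigma fun c => Finset.Icc 1 (H c)
  let f : (Σ _ : ℕ, ℕ) → ℕ := fun q => q.2 * A .dir q.1 % p
  have hmem : ∀ q ∈ R, q.1 ∈ C ∧ 1 ≤ q.2 ∧ q.2 ≤ H q.1 := fun q hq => by
    simpa [R] using hq
  have hinj : Set.InjOn f R := by
    intro q hq q' hq' he
    obtain ⟨h₁, h₂, h₃⟩ := hmem q hq
    obtain ⟨h₁', h₂', h₃'⟩ := hmem q' hq'
    have e := h.cover _ h₁ _ h₂ h₃
    have e' := h.cover _ h₁' _ h₂' h₃'
    have he : q.2 * A .dir q.1 % p = q'.2 * A .dir q'.1 % p := he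
    rw [he] at e
    obtain ⟨q₁, q₂⟩ := q
    obtain ⟨q₁', q₂'⟩ := q'
    have e₁ : q₁ = q₁' := e.1.symm.trans e'.1
    have e₂ : q₂ = q₂' := e.2.symm.trans e'.2
    rw [e₁, e₂]
  have hsub : R.image f ⊆ Finset.Icc 1 (p - 1) := by
    intro r hr
    obtain ⟨q, hq, rfl⟩ := Finset.mem_image.1 hr
    obtain ⟨h₁, h₂, h₃⟩ := hmem q hq
    have := hH _ h₁
    have h₄ := mul_mod_pos hp h₂ (by omega) (hdir _ h₁).1 (hdir _ h₁).2
    have h₅ := Nat.mod_lt (q.2 * A .dir q.1) hp.pos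
    exact Finset.mem_Icc.2 ⟨h₄, Nat.le_sub_one_of_lt h₅⟩
  have hcard : (R.image f).card = ∑ c ∈ C, H c := by
    rw [Finset.card_image_of_injOn hinj, Finset.card_sigma]
    simp
  have hle := Finset.card_le_card hsub
  rw [Nat.card_Icc, hcard, Nat.add_sub_cancel] at hle
  refine ⟨hle, fun he r hr hrp => ?_⟩
  have heq := Finset.eq_of_subset_of_card_le hsub (by rw [Nat.card_Icc, hcard, Nat.add_sub_cancel,
      he])
  have hr : r ∈ R.image f := heq ▸ Finset.mem_Icc.2 ⟨hr, by omega⟩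
  obtain ⟨q, hq, rfl⟩ := Finset.mem_image.1 hr
  obtain ⟨h₁, h₂, h₃⟩ := hmem q hq
  have := hC _ h₁
  rw [show A .own (f q) = q.1 from (h.cover _ h₁ _ h₂ h₃).1]
  omega

/-- A component whose first `H T` residues are recorded takes the next one. -/
theorem grow (h : Owned p A C H) {T r : ℕ} (hT : T ∈ C) (hr0 : 0 < r) (hHT : H T + 1 < p)
    (hC : ∀ c ∈ C, 1 ≤ c)
    (hr : r = (H T + 1) * A .dir T % p) (hfree : A .own r = 0)
    (ho : A' .own = Function.update (A .own) r T)
    (hc : A' .coef = Function.update (A .coef) r (H T + 1))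
    (hd : ∀ c ∈ C, A' .dir c = A .dir c) :
    Owned p A' C (Function.update H T (H T + 1)) where
  of_ne s hs hsp hne := by
    rw [ho] at hne ⊢
    rw [hc]
    by_cases hsr : s = r
    · subst hsr
      simp only [Function.update_self]
      exact ⟨hT, by omega, le_rfl, by rw [hd T hT, ← hr]⟩
    · simp only [Function.update_of_ne hsr] at hne ⊢
      obtain ⟨h₁, h₂, h₃, h₄⟩ := h.of_ne s hs hsp hne
      refine ⟨h₁, h₂, h₃.trans ?_, by rw [hd _ h₁, h₄]⟩
      by_cases e : A .own s = T
      · simp [e]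
      · simp [e]
  own_zero := by rw [ho, Function.update_of_ne hr0.ne, h.own_zero]
  coef_lt s hs := by
    rw [hc]
    by_cases e : s = r
    · rwa [e, Function.update_self]
    · rw [Function.update_of_ne e]
      exact h.coef_lt s hs
  cover c hcC j hj hjH := by
    rw [ho, hc, hd c hcC]
    by_cases hold : j ≤ H c
    · have hcov := h.cover c hcC j hj hold
      have hne : j * A .dir c % p ≠ r := by
        rintro rfl
        have := hC c hcC
        omega
      simpa only [Function.update_of_ne hne] using hcov
    · have hcT : c = T := by
        by_contra hne
        simp only [Function.update_of_ne hne] at hjH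
        exact hold hjH
      subst hcT
      simp only [Function.update_self] at hjH
      obtain rfl : j = H c + 1 := by omega
      simp [hr]

/-- The cells of a component are cleared. -/
theorem clear (h : Owned p A C H) (hp : p.Prime) {D : ℕ} (hD : D ∈ C) (hC : ∀ c ∈ C, 1 ≤ c)
    (hcl : Cleared p (A .own) (A' .own) (A .dir D) (H D))
    (hdir : ∀ c ∈ C, 1 ≤ A .dir c ∧ A .dir c < p) (hH : ∀ c ∈ C, H c < p)
    (hc : A' .coef = A .coef) (hd : ∀ c ∈ C, A' .dir c = A .dir c) :
    Owned p A' (C.erase D) H := by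
  obtain ⟨ho, ho'⟩ := hcl
  -- Clearing along the progression is the same as clearing by owner, since the recorded multiples
  -- of the direction are exactly the cells owned by `D`.
  have key : ∀ r, 0 < r → r < p → A' .own r = if A .own r = D then 0 else A .own r := by
    intro r hr hrp
    split_ifs with e
    · have := hC D hD
      obtain ⟨h₁, h₂, h₃, h₄⟩ := h.of_ne r hr hrp (by omega)
      rw [e] at h₃ h₄
      rw [← h₄]
      exact ho _ h₂ h₃
    · refine ho' r ?_
      rintro j hj hjH rfl
      exact e (h.cover D hD j hj hjH).1
  constructor
  · intro r hr hrp hne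
    rw [key r hr hrp] at hne ⊢
    by_cases e : A .own r = D
    · simp [e] at hne
    rw [if_neg e] at hne ⊢
    obtain ⟨h₁, h₂, h₃, h₄⟩ := h.of_ne r hr hrp hne
    rw [hc, hd _ h₁]
    exact ⟨Finset.mem_erase.2 ⟨e, h₁⟩, h₂, h₃, h₄⟩
  · rw [ho' 0 fun j hj hjH =>
      (mul_mod_pos hp hj (hjH.trans_lt (hH D hD)) (hdir D hD).1 (hdir D hD).2).ne', h.own_zero]
  · exact hc ▸ h.coef_lt
  · intro c hcC j hj hjH
    obtain ⟨hcD, hcC⟩ := Finset.mem_erase.1 hcC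
    obtain ⟨h₁, h₂⟩ := h.cover c hcC j hj hjH
    have h₃ := hH c hcC
    have h₄ := hdir c hcC
    rw [hd c hcC, hc, key _ (mul_mod_pos hp hj (by omega) h₄.1 h₄.2) (Nat.mod_lt _ hp.pos), h₁,
      if_neg hcD]
    exact ⟨rfl, h₂⟩

/-- Only recorded cells matter here, not lengths: a temporary component that holds nothing can join
the family, and by `erase_zero` leave it, at no cost. -/
theorem insert_zero (h : Owned p A C H) {c : ℕ} (hc : c ∉ C) (hH : ∀ c' ∈ C, H' c' = H c')
    (h0 : H' c = 0) :
    Owned p A (insert c C) H' where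
  of_ne r hr hrp hne := by
    obtain ⟨h₁, h₂, h₃, h₄⟩ := h.of_ne r hr hrp hne
    exact ⟨Finset.mem_insert_of_mem h₁, h₂, (hH _ h₁).symm ▸ h₃, h₄⟩
  own_zero := h.own_zero
  coef_lt := h.coef_lt
  cover c' hc' j hj hjH := by
    rcases Finset.mem_insert.1 hc' with rfl | hc'
    · omega
    · exact h.cover c' hc' j hj (hH _ hc' ▸ hjH)

theorem erase_zero (h : Owned p A C H) {c : ℕ} (h0 : H c = 0) : Owned p A (C.erase c) H where
  of_ne r hr hrp hne := by
    obtain ⟨h₁, h₂, h₃, h₄⟩ := h.of_ne r hr hrp hne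
    refine ⟨Finset.mem_erase.2 ⟨?_, h₁⟩, h₂, h₃, h₄⟩
    intro e
    rw [e] at h₃
    omega
  own_zero := h.own_zero
  coef_lt := h.coef_lt
  cover c' hc' j hj hjH := h.cover c' (Finset.mem_of_mem_erase hc') j hj hjH

/-- The coefficients of a first collision are coprime. -/
theorem coprime_of_collision (h : Owned p A C H) (hp : p.Prime) {T t v : ℕ} (hv : 1 ≤ v)
    (hvp : v < p)
    (hT : T ∈ C) (hdT : A .dir T = v) (hH : ∀ c ∈ C, H c < p)
    (htp : t < p) (hfree : ∀ j, H T < j → j < t → A .own (j * v % p) = 0) (hC : ∀ c ∈ C, 1 ≤ c)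
    (ht : H T < t) (hne : A .own (t * v % p) ≠ 0) :
    A .own (t * v % p) ≠ T ∧ t.Coprime (A .coef (t * v % p)) := by
  subst hdT
  set D := A .own (t * A .dir T % p) with hD
  set y := A .coef (t * A .dir T % p) with hy
  have hr := mul_mod_pos hp (by omega) htp hv hvp
  obtain ⟨h₁, h₂, h₃, h₄⟩ := h.of_ne _ hr (Nat.mod_lt _ hp.pos) hne
  rw [← hD, ← hy] at h₃ h₄
  rw [← hD] at h₁
  -- Cells owned by `T` have coefficients at most `H T < t`, and the multiples of `v` by numbers
  -- below `p` are distinct.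
  have hDT : D ≠ T := by
    intro e
    rw [e] at h₃ h₄
    have h₅ := hH T hT
    have := mul_mod_inj hp (by omega) htp hv hvp h₄
    omega
  refine ⟨hDT, ?_⟩
  by_contra hg
  -- Cancelling the common factor modulo `p` gives the collision `(t / e) * v = (y / e) * dir D`.
  -- That residue is owned by `D`; but its coefficient in `T` is below `t`, so it is either held by
  -- `T` or was found free by the scan.
  set e := Nat.gcd t y with he
  have he0 : 0 < e := Nat.gcd_pos_of_pos_left _ (by omega)
  obtain ⟨t', ht'⟩ : e ∣ t := Nat.gcd_dvd_left _ _
  obtain ⟨y', hy'⟩ : e ∣ y := Nat.gcd_dvd_right _ _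
  have he1 : 2 ≤ e := by
    have : e ≠ 1 := hg
    omega
  have ht'0 : 1 ≤ t' := Nat.pos_of_ne_zero (by rintro rfl; omega)
  have hy'0 : 1 ≤ y' := Nat.pos_of_ne_zero (by rintro rfl; omega)
  have htlt : t' < t := by nlinarith
  have hylt : y' < y := by nlinarith
  have hmod : e * (y' * A .dir D) ≡ e * (t' * A .dir T) [MOD p] := by
    rw [← mul_assoc, ← mul_assoc, ← ht', ← hy']
    exact h₄
  have hep : Nat.gcd p e = 1 :=
    Nat.coprime_of_lt_prime he0.ne' (by nlinarith) hp
  have hmod' : y' * A .dir D % p = t' * A .dir T % p := Nat.ModEq.cancel_left_of_coprime hep hmod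
  have hcov := (h.cover D h₁ y' hy'0 (by omega)).1
  rw [hmod'] at hcov
  by_cases hle : t' ≤ H T
  · exact hDT (hcov.symm.trans (h.cover T hT t' ht'0 hle).1)
  · have := hfree t' (by omega) htlt
    have := hC D h₁
    omega

end Owned

/-! ## The inner loops -/

section Loops

variable {p w S : ℕ} {σ : State Var Arr}

/-- Powers of `p` serve as atoms for `omega`. The doublings absorb sums, so that intermediate values
are seen to stay below `p ^ 6`. -/
theorem pow_chain (hp : 2 ≤ p) :
    2 * p ≤ p ^ 2 ∧ 2 * p ^ 2 ≤ p ^ 3 ∧ 2 * p ^ 3 ≤ p ^ 4 ∧ 2 * p ^ 4 ≤ p ^ 5 ∧ 2 * p ^ 5 ≤ p ^ 6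
        := by
  have key : ∀ n, 2 * p ^ n ≤ p ^ (n + 1) := fun n => by
    rw [pow_succ, mul_comm]
    exact Nat.mul_le_mul_left _ hp
  refine ⟨?_, key 2, key 3, key 4, key 5⟩
  simpa using key 1

theorem wp_setup_loop (hp : 2 ≤ p) (hσ : σ.var .p = p) (hj : σ.var .j = 0) (hW : p ^ 6 < 2 ^ w)
    (hS : p ≤ S) :
    WP w S (while' (isLt Var.j Var.p)
      (wr .own Var.j 0 ;; wr .coef Var.j 0 ;; wr .act Var.j 0 ;; wr .out Var.j 0 ;;
        .j ::= Var.j + 1))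
      (fun time σ' => time ≤ 30 * p + 30 ∧ (∃ j, σ'.var = Function.update σ.var .j j) ∧
        σ'.arr .d = σ.arr .d ∧
        ∀ i < p, σ'.arr .own i = 0 ∧ σ'.arr .coef i = 0 ∧ σ'.arr .act i = 0 ∧ σ'.arr .out i = 0)
      σ := by
  have hpw := pow_chain hp
  -- In this and the next three loops, `30` generously bounds one iteration including its test.
  refine wp_loop (fun c σ' => ∃ j ≤ p, c = 30 * (p - j) ∧ σ'.var = Function.update σ.var .j j ∧
    σ'.arr .d = σ.arr .d ∧
    ∀ i < j, σ'.arr .own i = 0 ∧ σ'.arr .coef i = 0 ∧ σ'.arr .act i = 0 ∧ σ'.arr .out i = 0)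
    ?_ (c := 30 * p) ?_ ?_
  · rintro c σ' ⟨j, hjp, rfl, hv, hd, hi⟩
    have h₁ : σ'.var .j = j := by simp [hv]
    have h₂ : σ'.var .p = p := by simp [hv, hσ]
    simp only [wp_seq, wp_assign, wp_store, eval_rules, ok_rules, cost_rules, h₁, h₂,
      Function.update_self, ne_eq, reduceCtorEq, not_false_eq_true, Function.update_of_ne]
    refine ⟨⟨by omega, by omega⟩, fun hlt => ?_⟩
    refine ⟨⟨by omega, by omega, by omega⟩, ⟨by omega, by omega, by omega⟩,
      ⟨by omega, by omega, by omega⟩, ⟨by omega, by omega, by omega⟩,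
      ⟨by omega, by omega, by omega⟩, 30 * (p - (j + 1)), by omega, j + 1, by omega, rfl, ?_, hd,
          ?_⟩
    · rw [hv, Function.update_idem]
    · intro i hij
      rcases Nat.lt_succ_iff_lt_or_eq.1 hij with h | rfl
      · have := hi i h
        simpa [Function.update_of_ne h.ne] using this
      · simp
  · refine ⟨0, by omega, by omega, ?_, rfl, by simp⟩
    rw [← hj, Function.update_eq_self]
  · rintro c' t σ' ⟨j, hjp, rfl, hv, hd, hi⟩ hb ht
    have h₁ : σ'.var .j = j := by simp [hv]
    have h₂ : σ'.var .p = p := by simp [hv, hσ]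
    simp only [eval_rules, cost_rules, h₁, h₂] at hb ht
    obtain rfl : j = p := by omega
    exact ⟨by omega, ⟨_, hv⟩, hd, hi⟩

theorem wp_scan_loop {h v l : ℕ} (hp : 2 ≤ p) (hσ : σ.var .p = p) (hv : σ.var .v = v)
    (hl : σ.var .l = l) (ht : σ.var .t = h + 1) (hvp : v < p) (hlp : l < p) (hhl : h ≤ l)
    (hown : ∀ r < p, σ.arr .own r < p) (hW : p ^ 6 < 2 ^ w) (hS : p ≤ S) :
    WP w S (while' (both (isLe Var.t Var.l) (isEq (rd .own ((Var.t * Var.v) % Var.p)) 0))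
      (.t ::= Var.t + 1))
      (fun time σ' => ∃ t, σ' = ⟨Function.update σ.var .t t, σ.arr⟩ ∧ h < t ∧ t ≤ l + 1 ∧
        time ≤ 30 * (t - h) + 30 ∧ (∀ j, h < j → j < t → σ.arr .own (j * v % p) = 0) ∧
        (t ≤ l → σ.arr .own (t * v % p) ≠ 0)) σ := by
  have hpw := pow_chain hp
  refine wp_loop (fun c σ' => ∃ t, σ' = ⟨Function.update σ.var .t t, σ.arr⟩ ∧ h < t ∧ t ≤ l + 1 ∧
    c = 30 * (l + 1 - t) ∧ (∀ j, h < j → j < t → σ.arr .own (j * v % p) = 0))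
    ?_ (c := 30 * (l - h)) ?_ ?_
  · rintro c σ' ⟨t, rfl, hht, htl, rfl, hfree⟩
    have h₁ := Nat.mod_lt (t * v) (show 0 < p by omega)
    have h₂ := hown _ h₁
    have h₃ : t * v ≤ p ^ 2 := by
      rw [pow_two]
      exact Nat.mul_le_mul (by omega) hvp.le
    simp only [wp_assign, eval_rules, ok_rules, cost_rules, hσ, hv, hl, Function.update_self,
      ne_eq, reduceCtorEq, not_false_eq_true, Function.update_of_ne]
    refine ⟨by and_intros <;> omega, fun ⟨hle, hz⟩ => ⟨by omega, 30 * (l + 1 - (t + 1)), by omega,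
      t + 1, by rw [Function.update_idem], by omega, by omega, rfl, fun j hj hjt => ?_⟩⟩
    rcases Nat.lt_succ_iff_lt_or_eq.1 hjt with h | rfl
    · exact hfree j hj h
    · exact hz
  · exact ⟨h + 1, by rw [← ht, Function.update_eq_self], by omega, by omega, by omega,
      fun j hj hjt => by omega⟩
  · rintro c' time σ' ⟨t, rfl, hht, htl, rfl, hfree⟩ hb htime
    simp only [eval_rules, cost_rules, hσ, hv, hl, Function.update_self, ne_eq, reduceCtorEq,
      not_false_eq_true, Function.update_of_ne] at hb htime
    exact ⟨t, rfl, hht, htl, by omega, hfree, fun h hz => hb ⟨h, hz⟩⟩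

/-- A succession of `Owned.grow` steps: before cell `j` is written, `j - 1` cells are recorded, and
the remaining ones are still free because multiples of `v` are distinct. -/
theorem wp_install_loop {C : Finset ℕ} {H : ℕ → ℕ} {T h v l : ℕ} (hp : p.Prime)
    (hσ : σ.var .p = p) (hv : σ.var .v = v) (hl : σ.var .l = l) (hT : σ.var .T = T)
    (hj : σ.var .j = h + 1) (hv0 : 1 ≤ v) (hvp : v < p) (hlp : l < p) (hhl : h ≤ l)
    (hTC : T ∈ C) (hdT : σ.arr .dir T = v) (hHT : H T = h) (hC : ∀ c ∈ C, 1 ≤ c) (hTp : T < p)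
    (hO : Owned p σ.arr C H) (hfree : ∀ j, h < j → j ≤ l → σ.arr .own (j * v % p) = 0)
    (hW : p ^ 6 < 2 ^ w) (hS : p ≤ S) :
    WP w S (while' (isLe Var.j Var.l)
      (.r ::= (Var.j * Var.v) % Var.p ;; wr .own Var.r Var.T ;; wr .coef Var.r Var.j ;;
        .j ::= Var.j + 1))
      (fun time σ' => ∃ r j own coef,
        σ' = ⟨Function.update (Function.update σ.var .r r) .j j,
          Function.update (Function.update σ.arr .own own) .coef coef⟩ ∧
        time ≤ 30 * (l - h) + 30 ∧ Owned p σ'.arr C (Function.update H T l)) σ := by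
  have hpw := pow_chain hp.two_le
  refine wp_loop (fun c σ' => ∃ r j own coef,
      σ' = ⟨Function.update (Function.update σ.var .r r) .j j,
        Function.update (Function.update σ.arr .own own) .coef coef⟩ ∧
      h < j ∧ j ≤ l + 1 ∧ c = 30 * (l + 1 - j) ∧
      Owned p σ'.arr C (Function.update H T (j - 1)) ∧
      ∀ i, j ≤ i → i ≤ l → own (i * v % p) = 0)
    ?_ (c := 30 * (l - h)) ?_ ?_
  · rintro c σ' ⟨r, j, own, coef, rfl, hhj, hjl, rfl, hO', hfr⟩
    have h₁ := Nat.mod_lt (j * v) hp.pos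
    have h₃ : j * v ≤ p ^ 2 := by
      rw [pow_two]
      exact Nat.mul_le_mul (by omega) hvp.le
    simp only [wp_seq, wp_store, wp_assign, eval_rules, ok_rules, cost_rules, hσ, hv, hl, hT,
      Function.update_self, ne_eq, reduceCtorEq, not_false_eq_true, Function.update_of_ne]
    refine ⟨by and_intros <;> omega, fun hle => ?_⟩
    have h₄ := mul_mod_pos hp (by omega) (show j < p by omega) hv0 hvp
    refine ⟨by and_intros <;> omega, by and_intros <;> omega, by and_intros <;> omega,
      by and_intros <;> omega, 30 * (l + 1 - (j + 1)), by omega, j * v % p, j + 1,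
      Function.update own (j * v % p) T, Function.update coef (j * v % p) j, ?_, by omega, by omega,
      rfl, ?_, ?_⟩
    · congr 1
      · funext u
        cases u <;> simp
      · funext u
        cases u <;> simp
    · have := hO'.grow (T := T) (r := j * v % p) (A' := Function.update (Function.update σ.arr .own
        (Function.update own (j * v % p) T)) .coef (Function.update coef (j * v % p) j)) hTC h₄
        (by simp; omega) hC
        (by simp [hdT, Nat.sub_add_cancel (show 1 ≤ j by omega)])
        (by simpa using hfr j le_rfl hle) (by simp)
        (by simp [Nat.sub_add_cancel (show 1 ≤ j by omega)]) (by simp)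
      refine this.congr (by simp) (by simp) (by simp) fun c _ => ?_
      by_cases hc : c = T
      · subst hc
        simp
        omega
      · simp [hc]
    · intro i hji hil
      rw [Function.update_of_ne]
      · exact hfr i (by omega) hil
      · intro e
        have := mul_mod_inj hp (by omega) (by omega) hv0 hvp e
        omega
  · refine ⟨σ.var .r, h + 1, σ.arr .own, σ.arr .coef, ?_, by omega, by omega, by omega, ?_, ?_⟩
    · rw [← hj]
      simp
    · refine hO.congr (by simp) (by simp) (by simp) fun c _ => ?_
      by_cases hc : c = T
      · subst hc
        simp [hHT]
      · simp [hc]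
    · exact fun i hi hil => hfree i (by omega) hil
  · rintro c' time σ' ⟨r, j, own, coef, rfl, hhj, hjl, rfl, hO', hfr⟩ hb htime
    simp only [eval_rules, cost_rules, hl, Function.update_self, ne_eq, reduceCtorEq,
      not_false_eq_true, Function.update_of_ne] at hb htime
    obtain rfl : j = l + 1 := by omega
    exact ⟨r, l + 1, own, coef, rfl, by omega, hO'⟩

theorem wp_clearCells {v l : ℕ} {zv zl : Var} (hp : 2 ≤ p) (hσ : σ.var .p = p)
    (hv : σ.var zv = v) (hl : σ.var zl = l) (hzv : zv ≠ .j) (hzl : zl ≠ .j)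
    (hvp : v < p) (hlp : l < p) (hW : p ^ 6 < 2 ^ w) (hS : p ≤ S) :
    WP w S (clearCells zv zl)
      (fun time σ' => ∃ j own, σ' = ⟨Function.update σ.var .j j, Function.update σ.arr .own own⟩ ∧
        time ≤ 30 * l + 30 ∧ Cleared p (σ.arr .own) own v l) σ := by
  have hpw := pow_chain hp
  simp only [clearCells, wp_seq, wp_assign, eval_rules, ok_rules, cost_rules]
  refine ⟨by omega, wp_loop (fun c σ' => ∃ j own,
      σ' = ⟨Function.update σ.var .j j, Function.update σ.arr .own own⟩ ∧
      1 ≤ j ∧ j ≤ l + 1 ∧ c = 30 * (l + 1 - j) ∧ (∀ i, 1 ≤ i → i < j → own (i * v % p) = 0) ∧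
      ∀ r, (∀ i, 1 ≤ i → i < j → i * v % p ≠ r) → own r = σ.arr .own r)
    ?_ (c := 30 * l) ?_ ?_⟩
  · rintro c σ' ⟨j, own, rfl, hj, hjl, rfl, h₁, h₂⟩
    have h₃ : j * v ≤ p ^ 2 := by
      rw [pow_two]
      exact Nat.mul_le_mul (by omega) hvp.le
    have h₄ := Nat.mod_lt (j * v) (show 0 < p by omega)
    simp only [wp_seq, wp_store, wp_assign, eval_rules, ok_rules, cost_rules, hσ, hv, hl,
      Function.update_self, ne_eq, reduceCtorEq, not_false_eq_true, Function.update_of_ne, hzv,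
      hzl]
    refine ⟨by and_intros <;> omega, fun hle => ⟨by and_intros <;> omega, by and_intros <;> omega,
      30 * (l + 1 - (j + 1)), by omega, j + 1, Function.update own (j * v % p) 0, by simp,
      by omega, by omega, rfl, ?_, ?_⟩⟩
    · intro i hi hij
      by_cases e : i * v % p = j * v % p
      · rw [e, Function.update_self]
      · rw [Function.update_of_ne e]
        refine h₁ i hi ?_
        have : i ≠ j := by
          rintro rfl
          exact e rfl
        omega
    · intro r hr
      rw [Function.update_of_ne (Ne.symm (hr j hj (by omega)))]
      exact h₂ r fun i hi hij => hr i hi (by omega)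
  · exact ⟨1, σ.arr .own, by simp, le_rfl, by omega, by omega, fun i hi hij => by omega,
      fun r _ => rfl⟩
  · rintro c' time σ' ⟨j, own, rfl, hj, hjl, rfl, h₁, h₂⟩ hb htime
    simp only [eval_rules, cost_rules, hl, Function.update_self, ne_eq, not_false_eq_true,
      Function.update_of_ne, hzl] at hb htime
    obtain rfl : j = l + 1 := by omega
    exact ⟨l + 1, own, rfl, by omega, fun i hi hil => h₁ i hi (by omega),
      fun r hr => h₂ r fun i hi hij => hr i hi (by omega)⟩

end Loops

/-! ## A merge -/

section Merge

variable {p w S : ℕ} {σ : State Var Arr}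

theorem inv_mul_modEq {x y : ℕ} (hx : x ≠ 0) (h : y.Coprime x) :
    (modInvNat y x) * y ≡ 1 [MOD x] := by
  have : NeZero x := ⟨hx⟩
  rw [modInvNat, ← ZMod.natCast_eq_natCast_iff]
  push_cast
  rw [ZMod.natCast_zmod_val, mul_comm, ZMod.coe_mul_inv_eq_one _ h]

/-- The outcome of the three cases of a merge: the identity `T'` and the held prefix `h'` of the
new component, the new owner array and the stored inverse. -/
def MergeCase (p : ℕ) (own own' : ℕ → ℕ) (T D T' v w h m h' x y : ℕ) (time : ℕ) : Prop :=
  (x = 1 ∧ T' = D ∧ h' = m ∧ own' = own ∧ time ≤ 300) ∨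
  (1 < x ∧ y = 1 ∧ T' = T ∧ h' = h ∧ Cleared p own own' w m ∧ time ≤ 30 * m + 300) ∨
  (1 < x ∧ 1 < y ∧ T' = T ∧ h' = 0 ∧ (∃ own₁, Cleared p own own₁ w m ∧ Cleared p own₁ own' v h) ∧
    time ≤ 30 * (m + h) + 300)

/-- The case distinction of `mergeStep`. -/
def mergeCases : P :=
  ifte (isEq Var.x 1)
    (.F ::= 0 ;; .L ::= Var.m + Var.l * Var.y ;; .inv ::= 0 ;;
      .T ::= Var.D ;; .h ::= Var.m)
    (ifte (isEq Var.y 1)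
      (.F ::= 0 ;; .L ::= Var.l + Var.m * Var.x ;; .inv ::= 0 ;;
        clearCells Var.w Var.m)
      (.F ::= (Var.x - 1) * (Var.y - 1) ;;
        .L ::= Var.m * Var.x + Var.l * Var.y - 2 * Var.F ;;
        .inv ::= modInv Var.y Var.x ;;
        clearCells Var.w Var.m ;; clearCells Var.v Var.h ;; .h ::= 0))

/-- Isolated so that the code after the case distinction is executed symbolically once instead of
three times. The three branches agree on `F` and `L`: the general formulas specialize correctly when
`x = 1` or `y = 1`. -/
theorem wp_mergeCases {T D v u l h m x y : ℕ} (hp : 2 ≤ p) (hσ : σ.var .p = p)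
    (hT : σ.var .T = T) (hD : σ.var .D = D) (hv : σ.var .v = v) (hu : σ.var .w = u)
    (hl : σ.var .l = l) (hh : σ.var .h = h) (hm : σ.var .m = m) (hx : σ.var .x = x)
    (hy : σ.var .y = y) (hDp : D < p) (hvp : v < p) (hup : u < p) (hlp : l < p)
    (hhp : h < p) (hmp : m < p) (hx1 : 1 ≤ x) (hxp : x < p) (hy1 : 1 ≤ y) (hyp : y < p)
    (hxl : x ≤ l) (hym : y ≤ m) (hxy : x.Coprime y) (hW : p ^ 6 < 2 ^ w) (hS : p ≤ S) :
    WP w S mergeCases (fun time σ' => ∃ T' h' inv j own, σ' =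
      ⟨Function.update (Function.update (Function.update (Function.update (Function.update
        (Function.update σ.var .F ((x - 1) * (y - 1))) .L (mergeLen l m x y)) .inv inv) .T T')
          .h h') .j j, Function.update σ.arr .own own⟩ ∧ inv < p ∧
      (1 < x → 1 < y → inv * y ≡ 1 [MOD x]) ∧
      MergeCase p (σ.arr .own) own T D T' v u h m h' x y time) σ := by
  have hpw := pow_chain hp
  have b₁ : m * x ≤ p ^ 2 := by
    rw [pow_two]
    exact Nat.mul_le_mul hmp.le hxp.le
  have b₂ : l * y ≤ p ^ 2 := by
    rw [pow_two]
    exact Nat.mul_le_mul hlp.le hyp.le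
  have b₃ : (x - 1) * (y - 1) ≤ p ^ 2 := by
    rw [pow_two]
    exact Nat.mul_le_mul (by omega) (by omega)
  simp only [mergeCases, wp_cond, wp_seq, wp_assign, eval_rules, ok_rules, cost_rules, hD,
    hl, hm, hx, hy, Function.update_self, ne_eq, reduceCtorEq, not_false_eq_true,
    Function.update_of_ne]
  refine ⟨by and_intros <;> omega, fun hx => ?_, fun hx' => ⟨by and_intros <;> omega, fun hy => ?_,
    fun hy' => ?_⟩⟩
  · subst hx
    refine ⟨by omega, by and_intros <;> omega, by omega, by omega, by omega, D, m, 0, σ.var .j,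
      σ.arr .own, ?_, by omega, by omega, .inl ⟨rfl, rfl, rfl, rfl, by omega⟩⟩
    congr 1
    · funext q
      cases q <;> simp [mergeLen, *]
    · simp
  · subst hy
    refine ⟨by omega, by and_intros <;> omega, by omega, (wp_clearCells (v := u) (l := m) hp
      (by simpa using hσ) (by simpa using hu) (by simpa using hm) (by simp) (by simp) hup hmp hW
      hS).mono ?_⟩
    rintro t σ' ⟨j, own, rfl, ht, hcl⟩
    refine ⟨T, h, 0, j, own, ?_, by omega, by omega,
      .inr (.inl ⟨by omega, rfl, rfl, rfl, hcl, by omega⟩)⟩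
    congr 1
    funext q
    cases q <;> simp [mergeLen, *, Nat.add_comm]
  · have hle : 2 * ((x - 1) * (y - 1)) < 2 ^ w := by omega
    have hvi : modInvNat y x < x := by
      have : NeZero x := ⟨by omega⟩
      exact ZMod.val_lt _
    refine ⟨by and_intros <;> omega, by and_intros <;> omega,
      ⟨by omega, by omega, by omega, hxy.symm⟩, (wp_clearCells (v := u) (l := m) hp
      (by simpa using hσ) (by simpa using hu) (by simpa using hm) (by simp) (by simp) hup hmp hW
      hS).mono ?_⟩
    rintro t σ' ⟨j, own, rfl, ht, hcl⟩
    refine (wp_clearCells (v := v) (l := h) hp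
      (by simpa using hσ) (by simpa using hv) (by simpa using hh) (by simp) (by simp) hvp hhp hW
      hS).mono ?_
    rintro t' σ' ⟨j', own', rfl, ht', hcl'⟩
    refine ⟨by omega, T, 0, (modInvNat y x), j', own', ?_, by omega,
      fun _ _ => inv_mul_modEq (by omega) hxy.symm,
      .inr (.inr ⟨by omega, by omega, rfl, rfl, ⟨own, hcl, by simpa using hcl'⟩, by omega⟩)⟩
    congr 1
    · funext q
      cases q <;> simp [mergeLen, *]
    · simp

-- Pure symbolic execution, with no invariant involved; `Owned.merge` and `Forest.merge` give the
-- resulting arrays their meaning.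
set_option maxHeartbeats 400000 in
theorem wp_mergeStep {T D v u l h m x y nn total ξ ζ a b : ℕ} (hp : p.Prime) (hσ : σ.var .p = p)
    (hT : σ.var .T = T) (ht : σ.var .t = x) (hv : σ.var .v = v) (hl : σ.var .l = l)
    (hh : σ.var .h = h) (hnn : σ.var .nn = nn) (htot : σ.var .total = total)
    (hD : σ.arr .own (x * v % p) = D) (hy : σ.arr .coef (x * v % p) = y) (hu : σ.arr .dir D = u)
    (hm : σ.arr .len D = m) (hξ : σ.arr .off T = ξ) (hζ : σ.arr .off D = ζ)
    (ha : σ.arr .root T = a) (hb : σ.arr .root D = b)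
    (hTp : T < p) (hDp : D < p) (hvp : v < p) (hup : u < p) (hlp : l < p)
    (hhp : h < p) (hmp : m < p) (hx1 : 1 ≤ x) (hy1 : 1 ≤ y)
    (hxl : x ≤ l) (hym : y ≤ m) (hxy : x.Coprime y) (hnp : nn < 2 * p) (htp : total < p)
    (hξp : ξ < p) (hζp : ζ < p) (hap : a ≤ 2 * p) (hbp : b ≤ 2 * p)
    (hW : p ^ 6 < 2 ^ w) (hS : 2 * p < S) :
    WP w S mergeStep (fun time σ' => ∃ T' h' inv own time', time ≤ time' + 300 ∧ inv < p ∧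
      (1 < x → 1 < y → inv * y ≡ 1 [MOD x]) ∧
      MergeCase p (σ.arr .own) own T D T' v u h m h' x y time' ∧
      (∀ q ∈ ({.p, .tau, .k} : Finset Var), σ'.var q = σ.var q) ∧
      σ'.var .nn = nn + 1 ∧ σ'.var .T = T' ∧ σ'.var .h = h' ∧ σ'.var .total = total - m ∧
      (∀ q ∈ ({.d, .out, .coef} : Finset Arr), σ'.arr q = σ.arr q) ∧
      σ'.arr .own = own ∧
      (∀ q ∈ nodeArrays, ∀ i ≤ nn, σ'.arr q i = σ.arr q i) ∧
      σ'.arr .kind (nn + 1) = 2 ∧ σ'.arr .chA (nn + 1) = a ∧ σ'.arr .chB (nn + 1) = b ∧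
      σ'.arr .lenA (nn + 1) = l ∧ σ'.arr .lenB (nn + 1) = m ∧ σ'.arr .cx (nn + 1) = x ∧
      σ'.arr .cy (nn + 1) = y ∧ σ'.arr .cinv (nn + 1) = inv ∧
      σ'.arr .dir = Function.update (σ.arr .dir) T' (v * modInvNat y p % p) ∧
      σ'.arr .off = Function.update (σ.arr .off) T' (((ξ + ζ) % p + (x - 1) * (y - 1) *
        (v * modInvNat y p % p)) % p) ∧
      σ'.arr .root = Function.update (σ.arr .root) T' (nn + 1) ∧
      σ'.arr .len = Function.update (σ.arr .len) T' (min (mergeLen l m x y) (p - 1)) ∧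
      ((p - 1 ≤ mergeLen l m x y ∧ σ'.var .merging = 0 ∧ σ'.var .done = 1 ∧ σ'.var .full = T' ∧
          σ'.arr .act = Function.update (Function.update (σ.arr .act) D 0) T' 1) ∨
        (mergeLen l m x y < p - 1 ∧ (∀ q ∈ ({.merging, .done, .full} : Finset Var),
          σ'.var q = σ.var q) ∧ σ'.arr .act = Function.update (σ.arr .act) D 0))) σ := by
  have hpw := pow_chain hp.two_le
  have h₁ : x * v ≤ p ^ 2 := by
    rw [pow_two]
    exact Nat.mul_le_mul (by omega) hvp.le
  have h₂ := Nat.mod_lt (x * v) hp.pos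
  have h₃ : modInvNat y p < p := by
    have : NeZero p := ⟨hp.ne_zero⟩
    exact ZMod.val_lt _
  have h₄ : v * modInvNat y p ≤ p ^ 2 := by
    rw [pow_two]
    exact Nat.mul_le_mul hvp.le h₃.le
  have h₅ : y.Coprime p := (Nat.coprime_of_lt_prime (by omega) (by omega) hp).symm
  generalize hι : modInvNat y p = ι at *
  have h₆ := Nat.mod_lt (v * ι) hp.pos
  have h₇ : (x - 1) * (y - 1) ≤ p ^ 2 := by
    rw [pow_two]
    exact Nat.mul_le_mul (by omega) (by omega)
  have h₈ : (x - 1) * (y - 1) * (v * ι % p) ≤ p ^ 3 := by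
    rw [pow_succ]
    exact Nat.mul_le_mul h₇ h₆.le
  have h₉ := Nat.mod_lt (ξ + ζ) hp.pos
  have h₁₀ : mergeLen l m x y ≤ p ^ 3 := by
    have b₁ : m * x ≤ p ^ 2 := by
      rw [pow_two]
      exact Nat.mul_le_mul (by omega) (by omega)
    have b₂ : l * y ≤ p ^ 2 := by
      rw [pow_two]
      exact Nat.mul_le_mul (by omega) (by omega)
    unfold mergeLen
    omega
  rw [mergeStep, ← mergeCases]
  simp only [wp_seq, wp_assign, wp_store, eval_rules, ok_rules, cost_rules, hσ, hT, hD, hv, hu, hl,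
    hm, hy, ht, hnn, hξ, hζ, ha, hb, hι, htot, Function.update_self, ne_eq, reduceCtorEq,
    not_false_eq_true, Function.update_of_ne]
  -- The eighteen assignments and stores that precede the case distinction.
  iterate 18 refine ⟨by and_intros <;> omega, ?_⟩
  refine (wp_mergeCases (T := T) (D := D) (v := v) (u := u) (l := l) (h := h) (m := m) (x := x)
    (y := y) hp.two_le (by simp [hσ]) (by simp [hT]) (by simp) (by simp [hv]) (by simp)
    (by simp [hl]) (by simp [hh]) (by simp) (by simp) (by simp) hDp hvp hup hlp hhp hmp hx1
    (by omega) hy1 (by omega) hxl hym hxy hW (by omega)).mono ?_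
  rintro time _ ⟨T', h', inv, j, own, rfl, hinv, hmod, hcase⟩
  have hT'p : T' < p := by
    rcases hcase with h | h | h <;> omega
  simp only [wp_seq, wp_cond, wp_assign, wp_store, eval_rules, ok_rules, cost_rules, hσ,
    Function.update_self, ne_eq, reduceCtorEq, not_false_eq_true, Function.update_of_ne]
  have hnew : ∀ (f : ℕ → ℕ) (c : ℕ), ∀ i ≤ nn, Function.update f (nn + 1) c i = f i :=
    fun f c i hi => Function.update_of_ne (by omega) _ _
  iterate 4 refine ⟨by and_intros <;> omega, ?_⟩
  refine ⟨by and_intros <;> omega, fun hfull => ?_, fun hfull => ?_⟩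
  · refine ⟨by omega, by omega, by omega, by omega, by omega, ?_⟩
    refine ⟨T', h', inv, own, time, ?_, hinv, hmod, hcase, ?_⟩
    · clear * -
      omega
    simp [nodeArrays, hfull]
    and_intros <;> exact hnew _ _
  · refine ⟨by omega, T', h', inv, own, time, ?_, hinv, hmod, hcase, ?_⟩
    · clear * -
      omega
    simp [nodeArrays, hfull]
    refine ⟨by and_intros <;> exact hnew _ _, ?_, by omega⟩
    rw [min_eq_left (by omega)]

end Merge

/-! ## Merging preserves the invariants -/

/-- Why a held prefix may stay: if `x = 1`, the new direction is that of `D`, so the cells of `D`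
keep their coefficients, and `T` held nothing because `h < x`. If `y = 1`, the new direction is that
of `T`, and the cells held by `T` keep theirs. If both exceed one, nothing recorded for either
component is kept. -/
theorem Owned.merge {p : ℕ} {A A' : Arr → ℕ → ℕ} {C : Finset ℕ} {T D T' h m h' x y g L time : ℕ}
    (hO : Owned p A (insert T C) (Function.update (A .len) T h)) (hp : p.Prime) (hT : T ∉ C)
    (hD : D ∈ C) (hid : ∀ c ∈ insert T C, 1 ≤ c)
    (hdirp : ∀ c ∈ insert T C, 1 ≤ A .dir c ∧ A .dir c < p)
    (hH : ∀ c ∈ insert T C, Function.update (A .len) T h c < p) (hm : A .len D = m) (hx : h < x)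
    (hcase : MergeCase p (A .own) (A' .own) T D T' (A .dir T) (A .dir D) h m h' x y time)
    (hcoef : A' .coef = A .coef) (hdir : A' .dir = Function.update (A .dir) T' g)
    (hlen : A' .len = Function.update (A .len) T' L) (hgx : x = 1 → g = A .dir D)
    (hgy : y = 1 → g = A .dir T) :
    Owned p A' (insert T' (C.erase D)) (Function.update (A' .len) T' h') := by
  have hDT : D ≠ T := fun e => hT (e ▸ hD)
  have hmT : m = Function.update (A .len) T h D := by rw [Function.update_of_ne hDT, hm]
  have hDi : D ∈ insert T C := Finset.mem_insert_of_mem hD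
  rcases hcase with ⟨h₁, rfl, rfl, ho, -⟩ | ⟨h₁, h₂, rfl, rfl, hcl, -⟩ |
    ⟨h₁, h₂, rfl, rfl, ⟨own₁, hcl, hcl'⟩, -⟩
  · have := hO.erase_zero (c := T) (by simp; omega)
    rw [Finset.erase_insert hT] at this
    rw [Finset.insert_erase hD]
    refine this.congr ho hcoef (fun c _ => ?_) fun c hc => ?_
    · rw [hdir, hgx h₁, Function.update_eq_self]
    · have hcT : c ≠ T := fun e => hT (e ▸ hc)
      by_cases e : c = T'
      · rw [e, Function.update_self, Function.update_of_ne hDT, hm]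
      · rw [Function.update_of_ne e, Function.update_of_ne hcT, hlen, Function.update_of_ne e]
  · have := hO.clear (A' := A') hp hDi hid (hmT ▸ hcl) hdirp hH hcoef
      (fun c _ => by rw [hdir, hgy h₂, Function.update_eq_self])
    rw [Finset.erase_insert_of_ne hDT.symm] at this
    refine this.congr rfl rfl (fun _ _ => rfl) fun c _ => ?_
    by_cases e : c = T'
    · simp [e]
    · rw [Function.update_of_ne e, Function.update_of_ne e, hlen, Function.update_of_ne e]
  · have e₁ := hO.clear (A' := Function.update A .own own₁) hp hDi hid
      (by simpa [← hmT] using hcl) hdirp hH (by simp) (fun c _ => by simp)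
    rw [Finset.erase_insert_of_ne hDT.symm] at e₁
    have hsub : insert T' (C.erase D) ⊆ insert T' C :=
      Finset.insert_subset_insert _ (Finset.erase_subset _ _)
    have hTe : T' ∉ C.erase D := fun h => hT (Finset.mem_of_mem_erase h)
    have e₂ := e₁.clear (A' := Function.update A .own (A' .own)) (D := T') hp
      (Finset.mem_insert_self _ _) (fun c hc => hid c (hsub hc)) (by simpa using hcl')
      (fun c hc => by simpa using hdirp c (hsub hc)) (fun c hc => hH c (hsub hc)) (by simp)
      (fun c _ => by simp)
    rw [Finset.erase_insert hTe] at e₂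
    have hne : ∀ c ∈ C.erase D, c ≠ T' := fun c hc e => hTe (e ▸ hc)
    have e₃ : Owned p A' (C.erase D) (Function.update (A .len) T' h) :=
      e₂.congr (by simp) (by simp [hcoef])
        (fun c hc => by simp [hdir, Function.update_of_ne (hne c hc)]) fun _ _ => rfl
    refine e₃.insert_zero hTe (fun c hc => ?_) (by simp)
    rw [Function.update_of_ne (hne c hc), Function.update_of_ne (hne c hc), hlen,
      Function.update_of_ne (hne c hc)]

/-- The new root is beyond all existing nodes, and only the record `T'`, one of the two consumed, is
overwritten. An upper bound on `L` suffices, which also covers the truncation to `p - 1`. -/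
theorem Forest.merge {p : ℕ} [Fact p.Prime] {d : ℕ → ZMod p} {A A' : Arr → ℕ → ℕ} {nn k : ℕ}
    {C : Finset ℕ} {I : ℕ → Finset ℕ} {T D T' x y g L i : ℕ}
    (hF : Forest d A nn k (insert T C) I) (hT : T ∉ C) (hD : D ∈ C) (hT' : T' = T ∨ T' = D)
    (hx : 1 ≤ x) (hxl : x ≤ A .len T) (hy : 1 ≤ y) (hym : y ≤ A .len D) (hip : i < p)
    (hi : 1 < x → 1 < y → i * y ≡ 1 [MOD x]) (hg : 1 ≤ g) (hgp : g < p)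
    (hgT : (A .dir T : ZMod p) = y * g) (hgD : (A .dir D : ZMod p) = x * g)
    (hL : 1 ≤ L) (hLp : L < p) (hLm : L ≤ mergeLen (A .len T) (A .len D) x y)
    (hn : ∀ q ∈ nodeArrays, ∀ i ≤ nn, A' q i = A q i)
    (hkind : A' .kind (nn + 1) = 2) (hchA : A' .chA (nn + 1) = A .root T)
    (hchB : A' .chB (nn + 1) = A .root D) (hlenA : A' .lenA (nn + 1) = A .len T)
    (hlenB : A' .lenB (nn + 1) = A .len D) (hcx : A' .cx (nn + 1) = x)
    (hcy : A' .cy (nn + 1) = y) (hcinv : A' .cinv (nn + 1) = i)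
    (hdir : A' .dir = Function.update (A .dir) T' g)
    (hoff : A' .off = Function.update (A .off) T'
      (((A .off T + A .off D) % p + (x - 1) * (y - 1) * g) % p))
    (hroot : A' .root = Function.update (A .root) T' (nn + 1))
    (hlen : A' .len = Function.update (A .len) T' L) :
    Forest d A' (nn + 1) k (insert T' (C.erase D)) (Function.update I T' (I T ∪ I D)) := by
  have hp : p.Prime := Fact.out
  have hDT : D ≠ T := fun e => hT (e ▸ hD)
  have cT := hF.comp T (Finset.mem_insert_self _ _)
  have cD := hF.comp D (Finset.mem_insert_of_mem hD)
  have hdisj := hF.disj T (Finset.mem_insert_self _ _) D (Finset.mem_insert_of_mem hD) hDT.symm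
  have hne : ∀ c ∈ C.erase D, c ≠ T' := fun c hc => by
    obtain ⟨h₁, h₂⟩ := Finset.mem_erase.1 hc
    rintro rfl
    rcases hT' with rfl | rfl
    · exact hT h₂
    · exact h₁ rfl
  have hdis : ∀ c ∈ C.erase D, Disjoint (I c) (I T ∪ I D) := fun c hc => by
    obtain ⟨h₁, h₂⟩ := Finset.mem_erase.1 hc
    rw [Finset.disjoint_union_right]
    exact ⟨hF.disj c (Finset.mem_insert_of_mem h₂) T (Finset.mem_insert_self _ _)
      fun e => hT (e ▸ h₂), hF.disj c (Finset.mem_insert_of_mem h₂) D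
      (Finset.mem_insert_of_mem hD) h₁⟩
  constructor
  · intro c hc
    by_cases e : c = T'
    · subst e
      rw [Function.update_self]
      exact {
        id_pos := by rcases hT' with rfl | rfl; exacts [cT.id_pos, cD.id_pos]
        id_le := by rcases hT' with rfl | rfl; exacts [cT.id_le, cD.id_le]
        dir_pos := by simpa [hdir] using hg
        dir_lt := by simpa [hdir] using hgp
        len_pos := by simpa [hlen] using hL
        len_lt := by simpa [hlen] using hLp
        off_lt := by simpa [hoff] using Nat.mod_lt _ hp.pos
        root_le := by simp [hroot]
        sub := Finset.union_subset cT.sub cD.sub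
        enc := by
          simp only [hdir, hlen, hoff, hroot, Function.update_self]
          refine .merge (v := A .dir T) (w := A .dir D) (ξ := A .off T) (ζ := A .off D) hkind
            (by rw [hchA]; have := cT.root_le; omega) (by rw [hchB]; have := cD.root_le; omega)
            (by rw [hlenA]; exact cT.len_lt) (by rw [hlenB]; exact cD.len_lt)
                (by rw [hcx]; exact hx)
            (by rw [hcx, hlenA]; exact hxl) (by rw [hcy]; exact hy) (by rw [hcy, hlenB]; exact hym)
            (by rw [hcx, hcy, hcinv]; exact hi) (by rw [hcinv]; exact hip)
            (by rw [hcx, hcy, hlenA, hlenB]; exact hLm) (by rw [hcy]; exact hgT)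
            (by rw [hcx]; exact hgD) ?_ hdisj rfl ?_ ?_
          · rw [hcx, hcy]
            simp
          · rw [hchA, hlenA]
            exact cT.enc.congr fun a ha i hi => hn a ha i (hi.trans cT.root_le)
          · rw [hchB, hlenB]
            exact cD.enc.congr fun a ha i hi => hn a ha i (hi.trans cD.root_le) }
    · have hc' := Finset.mem_of_mem_insert_of_ne hc e
      rw [Function.update_of_ne e]
      refine (hF.comp c (Finset.mem_insert_of_mem (Finset.mem_of_mem_erase hc'))).congr
        (Nat.le_succ _) le_rfl hn ?_
      simp [hdir, hlen, hoff, hroot, Function.update_of_ne e]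
  · intro c hc c' hc' hcc
    by_cases e : c = T'
    · subst e
      have hc' := Finset.mem_of_mem_insert_of_ne hc' hcc.symm
      rw [Function.update_self, Function.update_of_ne (hne c' hc')]
      exact (hdis c' hc').symm
    · have hc₁ := Finset.mem_of_mem_insert_of_ne hc e
      rw [Function.update_of_ne e]
      by_cases e' : c' = T'
      · subst e'
        rw [Function.update_self]
        exact hdis c hc₁
      · have hc' := Finset.mem_of_mem_insert_of_ne hc' e'
        rw [Function.update_of_ne e']
        exact hF.disj c (Finset.mem_insert_of_mem (Finset.mem_of_mem_erase hc₁)) c'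
          (Finset.mem_insert_of_mem (Finset.mem_of_mem_erase hc')) hcc

/-! ## The states of the main loop -/

/-- The input data, the loop counter and the empty output. -/
structure Frame {p : ℕ} (d : ℕ → ZMod p) (τ : ZMod p) (k : ℕ) (σ : State Var Arr) : Prop where
  p_eq : σ.var .p = p
  tau_eq : σ.var .tau = τ.val
  k_eq : σ.var .k = k
  d_eq : ∀ j ∈ Finset.Icc 1 (p - 1), σ.arr .d j = (d j).val
  out_eq : ∀ j ∈ Finset.Icc 1 (p - 1), σ.arr .out j = 0

/-- `C` is the set of active components. -/
def Acts (p : ℕ) (A : Arr → ℕ → ℕ) (C : Finset ℕ) : Prop :=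
  ∀ j, 1 ≤ j → j < p → A .act j = if j ∈ C then 1 else 0

/-- There is no temporary component, and `k` residues have been inserted. -/
structure Idle {p : ℕ} (d : ℕ → ZMod p) (k : ℕ) (σ : State Var Arr) (C : Finset ℕ)
    (I : ℕ → Finset ℕ) : Prop where
  done : σ.var .done = 0
  full : σ.var .full = 0
  forest : Forest d σ.arr (σ.var .nn) k C I
  acts : Acts p σ.arr C
  owned : Owned p σ.arr C (σ.arr .len)
  total : σ.var .total = ∑ c ∈ C, σ.arr .len c
  grown : k ≤ σ.var .total
  nodes : σ.var .nn + C.card ≤ 2 * k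

/-- There is a temporary component, and `k` residues have been inserted. -/
structure Busy {p : ℕ} (d : ℕ → ZMod p) (k : ℕ) (σ : State Var Arr) (C : Finset ℕ)
    (I : ℕ → Finset ℕ) : Prop where
  merging : σ.var .merging = 1
  done : σ.var .done = 0
  full : σ.var .full = 0
  fresh : σ.var .T ∉ C
  forest : Forest d σ.arr (σ.var .nn) k (insert (σ.var .T) C) I
  acts : Acts p σ.arr C
  owned : Owned p σ.arr (insert (σ.var .T) C)
    (Function.update (σ.arr .len) (σ.var .T) (σ.var .h))
  held : σ.var .h < σ.arr .len (σ.var .T)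
  total : σ.var .total = ∑ c ∈ C, σ.arr .len c
  grown : k ≤ σ.var .total + σ.arr .len (σ.var .T)
  nodes : σ.var .nn + C.card + 1 ≤ 2 * k

/-- There is a full component. -/
structure Full {p : ℕ} (d : ℕ → ZMod p) (k : ℕ) (σ : State Var Arr) (C : Finset ℕ)
    (I : ℕ → Finset ℕ) : Prop where
  merging : σ.var .merging = 0
  done : σ.var .done = 1
  mem : σ.var .full ∈ C
  len : σ.arr .len (σ.var .full) = p - 1
  forest : Forest d σ.arr (σ.var .nn) k C I
  acts : Acts p σ.arr C
  total : σ.var .total < p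
  nodes : σ.var .nn ≤ 2 * k

/-- The potentials that pay for the running time. -/
def idlePotential (σ : State Var Arr) : ℕ := σ.var .nn + 5 * σ.var .total
def busyPotential (σ : State Var Arr) : ℕ :=
  σ.var .nn + 4 * (σ.var .total + σ.arr .len (σ.var .T)) + (σ.var .total + σ.var .h)

variable {p k w S : ℕ} {d : ℕ → ZMod p} {τ : ZMod p} {σ : State Var Arr} {C : Finset ℕ}
  {I : ℕ → Finset ℕ}

theorem Busy.held_lt (h : Busy d k σ C I) : ∀ c ∈ insert (σ.var .T) C,
    Function.update (σ.arr .len) (σ.var .T) (σ.var .h) c < p := by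
  intro c hc
  by_cases e : c = σ.var .T
  · subst e
    rw [Function.update_self]
    exact h.held.trans (h.forest.comp _ hc).len_lt
  · rw [Function.update_of_ne e]
    exact (h.forest.comp c hc).len_lt

/-- Only the held cells of the temporary component can be counted, since its other cells may
coincide with owned ones. -/
theorem Busy.total_lt (h : Busy d k σ C I) (hp : p.Prime) : σ.var .total + σ.var .h < p := by
  have hle := (h.owned.sum_le hp (fun c hc => (h.forest.comp c hc).id_pos)
    (fun c hc => ⟨(h.forest.comp c hc).dir_pos, (h.forest.comp c hc).dir_lt⟩) h.held_lt).1
  have hsum : ∑ c ∈ C, Function.update (σ.arr .len) (σ.var .T) (σ.var .h) c = σ.var .total := by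
    rw [h.total]
    refine Finset.sum_congr rfl fun c hc => Function.update_of_ne ?_ _ _
    rintro rfl
    exact h.fresh hc
  rw [Finset.sum_insert h.fresh, Function.update_self, hsum] at hle
  have := hp.pos
  omega

theorem Owned.own_lt {A : Arr → ℕ → ℕ} {H : ℕ → ℕ} (hO : Owned p A C H) (hp : p.Prime)
    (hC : ∀ c ∈ C, c < p) : ∀ r < p, A .own r < p := by
  intro r hr
  by_cases h : A .own r = 0
  · rw [h]
    exact hp.pos
  · refine hC _ (hO.of_ne r ?_ hr h).1
    rw [Nat.pos_iff_ne_zero]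
    rintro rfl
    exact h hO.own_zero

/-- The temporary component is installed. -/
theorem Busy.wp_install (hB : Busy d k σ C I) (hF : Frame d τ k σ) (hp : p.Prime) (hk : k < p)
    (hv : σ.var .v = σ.arr .dir (σ.var .T)) (hl : σ.var .l = σ.arr .len (σ.var .T))
    (hfree : ∀ j, σ.var .h < j → j ≤ σ.var .l → σ.arr .own (j * σ.var .v % p) = 0)
    (hW : p ^ 6 < 2 ^ w) (hS : 2 * p < S) :
    WP w S install (fun time σ' => time ≤ 30 * (σ.var .l - σ.var .h) + 100 ∧ Frame d τ k σ' ∧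
      σ'.var .merging = 0 ∧ Idle d k σ' (insert (σ.var .T) C) I ∧
      idlePotential σ' = busyPotential σ + (σ.var .l - σ.var .h)) σ := by
  have hpw := pow_chain hp.two_le
  have cT := hB.forest.comp _ (Finset.mem_insert_self _ _)
  obtain ⟨c₁, c₂, c₃, c₄, c₅, c₆, -, -, -, -⟩ := cT
  have htot := hB.total_lt hp
  have hheld := hB.held
  have hpe := hF.p_eq
  rw [← hv] at c₃ c₄
  rw [← hl] at c₅ c₆ hheld
  simp only [install, wp_seq, wp_assign, wp_store, eval_rules, ok_rules, cost_rules]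
  refine ⟨by omega, (wp_install_loop (σ := ⟨Function.update σ.var .j (σ.var .h + 1), σ.arr⟩)
    (C := insert (σ.var .T) C)
    (H := Function.update (σ.arr .len) (σ.var .T) (σ.var .h)) (T := σ.var .T) (h := σ.var .h)
    (v := σ.var .v) (l := σ.var .l) hp (by simp [hpe]) (by simp) (by simp) (by simp) (by simp) c₃
    c₄ c₆ hheld.le (Finset.mem_insert_self _ _) (by simp [hv]) (by simp)
    (fun c hc => (hB.forest.comp c hc).id_pos) (by omega) hB.owned hfree hW (by omega)).mono ?_⟩
  rintro time _ ⟨r, j, own, coef, rfl, htime, hO⟩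
  simp only [ne_eq, reduceCtorEq, not_false_eq_true, Function.update_of_ne]
  refine ⟨by omega, by omega, by omega, by omega, ?_, by simp, ?_, ?_⟩
  · exact ⟨by simp [hF.p_eq], by simp [hF.tau_eq], by simp [hF.k_eq], by simpa using hF.d_eq,
      by simpa using hF.out_eq⟩
  · constructor
    · simpa using hB.done
    · simpa using hB.full
    · constructor
      · intro c hc
        exact (hB.forest.comp c hc).congr (by simp) le_rfl (by simp [nodeArrays]) (by simp)
      · exact hB.forest.disj
    · intro j hj hjp
      have := hB.acts j hj hjp
      by_cases e : j = σ.var .T <;> simp [e, this]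
    · refine hO.congr (by simp) (by simp) (by simp) fun c _ => ?_
      by_cases e : c = σ.var .T <;> simp [e, hl]
    · simp [Finset.sum_insert hB.fresh, hB.total, hl, add_comm]
    · simpa [hl] using hB.grown
    · have := hB.nodes
      simp [Finset.card_insert_of_notMem hB.fresh]
      omega
  · simp only [idlePotential, busyPotential, Function.update_self, ne_eq, reduceCtorEq,
      not_false_eq_true, Function.update_of_ne, ← hl]
    omega

theorem natCast_div_mod [Fact p.Prime] {v y : ℕ} (hy : 1 ≤ y) (hyp : y < p) :
    ((v * modInvNat y p % p : ℕ) : ZMod p) = v / y ∧ (y : ZMod p) ≠ 0 := by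
  have : (y : ZMod p) ≠ 0 := fun h => by
    have := Nat.le_of_dvd hy ((ZMod.natCast_eq_zero_iff _ _).1 h)
    omega
  refine ⟨?_, this⟩
  rw [ZMod.natCast_mod]
  push_cast
  rw [modInvNat, ZMod.natCast_zmod_val, div_eq_mul_inv]

theorem natCast_inj_of_lt {a b : ℕ} (ha : a < p) (hb : b < p) (h : (a : ZMod p) = b) : a = b := by
  rw [ZMod.natCast_eq_natCast_iff] at h
  exact Nat.ModEq.eq_of_lt_of_lt h ha hb

/-- The temporary component is merged with an active one. -/
theorem Busy.wp_merge (hB : Busy d k σ C I) (hF : Frame d τ k σ) (hp : p.Prime) (hk : k < p)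
    (hv : σ.var .v = σ.arr .dir (σ.var .T)) (hl : σ.var .l = σ.arr .len (σ.var .T))
    (hfree : ∀ j, σ.var .h < j → j < σ.var .t → σ.arr .own (j * σ.var .v % p) = 0)
    (hht : σ.var .h < σ.var .t) (htl : σ.var .t ≤ σ.var .l)
    (hne : σ.arr .own (σ.var .t * σ.var .v % p) ≠ 0)
    (hW : p ^ 6 < 2 ^ w) (hS : 2 * p < S) :
    WP w S mergeStep (fun time σ' => Frame d τ k σ' ∧
      ((∃ C I, Busy d k σ' C I ∧ time + 40 * (σ.var .t - σ.var .h) + 300 ≤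
          1000 * (busyPotential σ' - busyPotential σ) ∧ busyPotential σ < busyPotential σ') ∨
        ∃ C I, Full d k σ' C I ∧ time ≤ 900 * p)) σ := by
  have : Fact p.Prime := ⟨hp⟩
  have cT := hB.forest.comp _ (Finset.mem_insert_self _ _)
  have htot := hB.total_lt hp
  have hheld := hB.held
  have hcp := hB.owned.coprime_of_collision hp (T := σ.var .T) (t := σ.var .t) (v := σ.var .v)
    (hv ▸ cT.dir_pos) (hv ▸ cT.dir_lt) (Finset.mem_insert_self _ _) hv.symm hB.held_lt
    (by have := cT.len_lt; omega) (by simpa using hfree)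
    (fun c hc => (hB.forest.comp c hc).id_pos) (by simpa using hht) hne
  have hr := mul_mod_pos hp (by omega) (by have := cT.len_lt; omega) (hv ▸ cT.dir_pos)
    (hv ▸ cT.dir_lt : σ.var .v < p) (a := σ.var .t)
  obtain ⟨h₁, h₂, h₃, h₄⟩ := hB.owned.of_ne _ hr (Nat.mod_lt _ hp.pos) hne
  obtain ⟨hDT, hxy⟩ := hcp
  generalize hD : σ.arr .own (σ.var .t * σ.var .v % p) = D at *
  generalize hy : σ.arr .coef (σ.var .t * σ.var .v % p) = y at *
  rw [Function.update_of_ne hDT] at h₃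
  have hDC : D ∈ C := Finset.mem_of_mem_insert_of_ne h₁ hDT
  have cD := hB.forest.comp D h₁
  have hyp : y < p := h₃.trans_lt cD.len_lt
  have hm := Finset.sum_erase_add C (σ.arr .len) hDC
  rw [← hB.total] at hm
  obtain ⟨hg, hy0⟩ := natCast_div_mod (v := σ.var .v) h₂ hyp
  have hgp : σ.var .v * modInvNat y p % p < p := Nat.mod_lt _ hp.pos
  generalize hgg : σ.var .v * modInvNat y p % p = g at hg hgp
  have hgT : (σ.arr .dir (σ.var .T) : ZMod p) = y * g := by
    rw [hg, hv, mul_div_cancel₀ _ hy0]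
  -- The collision `t * v = y * dir D`, divided by `y`.
  have hgD : (σ.arr .dir D : ZMod p) = σ.var .t * g := by
    have := congrArg (Nat.cast : ℕ → ZMod p) h₄
    simp only [ZMod.natCast_mod] at this
    push_cast at this
    rw [hg, mul_div_assoc', ← this, mul_div_cancel_left₀ _ hy0]
  have hg1 : 1 ≤ g := by
    rw [Nat.one_le_iff_ne_zero]
    rintro rfl
    have := cT.dir_pos
    rw [natCast_inj_of_lt cT.dir_lt hp.pos (by simpa using hgT)] at this
    omega
  obtain ⟨hL₁, hL₂⟩ := le_mergeLen (l := σ.var .l) (m := σ.arr .len D) (x := σ.var .t) (y := y)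
    (by omega) htl h₂ h₃
  have hk0 := cT.id_pos
  have hk1 := cT.id_le
  have hk2 := cD.id_le
  have hlT := cT.len_lt
  have hlD := cD.len_lt
  have hnodes := hB.nodes
  have hgrown := hB.grown
  have hlD1 := cD.len_pos
  have hcard := Finset.card_erase_add_one hDC
  refine (wp_mergeStep (T := σ.var .T) (D := D) (v := σ.var .v) (u := σ.arr .dir D) (l := σ.var .l)
    (h := σ.var .h) (m := σ.arr .len D) (x := σ.var .t) (y := y) (nn := σ.var .nn)
    (total := σ.var .total) hp hF.p_eq rfl rfl rfl rfl rfl rfl rfl hD hy rfl rfl rfl rfl rfl rfl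
    (by omega) (by omega) (hv ▸ cT.dir_lt) cD.dir_lt (by omega) (by omega) (by omega) (by omega) h₂
    htl h₃ hxy (by omega) (by omega) cT.off_lt cD.off_lt (by have := cT.root_le; omega)
    (by have := cD.root_le; omega) hW hS).mono ?_
  rintro time σ' ⟨T', h', inv, own, time', htime, hinv, hmod, hcase, hvars, hnn, hT', hh', htot',
    harrs, hown, hno, k₁, k₂, k₃, k₄, k₅, k₆, k₇, k₈, hdir, hoff, hroot, hlen, hact⟩
  rw [hgg] at hdir hoff
  have hT'D : T' = σ.var .T ∨ T' = D := by
    rcases hcase with h | h | h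
    exacts [.inr h.2.1, .inl h.2.2.1, .inl h.2.2.1]
  have hforest := hB.forest.merge (A' := σ'.arr) hB.fresh hDC hT'D (by omega) (by omega) h₂ h₃ hinv
    hmod hg1 hgp hgT hgD (L := min (mergeLen (σ.var .l) (σ.arr .len D) (σ.var .t) y) (p - 1))
    (by omega) (by omega) (by rw [← hl]; exact min_le_left _ _) hno k₁ k₂ k₃ (by rw [k₄, hl]) k₅
    k₆ k₇ k₈ hdir hoff hroot hlen
  rw [← hnn] at hforest
  have hT'n : T' ∉ C.erase D := by
    rcases hT'D with rfl | rfl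
    · exact fun h => hB.fresh (Finset.mem_of_mem_erase h)
    · exact Finset.notMem_erase _ _
  have hFrame : Frame d τ k σ' := by
    simp only [Finset.forall_mem_insert, Finset.mem_singleton,
      forall_eq] at hvars harrs
    obtain ⟨e₁, e₂, e₃⟩ := hvars
    obtain ⟨e₄, e₅, e₆⟩ := harrs
    exact ⟨e₁ ▸ hF.p_eq, e₂ ▸ hF.tau_eq, e₃ ▸ hF.k_eq, e₄ ▸ hF.d_eq, e₅ ▸ hF.out_eq⟩
  refine ⟨hFrame, ?_⟩
  have hlenT' : σ'.arr .len T' = min (mergeLen (σ.var .l) (σ.arr .len D) (σ.var .t) y) (p - 1) := by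
    rw [hlen, Function.update_self]
  rcases hact with ⟨hfull, hm0, hd1, hfl, hact⟩ | ⟨hfull, hflags, hact⟩
  · refine .inr ⟨_, _, ⟨hm0, hd1, hfl ▸ Finset.mem_insert_self _ _, ?_, hforest, ?_, ?_, ?_⟩, ?_⟩
    · rw [hfl, hlenT', min_eq_right hfull]
    · intro j hj hjp
      have := hB.acts j hj hjp
      rw [hact]
      by_cases e : j = T'
      · simp [e]
      · by_cases e' : j = D
        · subst e'
          simp [e]
        · simp [e, e', this]
    · omega
    · omega
    -- This merge is the last one, so a crude bound linear in `p` replaces the potential argument.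
    · rcases hcase with h | h | h <;> omega
  · simp only [Finset.forall_mem_insert, Finset.mem_singleton,
      forall_eq] at hflags
    obtain ⟨f₁, f₂, f₃⟩ := hflags
    have hown' := hB.owned.merge (A' := σ'.arr) (T' := T') (h' := h') hp hB.fresh hDC
      (fun c hc => (hB.forest.comp c hc).id_pos)
      (fun c hc => ⟨(hB.forest.comp c hc).dir_pos, (hB.forest.comp c hc).dir_lt⟩) hB.held_lt rfl hht
      (by rw [hown, ← hv]; exact hcase) (harrs _ (by decide)) hdir hlen
      (fun e => natCast_inj_of_lt hgp cD.dir_lt (by rw [hgD, e]; simp))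
      (fun e => natCast_inj_of_lt hgp cT.dir_lt (by rw [hgT, e]; simp))
    rw [min_eq_left (by omega)] at hlenT'
    have hbusy : Busy d k σ' (C.erase D) (Function.update I T' (I (σ.var .T) ∪ I D)) := by
      refine ⟨f₁ ▸ hB.merging, f₂ ▸ hB.done, f₃ ▸ hB.full, hT' ▸ hT'n, hT' ▸ hforest, ?_,
        hT' ▸ hh' ▸ hown', ?_, ?_, ?_, ?_⟩
      · intro j hj hjp
        have := hB.acts j hj hjp
        rw [hact]
        by_cases e' : j = D <;> simp [e', this]
      · rw [hT', hh', hlenT']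
        rcases hcase with h | h | h <;> omega
      · rw [htot', ← hm, Nat.add_sub_cancel]
        refine Finset.sum_congr rfl fun c hc => ?_
        rw [hlen, Function.update_of_ne]
        rintro rfl
        exact hT'n hc
      · rw [hT', hlenT']
        omega
      · omega
    refine .inl ⟨_, _, hbusy, ?_⟩
    simp only [busyPotential, hnn, hT', hh', htot', hlenT', ← hl]
    -- The amortized balance; the new node always contributes one. If `x = 1`, then `h = 0`, one
    -- cell is scanned, and the `m` cells leaving `total` reappear as held ones. If `y = 1 < x`, the
    -- recorded cells drop by `m`; if `x, y > 1`, they drop by `m + h` with `h ≤ x - 1`. In these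
    -- two cases the length gain, counted four times, is at least `2 * m + 2 * (x - 1)`, which
    -- covers the drop and still pays for clearing and scanning.
    rcases hcase with h | h | h <;> omega

/-! ## The loop over the input residues -/

section MainLoop

variable {p k w S : ℕ} {d : ℕ → ZMod p} {τ : ZMod p} {σ σ' : State Var Arr} {C : Finset ℕ}
  {I : ℕ → Finset ℕ}

theorem Busy.of_eq (h : Busy d k σ C I) (ha : σ'.arr = σ.arr)
    (hv : ∀ q ∈ ({.merging, .done, .full, .T, .h, .total, .nn} : Finset Var),
      σ'.var q = σ.var q) : Busy d k σ' C I := by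
  have e₁ := hv .merging (by decide)
  have e₂ := hv .done (by decide)
  have e₃ := hv .full (by decide)
  have e₄ := hv .T (by decide)
  have e₅ := hv .h (by decide)
  have e₆ := hv .total (by decide)
  have e₇ := hv .nn (by decide)
  constructor <;> simp only [ha, e₁, e₂, e₃, e₄, e₅, e₆, e₇]
  exacts [h.merging, h.done, h.full, h.fresh, h.forest, h.acts, h.owned, h.held, h.total, h.grown,
    h.nodes]

/-- The body of the inner loop. -/
def mergeBody : P := scan ;; ifte (isLt Var.l Var.t) install mergeStep

/-- Unless a full component arises, one round is paid for by the rise of the potential. The margin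
of `100` steps leaves room for the loop test. -/
theorem Busy.wp_mergeBody (hB : Busy d k σ C I) (hF : Frame d τ k σ) (hp : p.Prime) (hk : k < p)
    (hW : p ^ 6 < 2 ^ w) (hS : 2 * p < S) :
    WP w S mergeBody (fun time σ' => Frame d τ k σ' ∧
      ((∃ C I, Busy d k σ' C I ∧ time + 100 ≤ 1000 * (busyPotential σ' - busyPotential σ) ∧
          busyPotential σ < busyPotential σ') ∨
        (∃ C I, σ'.var .merging = 0 ∧ Idle d k σ' C I ∧ time + 100 ≤ 1000 *
            (idlePotential σ' - busyPotential σ) ∧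
          busyPotential σ < idlePotential σ') ∨
        ∃ C I, Full d k σ' C I ∧ time ≤ 1000 * p)) σ := by
  have hpw := pow_chain hp.two_le
  have cT := hB.forest.comp _ (Finset.mem_insert_self _ _)
  have hheld := hB.held
  have c₁ := cT.id_le
  have c₂ := cT.dir_lt
  have c₃ := cT.len_lt
  simp only [mergeBody, scan, wp_seq, wp_assign, eval_rules, ok_rules, cost_rules,
    ne_eq, reduceCtorEq, not_false_eq_true, Function.update_of_ne]
  refine ⟨by and_intros <;> omega, by and_intros <;> omega, by and_intros <;> omega, ?_⟩
  refine (wp_scan_loop (σ := ⟨Function.update (Function.update (Function.update σ.var .v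
      (σ.arr .dir (σ.var .T))) .l (σ.arr .len (σ.var .T))) .t (σ.var .h + 1), σ.arr⟩)
          (h := σ.var .h) (v := σ.arr .dir (σ.var .T)) (l := σ.arr .len (σ.var .T))
    hp.two_le (by simp [hF.p_eq]) (by simp) (by simp) (by simp) c₂ c₃ hheld.le
    (hB.owned.own_lt hp fun c hc => (hB.forest.comp c hc).id_le.trans_lt hk) hW (by omega)).mono ?_
  rintro time _ ⟨t, rfl, hht, htl, htime, hfree, hne⟩
  simp only [Function.update_idem] at *
  have hB' : Busy d k ⟨Function.update (Function.update (Function.update σ.var .v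
      (σ.arr .dir (σ.var .T))) .l (σ.arr .len (σ.var .T))) .t t, σ.arr⟩ C I :=
    hB.of_eq rfl (by simp)
  have hF' : Frame d τ k ⟨Function.update (Function.update (Function.update σ.var .v
      (σ.arr .dir (σ.var .T))) .l (σ.arr .len (σ.var .T))) .t t, σ.arr⟩ :=
    ⟨by simp [hF.p_eq], by simp [hF.tau_eq], by simp [hF.k_eq], hF.d_eq, hF.out_eq⟩
  simp only [wp_cond, eval_rules, ok_rules, cost_rules, Function.update_self, ne_eq, reduceCtorEq,
    not_false_eq_true, Function.update_of_ne]
  refine ⟨by and_intros <;> omega, fun hlt => ?_, fun hlt => ?_⟩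
  · refine (hB'.wp_install hF' hp hk (by simp) (by simp) (fun j hj hjl => ?_) hW hS).mono ?_
    · simp at hj hjl ⊢
      exact hfree j hj (by omega)
    · rintro time' σ' ⟨h₁, h₂, h₅, h₃, h₄⟩
      simp only [busyPotential, Function.update_self, ne_eq, reduceCtorEq, not_false_eq_true,
        Function.update_of_ne] at h₁ h₄ ⊢
      exact ⟨h₂, .inr (.inl ⟨_, _, h₅, h₃, by omega, by omega⟩)⟩
  · refine (hB'.wp_merge hF' hp hk (by simp) (by simp) (fun j hj hjl => ?_) (by simpa using hht)
      (by simpa using hlt) (by simpa using hne (by omega)) hW hS).mono ?_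
    · simp at hj hjl ⊢
      exact hfree j hj (by omega)
    · rintro time' σ' ⟨h₁, ⟨C', I', h₂, h₃, h₄⟩ | ⟨C', I', h₂, h₃⟩⟩
      · simp only [busyPotential, Function.update_self, ne_eq, reduceCtorEq, not_false_eq_true,
          Function.update_of_ne] at h₃ h₄ ⊢
        exact ⟨h₁, .inl ⟨_, _, h₂, by omega, by omega⟩⟩
      · exact ⟨h₁, .inr (.inr ⟨_, _, h₂, by omega⟩)⟩

/-- `11 = 2 + 4 * 2 + 1`: at most `2 * p` nodes, a length `total + len T` below `2 * p` with weight
four, and fewer than `p` recorded cells. -/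
theorem Busy.potential_le (hB : Busy d k σ C I) (hp : p.Prime) (hk : k < p) :
    busyPotential σ ≤ 11 * p := by
  have h₁ := hB.total_lt hp
  have h₂ := hB.nodes
  have h₃ := (hB.forest.comp _ (Finset.mem_insert_self _ _)).len_lt
  simp only [busyPotential]
  omega

theorem Idle.total_le (hI : Idle d k σ C I) (hp : p.Prime) : σ.var .total ≤ p - 1 ∧
    (σ.var .total = p - 1 → ∀ r, 0 < r → r < p → σ.arr .own r ≠ 0) := by
  rw [hI.total]
  exact hI.owned.sum_le hp (fun c hc => (hI.forest.comp c hc).id_pos)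
    (fun c hc => ⟨(hI.forest.comp c hc).dir_pos, (hI.forest.comp c hc).dir_lt⟩)
    fun c hc => (hI.forest.comp c hc).len_lt

theorem Idle.potential_le (hI : Idle d k σ C I) (hp : p.Prime) (hk : k < p) :
    idlePotential σ ≤ 11 * p := by
  have h₁ := (hI.total_le hp).1
  have h₂ := hI.nodes
  simp only [idlePotential]
  omega

/-- The inner loop. -/
def mergeLoop : P := while' (isEq Var.merging 1) mergeBody

theorem Busy.wp_mergeLoop (hB : Busy d k σ C I) (hF : Frame d τ k σ) (hp : p.Prime) (hk : k < p)
    (hW : p ^ 6 < 2 ^ w) (hS : 2 * p < S) :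
    WP w S mergeLoop (fun time σ' => Frame d τ k σ' ∧
      ((∃ C I, Idle d k σ' C I ∧
          time + 1000 * (11 * p - idlePotential σ') ≤ 1000 * (11 * p - busyPotential σ) + 4) ∨
        ∃ C I, Full d k σ' C I ∧ time ≤ 1000 * (11 * p - busyPotential σ) + 1100 * p)) σ := by
  have hpw := pow_chain hp.two_le
  -- The budget is `1000` steps per unit of potential missing to `11 * p`, plus a reserve for the
  -- one round that may create a full component.
  refine wp_loop (fun c σ' => Frame d τ k σ' ∧
    ((∃ C I, Busy d k σ' C I ∧ c = 1000 * (11 * p - busyPotential σ') + 1100 * p) ∨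
      (∃ C I, σ'.var .merging = 0 ∧ Idle d k σ' C I ∧ c = 1000 * (11 * p - idlePotential σ')
          + 1100 * p) ∨
      ∃ C I, Full d k σ' C I ∧ c = 10)) ?_ ⟨hF, .inl ⟨C, I, hB, rfl⟩⟩ ?_
  · rintro c σ' ⟨hF', ⟨C', I', hB', rfl⟩ | ⟨C', I', hm, hI', rfl⟩ | ⟨C', I', hf', rfl⟩⟩
    · simp only [eval_rules, ok_rules, cost_rules, hB'.merging]
      refine ⟨by omega, fun _ => (hB'.wp_mergeBody hF' hp hk hW hS).mono ?_⟩
      have hle := hB'.potential_le hp hk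
      rintro time σ'' ⟨h₁, ⟨C, I, h₂, h₃, h₄⟩ | ⟨C, I, hm, h₂, h₃, h₄⟩ | ⟨C, I, h₂, h₃⟩⟩
      · have := h₂.potential_le hp hk
        exact ⟨_, by omega, h₁, .inl ⟨C, I, h₂, rfl⟩⟩
      · have := h₂.potential_le hp hk
        exact ⟨_, by omega, h₁, .inr (.inl ⟨C, I, hm, h₂, rfl⟩)⟩
      · have := hp.two_le
        exact ⟨_, by omega, h₁, .inr (.inr ⟨C, I, h₂, rfl⟩)⟩
    · simp only [eval_rules, ok_rules, hm]
      exact ⟨by omega, fun h => absurd h (by omega)⟩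
    · simp only [eval_rules, ok_rules, hf'.merging]
      exact ⟨by omega, fun h => absurd h (by omega)⟩
  · rintro c time σ' ⟨hF', ⟨C', I', hB', rfl⟩ | ⟨C', I', hm, hI', rfl⟩ | ⟨C', I', hf', rfl⟩⟩ hb ht
    · simp only [eval_rules, hB'.merging, not_true] at hb
    · simp only [cost_rules] at ht
      exact ⟨hF', .inl ⟨_, _, hI', by omega⟩⟩
    · simp only [cost_rules] at ht
      exact ⟨hF', .inr ⟨_, _, hf', by omega⟩⟩

end MainLoop

/-! ### Inserting one residue. -/

section Insert

variable {p k w S : ℕ} {d : ℕ → ZMod p} {τ : ZMod p} {σ σ' : State Var Arr} {C : Finset ℕ}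
  {I : ℕ → Finset ℕ}

theorem Forest.extend {A A' : Arr → ℕ → ℕ} {nn c : ℕ} (hF : Forest d A nn k C I) (hc : c ∈ C)
    (hd : (A .dir c : ZMod p) = d (k + 1)) (hl : A .len c + 1 < p)
    (hn : ∀ q ∈ nodeArrays, ∀ i ≤ nn, A' q i = A q i) (hkind : A' .kind (nn + 1) = 1)
    (hidx : A' .idx (nn + 1) = k + 1) (hchA : A' .chA (nn + 1) = A .root c)
    (hlenA : A' .lenA (nn + 1) = A .len c) (hdir : A' .dir = A .dir) (hoff : A' .off = A .off)
    (hroot : A' .root = Function.update (A .root) c (nn + 1))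
    (hlen : A' .len = Function.update (A .len) c (A .len c + 1)) :
    Forest d A' (nn + 1) (k + 1) C (Function.update I c (insert (k + 1) (I c))) := by
  have hc' := hF.comp c hc
  have hnot : ∀ c' ∈ C, k + 1 ∉ I c' := fun c' h h' => by
    have := Finset.mem_Icc.1 ((hF.comp c' h).sub h')
    omega
  constructor
  · intro c' h
    by_cases e : c' = c
    · subst e
      rw [Function.update_self]
      exact {
        id_pos := hc'.id_pos
        id_le := hc'.id_le.trans (Nat.le_succ _)
        dir_pos := hdir ▸ hc'.dir_pos
        dir_lt := hdir ▸ hc'.dir_lt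
        len_pos := by simp [hlen]
        len_lt := by simpa [hlen] using hl
        off_lt := hoff ▸ hc'.off_lt
        root_le := by simp [hroot]
        sub := by
          refine Finset.insert_subset (by simp) ?_
          exact hc'.sub.trans (Finset.Icc_subset_Icc_right (Nat.le_succ _))
        enc := by
          simp only [hdir, hoff, hlen, hroot, Function.update_self]
          refine .extend (I := I c') hkind (by rw [hidx]; exact hd)
            (by rw [hchA]; have := hc'.root_le; omega) (by rw [hlenA]) (by rw [hlenA]; omega)
            (by rw [hidx]; exact hnot _ hc) (by rw [hidx]) ?_
          rw [hchA, hlenA]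
          exact hc'.enc.congr fun a ha i hi => hn a ha i (hi.trans hc'.root_le) }
    · rw [Function.update_of_ne e]
      exact (hF.comp c' h).congr (Nat.le_succ _) (Nat.le_succ _) hn
        (by simp [hdir, hlen, hoff, hroot, Function.update_of_ne e])
  · intro c₁ h₁ c₂ h₂ hne
    have := hF.disj c₁ h₁ c₂ h₂ hne
    by_cases e₁ : c₁ = c
    · subst e₁
      rw [Function.update_self, Function.update_of_ne hne.symm, Finset.disjoint_insert_left]
      exact ⟨hnot _ h₂, this⟩
    · rw [Function.update_of_ne e₁]
      by_cases e₂ : c₂ = c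
      · subst e₂
        rw [Function.update_self, Finset.disjoint_insert_right]
        exact ⟨hnot _ h₁, this⟩
      · rwa [Function.update_of_ne e₂]

theorem Forest.insert_leaf {A A' : Arr → ℕ → ℕ} {nn v : ℕ} (hF : Forest d A nn k C I) (hv : 1 ≤ v)
    (hvp : v < p) (hd : (v : ZMod p) = d (k + 1)) (hp : 1 < p)
    (hn : ∀ q ∈ nodeArrays, ∀ i ≤ nn, A' q i = A q i) (hkind : A' .kind (nn + 1) = 0)
    (hidx : A' .idx (nn + 1) = k + 1)
    (hdir : A' .dir = Function.update (A .dir) (k + 1) v)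
    (hoff : A' .off = Function.update (A .off) (k + 1) 0)
    (hroot : A' .root = Function.update (A .root) (k + 1) (nn + 1))
    (hlen : A' .len = Function.update (A .len) (k + 1) 1) :
    Forest d A' (nn + 1) (k + 1) (insert (k + 1) C) (Function.update I (k + 1) {k + 1}) := by
  have hnot : ∀ c' ∈ C, k + 1 ∉ I c' := fun c' h h' => by
    have := Finset.mem_Icc.1 ((hF.comp c' h).sub h')
    omega
  have hne : ∀ c ∈ C, c ≠ k + 1 := fun c h => by
    have := (hF.comp c h).id_le
    omega
  constructor
  · intro c h
    rcases Finset.mem_insert.1 h with rfl | h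
    · rw [Function.update_self]
      exact {
        id_pos := by omega
        id_le := le_rfl
        dir_pos := by simpa [hdir] using hv
        dir_lt := by simpa [hdir] using hvp
        len_pos := by simp [hlen]
        len_lt := by simpa [hlen] using hp
        off_lt := by simp [hoff]; omega
        root_le := by simp [hroot]
        sub := by simp
        enc := by
          simp only [hdir, hoff, hlen, hroot, Function.update_self, Nat.cast_zero]
          exact .leaf hkind (by rw [hidx]; exact hd) (by rw [hidx]) }
    · rw [Function.update_of_ne (hne c h)]
      exact (hF.comp c h).congr (Nat.le_succ _) (Nat.le_succ _) hn
        (by simp [hdir, hlen, hoff, hroot, Function.update_of_ne (hne c h)])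
  · intro c₁ h₁ c₂ h₂ hc
    rcases Finset.mem_insert.1 h₁ with rfl | h₁
    · rcases Finset.mem_insert.1 h₂ with rfl | h₂
      · exact absurd rfl hc
      · rw [Function.update_self, Function.update_of_ne hc.symm, Finset.disjoint_singleton_left]
        exact hnot _ h₂
    · rw [Function.update_of_ne (hne c₁ h₁)]
      rcases Finset.mem_insert.1 h₂ with rfl | h₂
      · rw [Function.update_self, Finset.disjoint_singleton_right]
        exact hnot _ h₁
      · rw [Function.update_of_ne (hne c₂ h₂)]
        exact hF.disj c₁ h₁ c₂ h₂ hc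

theorem Idle.wp_insertStep [Fact p.Prime] (hI : Idle d k σ C I) (hF : Frame d τ (k + 1) σ)
    (hp : p.Prime) (hk : k + 1 < p) (hd : d (k + 1) ≠ 0) (htot : σ.var .total ≠ p - 1)
    (hW : p ^ 6 < 2 ^ w) (hS : 2 * p < S) :
    WP w S insertStep (fun time σ' => time ≤ 200 ∧ Frame d τ (k + 1) σ' ∧
      ((∃ C I, σ'.var .merging = 0 ∧ Idle d (k + 1) σ' C I ∧ idlePotential σ < idlePotential σ') ∨
        ∃ C I, Busy d (k + 1) σ' C I ∧ idlePotential σ < busyPotential σ')) σ := by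
  have hpw := pow_chain hp.two_le
  have htl := (hI.total_le hp).1
  have hdk := hF.d_eq (k + 1) (Finset.mem_Icc.2 ⟨by omega, by omega⟩)
  obtain ⟨v, hv⟩ : ∃ v, (d (k + 1)).val = v := ⟨_, rfl⟩
  have hvd : (v : ZMod p) = d (k + 1) := by rw [← hv, ZMod.natCast_zmod_val]
  have hvp : v < p := hv ▸ ZMod.val_lt _
  have hv1 : 1 ≤ v := by
    rw [Nat.one_le_iff_ne_zero]
    rintro rfl
    exact hd (by rw [← hvd, Nat.cast_zero])
  rw [hv] at hdk
  have hnodes := hI.nodes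
  have hgrown := hI.grown
  have hol := hI.owned.own_lt hp (fun c hc => (hI.forest.comp c hc).id_le.trans_lt (by omega))
  have hov := hol v hvp
  -- The test reads the coefficient even when the cell has no owner, and clearing leaves old
  -- coefficients behind; hence the bound is needed for every cell.
  have hcv := hI.owned.coef_lt v hvp
  have hcz := hI.owned.of_ne v hv1 hvp
  generalize hc : σ.arr .own v = c at *
  rw [insertStep]
  simp only [wp_seq, wp_assign, wp_store, wp_cond, eval_rules, ok_rules, cost_rules, hF.k_eq, hdk,
    hc, hF.p_eq, Function.update_self, ne_eq, reduceCtorEq, not_false_eq_true,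
    Function.update_of_ne]
  refine ⟨by and_intros <;> omega, by and_intros <;> omega, by and_intros <;> omega,
    by and_intros <;> omega, by and_intros <;> omega, fun hex => ?_, fun hnew => ?_⟩
  · obtain ⟨hcC, -, -, hdir⟩ := hcz hex.1
    -- Owning `d (k + 1)` with coefficient `1` means having it as direction.
    rw [hex.2, one_mul] at hdir
    have cc := hI.forest.comp c hcC
    rw [Nat.mod_eq_of_lt cc.dir_lt] at hdir
    -- The length of `c` is at most `total < p - 1`, so the extended length is still below `p` and
    -- its endpoint is a non-zero residue.
    have hlt := Finset.single_le_sum (f := σ.arr .len) (fun i _ => Nat.zero_le _) hcC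
    rw [← hI.total] at hlt
    have hsum := Finset.sum_erase_add C (σ.arr .len) hcC
    rw [← hI.total] at hsum
    have hcard := Finset.card_erase_add_one hcC
    have hroot := cc.root_le
    have hlen := cc.len_pos
    have hmul : (σ.arr .len c + 1) * v ≤ p ^ 2 := by
      rw [pow_two]
      exact Nat.mul_le_mul (by omega) hvp.le
    have hr0 := mul_mod_pos hp (by omega) (show σ.arr .len c + 1 < p by omega) hv1 hvp
    have hrp := Nat.mod_lt ((σ.arr .len c + 1) * v) hp.pos
    generalize hr : (σ.arr .len c + 1) * v % p = r at *
    have hupd : ∀ (f : ℕ → ℕ) (e : ℕ), ∀ i ≤ σ.var .nn,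
        Function.update f (σ.var .nn + 1) e i = f i :=
      fun f e i hi => Function.update_of_ne (by omega) _ _
    have hid : ∀ c ∈ C, 1 ≤ c := fun c hc => (hI.forest.comp c hc).id_pos
    have hor := hol r hrp
    iterate 8 refine ⟨by and_intros <;> omega, ?_⟩
    refine ⟨fun hfree => ?_, fun hfree => ?_⟩
    · iterate 3 refine ⟨by and_intros <;> omega, ?_⟩
      refine ⟨by omega, by norm_num, ⟨by simp [hF.p_eq], by simp [hF.tau_eq], by simp [hF.k_eq],
        by simpa using hF.d_eq, by simpa using hF.out_eq⟩, .inl ⟨C,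
        Function.update I c (insert (k + 1) (I c)), trivial, ⟨by simpa using hI.done,
        by simpa using hI.full, ?_, ?_, ?_, ?_, ?_, ?_⟩, ?_⟩⟩
      · simp only [ne_eq, reduceCtorEq, not_false_eq_true, Function.update_of_ne,
          Function.update_self]
        exact hI.forest.extend hcC (by rw [hdir, hvd]) (by omega) (by simp +contextual [nodeArrays,
            hupd])
          (by simp) (by simp) (by simp) (by simp) (by simp) (by simp) (by simp) (by simp)
      · simpa [Acts] using hI.acts
      · exact (hI.owned.grow (A' := Function.update (Function.update σ.arr .own
          (Function.update (σ.arr .own) r c)) .coef (Function.update (σ.arr .coef) r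
          (σ.arr .len c + 1))) hcC hr0 (by omega) hid (by rw [hdir, hr]) hfree (by simp) (by simp)
          (by simp)).congr (by simp) (by simp) (by simp) (by simp)
      · simp [Finset.sum_update_of_mem hcC, ← Finset.erase_eq]
        omega
      · simp
        omega
      · simp
        omega
      · simp [idlePotential]
        omega
    · iterate 5 refine ⟨by and_intros <;> omega, ?_⟩
      refine ⟨by norm_num, ⟨by simp [hF.p_eq], by simp [hF.tau_eq], by simp [hF.k_eq],
        by simpa using hF.d_eq, by simpa using hF.out_eq⟩, .inr ⟨C.erase c,
        Function.update I c (insert (k + 1) (I c)), ⟨by simp, by simpa using hI.done,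
        by simpa using hI.full, by simp, ?_, ?_, ?_, by simp, ?_, ?_, ?_⟩, ?_⟩⟩
      · simp only [ne_eq, reduceCtorEq, not_false_eq_true, Function.update_of_ne,
          Function.update_self, Finset.insert_erase hcC]
        exact hI.forest.extend hcC (by rw [hdir, hvd]) (by omega) (by simp +contextual [nodeArrays,
            hupd])
          (by simp) (by simp) (by simp) (by simp) (by simp) (by simp) (by simp) (by simp)
      · intro j hj hjp
        have := hI.acts j hj hjp
        by_cases e : j = c <;> simp [e, this]
      · simp only [ne_eq, reduceCtorEq, not_false_eq_true, Function.update_of_ne,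
          Function.update_self, Finset.insert_erase hcC]
        refine hI.owned.congr (by simp) (by simp) (by simp) fun c' _ => ?_
        by_cases e : c' = c <;> simp [e]
      · simp [← hsum]
        refine Finset.sum_congr rfl fun i hi => ?_
        rw [Function.update_of_ne (Finset.ne_of_mem_erase hi)]
      · simp
        omega
      · simp
        omega
      · simp [idlePotential, busyPotential]
        omega
  · have hkC : k + 1 ∉ C := fun h => by
      have := (hI.forest.comp _ h).id_le
      omega
    have hne : ∀ c ∈ C, c ≠ k + 1 := fun c hc e => hkC (e ▸ hc)
    have hupd : ∀ (f : ℕ → ℕ) (e : ℕ), ∀ i ≤ σ.var .nn,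
        Function.update f (σ.var .nn + 1) e i = f i :=
      fun f e i hi => Function.update_of_ne (by omega) _ _
    iterate 8 refine ⟨by and_intros <;> omega, ?_⟩
    refine ⟨by norm_num, ⟨by simp [hF.p_eq], by simp [hF.tau_eq], by simp [hF.k_eq],
      by simpa using hF.d_eq, by simpa using hF.out_eq⟩, .inr ⟨C,
      Function.update I (k + 1) {k + 1}, ⟨by simp, by simpa using hI.done,
      by simpa using hI.full, by simpa using hkC, ?_, by simpa [Acts] using hI.acts, ?_, by simp,
          ?_, ?_,
      ?_⟩, ?_⟩⟩
    · simp only [ne_eq, reduceCtorEq, not_false_eq_true, Function.update_of_ne,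
        Function.update_self]
      exact hI.forest.insert_leaf hv1 hvp hvd (by omega) (by simp +contextual [nodeArrays, hupd])
        (by simp) (by simp) (by simp) (by simp) (by simp) (by simp)
    · have := (hI.owned.congr (A' := Function.update σ.arr .dir
        (Function.update (σ.arr .dir) (k + 1) v)) (H' := Function.update (σ.arr .len) (k + 1) 0)
        (by simp) (by simp) (fun c hc => by simp [Function.update_of_ne (hne c hc)])
        (fun c hc => Function.update_of_ne (hne c hc) _ _)).insert_zero hkC (fun _ _ => rfl)
        (by simp)
      refine this.congr (by simp) (by simp) (by simp) fun c _ => ?_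
      by_cases e : c = k + 1 <;> simp [e]
    · simp [hI.total]
      refine Finset.sum_congr rfl fun i hi => ?_
      rw [Function.update_of_ne (hne i hi)]
    · simp
      omega
    · simp
      omega
    · simp [idlePotential, busyPotential]
      omega

end Insert

/-! ### The main loop and its final states. -/

section OuterLoop

variable {p k w S : ℕ} {d : ℕ → ZMod p} {τ : ZMod p} {σ σ' : State Var Arr} {C : Finset ℕ}
  {I : ℕ → Finset ℕ}

/-- The active components reach every residue from the sum of their offsets. -/
structure Final {p : ℕ} (d : ℕ → ZMod p) (τ : ZMod p) (σ : State Var Arr) (C : Finset ℕ)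
    (I : ℕ → Finset ℕ) : Prop where
  p_eq : σ.var .p = p
  tau_eq : σ.var .tau = τ.val
  out_eq : ∀ j ∈ Finset.Icc 1 (p - 1), σ.arr .out j = 0
  forest : Forest d σ.arr (2 * p) (p - 1) C I
  acts : Acts p σ.arr C
  cover : (σ.var .full ∈ C ∧ σ.arr .len (σ.var .full) = p - 1) ∨
    (σ.var .full = 0 ∧ ∀ r, 0 < r → r < p → σ.arr .own r ∈ C ∧
      σ.arr .coef r ≤ σ.arr .len (σ.arr .own r) ∧
      σ.arr .coef r * σ.arr .dir (σ.arr .own r) % p = r)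

theorem Forest.mono {A : Arr → ℕ → ℕ} {nn nn' k' : ℕ} (h : Forest d A nn k C I) (hn : nn ≤ nn')
    (hk : k ≤ k') : Forest d A nn' k' C I where
  comp c hc := (h.comp c hc).congr hn hk (fun _ _ _ _ => rfl) fun _ _ => rfl
  disj := h.disj

theorem Idle.final (hI : Idle d k σ C I) (hF : Frame d τ k σ) (hp : p.Prime) (hk : k < p)
    (ht : σ.var .total = p - 1) : Final d τ σ C I where
  p_eq := hF.p_eq
  tau_eq := hF.tau_eq
  out_eq := hF.out_eq
  forest := hI.forest.mono (by have := hI.nodes; omega) (by omega)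
  acts := hI.acts
  cover := .inr ⟨hI.full, fun r hr hrp => by
    obtain ⟨h₁, -, h₃, h₄⟩ := hI.owned.of_ne r hr hrp ((hI.total_le hp).2 ht r hr hrp)
    exact ⟨h₁, h₃, h₄⟩⟩

theorem Full.final (hf : Full d k σ C I) (hF : Frame d τ k σ) (hk : k < p) : Final d τ σ C I where
  p_eq := hF.p_eq
  tau_eq := hF.tau_eq
  out_eq := hF.out_eq
  forest := hf.forest.mono (by have := hf.nodes; omega) (by omega)
  acts := hf.acts
  cover := .inl ⟨hf.mem, hf.len⟩

theorem Final.of_eq (h : Final d τ σ C I) (ha : σ'.arr = σ.arr)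
    (hv : ∀ q ∈ ({.p, .tau, .full} : Finset Var), σ'.var q = σ.var q) : Final d τ σ' C I := by
  have e₁ := hv .p (by decide)
  have e₂ := hv .tau (by decide)
  have e₃ := hv .full (by decide)
  constructor <;> simp only [ha, e₁, e₂, e₃]
  exacts [h.p_eq, h.tau_eq, h.out_eq, h.forest, h.acts, h.cover]

theorem Idle.wp_mainBody [Fact p.Prime] (hI : Idle d k σ C I) (hF : Frame d τ (k + 1) σ)
    (hp : p.Prime) (hk : k + 1 < p) (hd : d (k + 1) ≠ 0) (htot : σ.var .total ≠ p - 1)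
    (hW : p ^ 6 < 2 ^ w) (hS : 2 * p < S) :
    WP w S (insertStep ;; mergeLoop)
      (fun time σ' => Frame d τ (k + 1) σ' ∧
        ((∃ C I, Idle d (k + 1) σ' C I ∧
            time + 1000 * (11 * p - idlePotential σ') ≤ 1000 * (11 * p - idlePotential σ) + 210) ∨
          ∃ C I, Full d (k + 1) σ' C I ∧
            time ≤ 1000 * (11 * p - idlePotential σ) + 1100 * p + 210)) σ := by
  have hpw := pow_chain hp.two_le
  rw [wp_seq]
  refine (hI.wp_insertStep hF hp hk hd htot hW hS).mono ?_
  rintro t₁ σ₁ ⟨h₁, h₂, ⟨C₁, I₁, h₃, h₄, h₅⟩ | ⟨C₁, I₁, h₃, h₄⟩⟩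
  · refine (wp_loop (fun c σ' => σ' = σ₁ ∧ c = 0) ?_ ⟨rfl, rfl⟩ ?_ : WP w S mergeLoop
      (fun time σ' => σ' = σ₁ ∧ time ≤ 4) σ₁).mono ?_
    · rintro c _ ⟨rfl, rfl⟩
      simp only [eval_rules, ok_rules, h₃]
      exact ⟨by omega, fun h => absurd h (by omega)⟩
    · rintro c t _ ⟨rfl, rfl⟩ - ht
      simp only [cost_rules] at ht
      exact ⟨rfl, by omega⟩
    · rintro t₂ _ ⟨rfl, h₆⟩
      exact ⟨h₂, .inl ⟨C₁, I₁, h₄, by omega⟩⟩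
  · refine (h₃.wp_mergeLoop h₂ hp hk hW hS).mono ?_
    rintro t₂ σ₂ ⟨h₅, ⟨C₂, I₂, h₆, h₇⟩ | ⟨C₂, I₂, h₆, h₇⟩⟩
    · exact ⟨h₅, .inl ⟨C₂, I₂, h₆, by omega⟩⟩
    · exact ⟨h₅, .inr ⟨C₂, I₂, h₆, by omega⟩⟩

theorem Idle.wp_mainLoop [Fact p.Prime] (hI : Idle d 0 σ C I) (hF : Frame d τ 1 σ)
    (hp : p.Prime) (hd : ∀ k ∈ Finset.Icc 1 (p - 1), d k ≠ 0) (htot : σ.var .total = 0)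
    (hW : p ^ 6 < 2 ^ w) (hS : 2 * p < S) :
    WP w S mainLoop (fun time σ' => time ≤ 13400 * p ∧ ∃ C I, Final d τ σ' C I) σ := by
  have hpw := pow_chain hp.two_le
  have hp2 := hp.two_le
  -- The register `k` is one ahead of the number of inserted residues. The budget adds `300` steps
  -- per remaining insertion and a reserve of `2000 * p` for the round with a full component, after
  -- which nothing is left to pay.
  refine wp_loop (fun c σ' => (∃ k C I, k + 1 ≤ p ∧ Frame d τ (k + 1) σ' ∧ Idle d k σ' C I ∧
      σ'.var .total ≠ p - 1 ∧
      c = 1000 * (11 * p - idlePotential σ') + 2000 * p + 300 * (p - 1 - k)) ∨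
    (σ'.var .done = 1 ∧ σ'.var .k ≤ p ∧ (∃ C I, Final d τ σ' C I) ∧ c = 0)) ?_
    (.inl ⟨0, C, I, by omega, hF, hI, by omega, rfl⟩) ?_
  · rintro c σ' (⟨k, C', I', hk, hF', hI', ht, rfl⟩ | ⟨hd1, hk, ⟨C', I', hf⟩, rfl⟩)
    · simp only [eval_rules, ok_rules, cost_rules, hI'.done, hF'.p_eq, hF'.k_eq]
      refine ⟨by omega, fun hlt => ?_⟩
      have hle := hI'.potential_le hp (by omega)
      rw [wp_seq]
      have hb := hI'.wp_mainBody hF' hp hlt.2 (hd _ (Finset.mem_Icc.2 ⟨by omega, by omega⟩))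
          ht hW hS
      rw [wp_seq] at hb
      refine hb.mono fun t₁ σ₁ hb => ?_
      rw [wp_seq]
      refine hb.mono ?_
      rintro t₂ σ₂ ⟨h₁, h₂⟩
      have hk₂ := h₁.k_eq
      simp only [wp_seq, wp_cond, wp_assign, wp_skip, eval_rules, ok_rules, cost_rules,
        h₁.p_eq, Function.update_self, ne_eq, reduceCtorEq, not_false_eq_true,
        Function.update_of_ne, hk₂]
      have htot : σ₂.var .total < p := by
        rcases h₂ with ⟨C₂, I₂, h₂, -⟩ | ⟨C₂, I₂, h₂, -⟩
        · have := (h₂.total_le hp).1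
          omega
        · exact h₂.total
      have hF₂ : ∀ q, Frame d τ q ⟨Function.update σ₂.var .k q, σ₂.arr⟩ := fun q =>
        ⟨by simp [h₁.p_eq], by simp [h₁.tau_eq], by simp, h₁.d_eq, h₁.out_eq⟩
      refine ⟨by and_intros <;> omega, fun he => ?_, fun he => ?_⟩
      · refine ⟨by omega, by omega, ?_⟩
        rcases h₂ with ⟨C₂, I₂, h₂, h₃⟩ | ⟨C₂, I₂, h₂, h₃⟩
        · refine ⟨0, by omega, .inr ⟨trivial, by omega, ⟨C₂, I₂, ?_⟩, rfl⟩⟩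
          exact (h₂.final h₁ hp (by omega) he).of_eq rfl (by simp)
        · refine ⟨0, by omega, .inr ⟨trivial, by omega, ⟨C₂, I₂, ?_⟩, rfl⟩⟩
          exact (h₂.final h₁ (by omega)).of_eq rfl (by simp)
      · refine ⟨by omega, ?_⟩
        rcases h₂ with ⟨C₂, I₂, h₂, h₃⟩ | ⟨C₂, I₂, h₂, h₃⟩
        · have hg := h₂.grown
          have hle' := h₂.potential_le hp (by omega)
          refine ⟨_, ?_, .inl ⟨k + 1, C₂, I₂, by omega, hF₂ _, ⟨by simpa using h₂.done,
            by simpa using h₂.full, by simpa using h₂.forest, h₂.acts, h₂.owned,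
            by simpa using h₂.total, by simpa using hg, by simpa using h₂.nodes⟩, he, rfl⟩⟩
          simp only [idlePotential, ne_eq, reduceCtorEq, not_false_eq_true,
            Function.update_of_ne] at hle hle' h₃ ⊢
          omega
        · refine ⟨0, by omega, .inr ⟨h₂.done, by omega, ⟨C₂, I₂, ?_⟩, rfl⟩⟩
          exact (h₂.final h₁ (by omega)).of_eq rfl (by simp)
    · simp only [eval_rules, ok_rules, cost_rules, hd1, hf.p_eq]
      exact ⟨by and_intros <;> omega, fun h => absurd h.1 (by omega)⟩
  · rintro c t σ' (⟨k, C', I', hk, hF', hI', ht, rfl⟩ | ⟨hd1, hk, hf, rfl⟩) hb htime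
    -- This exit is impossible: with all `p - 1` residues inserted, the growth invariant gives
    -- `total = p - 1`, which the loop invariant excludes.
    · simp only [eval_rules, hI'.done, hF'.p_eq, hF'.k_eq, true_and] at hb
      have h₁ := hI'.grown
      have h₂ := (hI'.total_le hp).1
      omega
    · simp only [cost_rules] at htime
      exact ⟨by omega, hf⟩

end OuterLoop

/-! ## Initialization and choice of the coefficients -/

section Choose

variable {p k w S : ℕ} {d : ℕ → ZMod p} {τ : ZMod p} {σ σ' : State Var Arr} {C : Finset ℕ}
  {I : ℕ → Finset ℕ}

theorem wp_setup (hp : 2 ≤ p) (hσ : σ.var .p = p) (hτ : σ.var .tau = τ.val)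
    (hd : ∀ k ∈ Finset.Icc 1 (p - 1), σ.arr .d k = (d k).val) (hW : p ^ 6 < 2 ^ w) (hS : p ≤ S) :
    WP w S setup (fun time σ' => time ≤ 30 * p + 100 ∧ Frame d τ 1 σ' ∧ σ'.var .total = 0 ∧
      Idle d 0 σ' ∅ fun _ => ∅) σ := by
  have hpw := pow_chain hp
  simp only [setup, wp_seq, wp_assign, eval_rules, ok_rules, cost_rules]
  refine ⟨by omega, ?_⟩
  refine (wp_setup_loop (σ := ⟨Function.update σ.var .j 0, σ.arr⟩) hp (by simp [hσ]) (by simp) hW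
    hS).mono ?_
  rintro time σ' ⟨ht, ⟨j, hj⟩, hd', hz⟩
  have h₁ : σ'.var .p = p := by simp [hj, hσ]
  have h₂ : σ'.var .tau = τ.val := by simp [hj, hτ]
  refine ⟨by omega, by omega, by omega, by omega, by omega, by omega, ?_, ?_, ?_⟩
  · refine ⟨by simp [h₁], by simp [h₂], by simp, fun j hj => ?_, fun j hj => ?_⟩
    · exact (congrFun hd' j).trans (hd j hj)
    · have := Finset.mem_Icc.1 hj
      exact (hz j (by omega)).2.2.2
  · simp
  · refine ⟨by simp, by simp, ⟨by simp, by simp⟩, ?_, ⟨?_, ?_, ?_, by simp⟩, by simp, by simp,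
      by simp⟩
    · intro j _ hjp
      simpa using (hz j hjp).2.2.1
    · intro r _ hr h
      exact absurd (hz r hr).1 h
    · exact (hz 0 (by omega)).1
    · intro r hr
      rw [show _ = 0 from (hz r hr).2.1]
      omega

theorem wp_sumOffsets (hf : Final d τ σ C I) (hp : p.Prime) (hX : σ.var .X = 0)
    (hj : σ.var .j = 1) (hW : p ^ 6 < 2 ^ w) (hS : 2 * p < S) :
    WP w S (while' (isLt Var.j Var.p)
      (ifte (isEq (rd .act Var.j) 1) (.X ::= (Var.X + rd .off Var.j) % Var.p) .skip ;;
        .j ::= Var.j + 1))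
      (fun time σ' => ∃ X j, σ' = ⟨Function.update (Function.update σ.var .X X) .j j, σ.arr⟩ ∧
        time ≤ 30 * p + 10 ∧ X < p ∧ (X : ZMod p) = ∑ c ∈ C, (σ.arr .off c : ZMod p)) σ := by
  have hpw := pow_chain hp.two_le
  have hC : C ⊆ Finset.range p := fun c hc => by
    have := (hf.forest.comp c hc).id_le
    have := (hf.forest.comp c hc).id_pos
    exact Finset.mem_range.2 (by omega)
  refine wp_loop (fun c σ' => ∃ X j,
    σ' = ⟨Function.update (Function.update σ.var .X X) .j j, σ.arr⟩ ∧ 1 ≤ j ∧ j ≤ p ∧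
    c = 30 * (p - j) ∧ X < p ∧
    (X : ZMod p) = ∑ c ∈ Finset.range j, if c ∈ C then (σ.arr .off c : ZMod p) else 0) ?_
    ⟨0, 1, ?_, le_rfl, hp.one_lt.le, rfl, hp.pos, ?_⟩ ?_
  · rintro c _ ⟨X, j, rfl, hj1, hjp, rfl, hXp, hXs⟩
    simp only [wp_seq, wp_assign, wp_cond, wp_skip, eval_rules, ok_rules, cost_rules, hf.p_eq,
      Function.update_self, ne_eq, reduceCtorEq, not_false_eq_true, Function.update_of_ne]
    refine ⟨by and_intros <;> omega, fun hlt => ?_⟩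
    have ha := hf.acts j hj1 hlt
    rw [ha]
    refine ⟨?_, fun he => ?_, fun he => ?_⟩
    · split_ifs <;> and_intros <;> omega
    · have hjC : j ∈ C := by
        by_contra h
        rw [if_neg h] at he
        omega
      have ho := (hf.forest.comp j hjC).off_lt
      have hm := Nat.mod_lt (X + σ.arr .off j) hp.pos
      refine ⟨by and_intros <;> omega, by omega, 30 * (p - (j + 1)), by omega,
        (X + σ.arr .off j) % p, j + 1, ?_, by omega, by omega, rfl, hm, ?_⟩
      · congr 1
        funext u
        cases u <;> simp
      · rw [Finset.sum_range_succ, if_pos hjC, ← hXs, ZMod.natCast_mod, Nat.cast_add]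
    · have hjC : j ∉ C := fun h => he (if_pos h)
      refine ⟨by omega, 30 * (p - (j + 1)), by omega, X, j + 1, ?_, by omega, by omega, rfl, hXp,
          ?_⟩
      · rw [Function.update_idem]
      · rw [Finset.sum_range_succ, if_neg hjC, add_zero, hXs]
  · rw [← hX, ← hj]
    simp
  · have : 0 ∉ C := fun h => by
      have := (hf.forest.comp 0 h).id_pos
      omega
    simp [this]
  · rintro c t _ ⟨X, j, rfl, hj1, hjp, rfl, hXp, hXs⟩ hb ht
    simp only [eval_rules, cost_rules, hf.p_eq, Function.update_self, ne_eq, reduceCtorEq,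
      not_false_eq_true, Function.update_of_ne] at hb ht
    obtain rfl : j = p := by omega
    refine ⟨X, j, rfl, by omega, hXp, ?_⟩
    rw [hXs, Finset.sum_ite_mem, Finset.inter_eq_right.2 hC]

theorem Final.wp_chooseCoeff [Fact p.Prime] (hf : Final d τ σ C I) (hp : p.Prime)
    (hW : p ^ 6 < 2 ^ w) (hS : 2 * p < S) :
    WP w S chooseCoeff (fun time σ' => time ≤ 30 * p + 100 ∧ Final d τ σ' C I ∧
      σ'.var .sel < p ∧ σ'.var .selt < p ∧ (σ'.var .sel ∈ C → σ'.var .selt ≤ σ'.arr .len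
          (σ'.var .sel)) ∧
      ∑ c ∈ C, ((σ'.arr .off c : ZMod p) +
        ((if c = σ'.var .sel then σ'.var .selt else 0 : ℕ) : ZMod p) * σ'.arr .dir c) = τ) σ := by
  have hpw := pow_chain hp.two_le
  have hp2 := hp.two_le
  -- At most the selected component contributes more than its offset. Component numbers start at
  -- `1`, so `sel = 0` selects none.
  have key : ∀ (sel selt : ℕ), ∑ c ∈ C, ((σ.arr .off c : ZMod p) +
      ((if c = sel then selt else 0 : ℕ) : ZMod p) * σ.arr .dir c) =
      ∑ c ∈ C, (σ.arr .off c : ZMod p) +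
        if sel ∈ C then (selt : ZMod p) * σ.arr .dir sel else 0 := fun sel selt => by
    rw [Finset.sum_add_distrib]
    congr 1
    simp only [Nat.cast_ite, Nat.cast_zero, ite_mul, zero_mul]
    rw [Finset.sum_ite_eq']
  simp only [chooseCoeff, wp_seq, wp_assign, eval_rules, ok_rules, cost_rules]
  refine ⟨by omega, by omega, ?_⟩
  refine (wp_sumOffsets (σ := ⟨Function.update (Function.update σ.var .X 0) .j 1, σ.arr⟩)
    (hf.of_eq rfl (by simp)) hp (by simp) (by simp) hW hS).mono ?_
  rintro time _ ⟨X, j, rfl, ht, hX, hXs⟩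
  have hτ : τ.val < p := ZMod.val_lt τ
  have hs : (((τ.val + p - X) % p : ℕ) : ZMod p) =
      τ - ∑ c ∈ C, (σ.arr .off c : ZMod p) := by
    rw [ZMod.natCast_mod, Nat.cast_sub (by omega)]
    simp [hXs]
  have hsp := Nat.mod_lt (τ.val + p - X) hp.pos
  simp only [wp_seq, wp_cond, wp_assign, eval_rules, ok_rules, cost_rules, hf.p_eq, hf.tau_eq,
    Function.update_self, ne_eq, reduceCtorEq, not_false_eq_true, Function.update_of_ne]
  generalize (τ.val + p - X) % p = s at *
  have hfin : ∀ (s sel selt : ℕ), Final d τ ⟨Function.update (Function.update (Function.update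
      (Function.update (Function.update (Function.update (Function.update σ.var .X 0) .j 1) .X X)
        .j j) .s s) .sel sel) .selt selt, σ.arr⟩ C I :=
    fun _ _ _ => hf.of_eq rfl (by simp)
  have hful : σ.var .full < p := by
    rcases hf.cover with ⟨h, -⟩ | ⟨h, -⟩
    · have := (hf.forest.comp _ h).id_le
      omega
    · omega
  refine ⟨by and_intros <;> omega, by and_intros <;> omega, fun hne => ?_, fun he => ?_⟩
  · obtain ⟨hfC, hlen⟩ := hf.cover.resolve_right fun h => hne h.1
    have cf := hf.forest.comp _ hfC
    have c₁ := cf.dir_pos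
    have c₂ := cf.dir_lt
    have hcop : (σ.arr .dir (σ.var .full)).Coprime p :=
      (Nat.coprime_of_lt_prime (by omega) c₂ hp).symm
    obtain ⟨hg, hy0⟩ := natCast_div_mod (v := s) c₁ c₂
    have hinv : modInvNat (σ.arr .dir (σ.var .full)) p < p := ZMod.val_lt _
    have hmul : s * modInvNat (σ.arr .dir (σ.var .full)) p ≤ p ^ 2 := by
      rw [pow_two]
      exact Nat.mul_le_mul hsp.le hinv.le
    have hm := Nat.mod_lt (s * modInvNat (σ.arr .dir (σ.var .full)) p) hp.pos
    refine ⟨by omega, ⟨⟨by omega, ⟨⟨by omega, by omega, by omega⟩, by omega, by omega, hcop⟩,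
      by omega⟩, by omega, by omega⟩, by omega, hfin _ _ _, hful, hm, fun _ => by omega, ?_⟩
    rw [key, if_pos hfC, hg, hs, div_mul_cancel₀ _ hy0, add_sub_cancel]
  · rw [not_not] at he
    obtain ⟨-, hcov⟩ := hf.cover.resolve_left fun h => by
      have := (hf.forest.comp _ h.1).id_pos
      omega
    refine ⟨by and_intros <;> omega, fun h0 => ?_, fun h0 => ?_⟩
    · have : 0 ∉ C := fun h => by
        have := (hf.forest.comp 0 h).id_pos
        omega
      refine ⟨by omega, by omega, by omega, hfin _ _ _, hp.pos, hp.pos, fun _ => by omega, ?_⟩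
      rw [key, if_neg this, add_zero]
      rw [h0, Nat.cast_zero] at hs
      exact (sub_eq_zero.1 hs.symm).symm
    · obtain ⟨h₁, h₂, h₃⟩ := hcov s (by omega) hsp
      have c₁ := (hf.forest.comp _ h₁).id_le
      have c₂ := (hf.forest.comp _ h₁).len_lt
      refine ⟨by and_intros <;> omega, by and_intros <;> omega, by omega, hfin _ _ _, by omega,
          by omega,
        fun _ => h₂, ?_⟩
      rw [key, if_pos h₁]
      have := congrArg (Nat.cast : ℕ → ZMod p) h₃
      rw [ZMod.natCast_mod, Nat.cast_mul, hs] at this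
      rw [this, add_sub_cancel]

end Choose

/-! ## Reconstruction -/

section Reconstruct

variable {p w S : ℕ} {d : ℕ → ZMod p} {τ : ZMod p} {σ σ' : State Var Arr} {C : Finset ℕ}
  {I : ℕ → Finset ℕ}

theorem wp_splitCoeff {n t l m x y i : ℕ} (hp : 2 ≤ p) (hn : σ.var .n = n) (ht : σ.var .t = t)
    (hl : σ.arr .lenA n = l) (hm : σ.arr .lenB n = m) (hx : σ.arr .cx n = x) (hy : σ.arr .cy n = y)
    (hi : σ.arr .cinv n = i) (hx1 : 1 ≤ x) (hxl : x ≤ l) (hlp : l < p) (hy1 : 1 ≤ y) (hym : y ≤ m)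
    (hmp : m < p) (hip : i < p) (hinv : 1 < x → 1 < y → i * y ≡ 1 [MOD x])
    (htL : t ≤ mergeLen l m x y) (hnS : n < S) (hnp : n ≤ 2 * p) (hW : p ^ 6 < 2 ^ w) :
    WP w S splitCoeff (fun time σ' => time ≤ 100 ∧ σ'.arr = σ.arr ∧ σ'.var .n = n ∧
      σ'.var .sp = σ.var .sp ∧ σ'.var .a ≤ l ∧ σ'.var .b ≤ m ∧
      (x - 1) * (y - 1) + t = σ'.var .a * y + σ'.var .b * x) σ := by
  have hpw := pow_chain hp
  have hmx : m * x ≤ p ^ 2 := by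
    rw [pow_two]
    exact Nat.mul_le_mul hmp.le (by omega)
  have hly : l * y ≤ p ^ 2 := by
    rw [pow_two]
    exact Nat.mul_le_mul hlp.le (by omega)
  have hxy : (x - 1) * (y - 1) ≤ p ^ 2 := by
    rw [pow_two]
    exact Nat.mul_le_mul (by omega) (by omega)
  have htL' : t ≤ m * x + l * y - 2 * ((x - 1) * (y - 1)) := htL
  simp only [splitCoeff, wp_seq, wp_assign, wp_cond, wp_skip, eval_rules, ok_rules, cost_rules, hn,
    ht, hl, hm, hx, hy, hi, Function.update_self, ne_eq, reduceCtorEq, not_false_eq_true,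
    Function.update_of_ne]
  iterate 4 refine ⟨by and_intros <;> omega, ?_⟩
  refine ⟨by and_intros <;> omega, fun h₁ => ?_, fun h₁ => ⟨by and_intros <;> omega,
    fun h₂ => ?_, fun h₂ => ?_⟩⟩
  · subst h₁
    obtain ⟨h₃, h₄⟩ := split_of_x_eq_one (l := l) hy1 hym (t := t) (by simpa using htL')
    have h₅ := Nat.div_le_self t y
    generalize t / y = q at *
    refine ⟨by and_intros <;> omega, by and_intros <;> omega, fun h₆ => ?_, fun h₆ => ?_⟩
    · rw [min_eq_right h₆.le] at h₃ h₄
      refine ⟨by omega, by and_intros <;> omega, by omega, trivial, trivial, trivial, le_rfl, h₄,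
          ?_⟩
      simp only [mul_one]
      omega
    · rw [min_eq_left (by omega)] at h₃ h₄
      refine ⟨by and_intros <;> omega, by omega, trivial, trivial, trivial, by omega, h₄, ?_⟩
      simp only [mul_one]
      omega
  · subst h₂
    obtain ⟨h₃, h₄⟩ := split_of_x_eq_one (l := m) hx1 hxl (t := t) (by
      simp at htL'
      omega)
    have h₅ := Nat.div_le_self t x
    generalize t / x = q at *
    refine ⟨by and_intros <;> omega, by and_intros <;> omega, fun h₆ => ?_, fun h₆ => ?_⟩
    · rw [min_eq_right h₆.le] at h₃ h₄
      refine ⟨by omega, by and_intros <;> omega, by omega, trivial, trivial, trivial, h₄, le_rfl,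
          ?_⟩
      simp only [mul_one]
      omega
    · rw [min_eq_left (by omega)] at h₃ h₄
      refine ⟨by and_intros <;> omega, by omega, trivial, trivial, trivial, h₄, by omega, ?_⟩
      simp only [mul_one]
      omega
  · obtain ⟨h₃, h₄, h₅, h₆, h₇⟩ := split_of_one_lt (t := t) (by omega) (by omega) hxl hym
      (hinv (by omega) (by omega)) htL'
    -- The largest of the bounds on intermediate values; words exceeding `p ^ 6` leave room for it.
    have h₈ : ((x - 1) * (y - 1) + t) * i ≤ p ^ 5 := by
      rw [pow_succ]
      exact Nat.mul_le_mul (by omega) hip.le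
    have h₉ := Nat.div_le_self ((x - 1) * (y - 1) + t - ((x - 1) * (y - 1) + t) * i % x * y) x
    have h₁₀ := Nat.mod_lt (((x - 1) * (y - 1) + t) * i) hx1
    generalize hs : (x - 1) * (y - 1) + t = s at *
    generalize s * i % x = a at *
    generalize (s - a * y) / x = b at *
    have h₁₁ := Nat.div_le_self (b - m + (y - 1)) y
    generalize (b - m + (y - 1)) / y = z at *
    iterate 6 refine ⟨by and_intros <;> omega, ?_⟩
    exact ⟨by omega, trivial, trivial, trivial, h₃, h₄, h₇⟩

end Reconstruct

/-! ### Expanding the trees with a stack. -/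

section Expand

variable {p w S nn : ℕ} {d : ℕ → ZMod p} {τ : ZMod p} {σ σ' : State Var Arr} {C : Finset ℕ}
  {I : ℕ → Finset ℕ}

/-- The lowest `s` stack cells encode a subset of `U` with sum `q`. -/
inductive Stacked {p : ℕ} (d : ℕ → ZMod p) (A : Arr → ℕ → ℕ) (nn : ℕ) :
    ℕ → Finset ℕ → ZMod p → Prop
  | nil : Stacked d A nn 0 ∅ 0
  | snoc {s L : ℕ} {U U' I : Finset ℕ} {q q' v ξ : ZMod p} (h : Stacked d A nn s U q)
      (hn : A .stN s ≤ nn) (ht : A .stT s ≤ L) (hL : L < p) (he : Enc d A (A .stN s) v L ξ I)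
      (hd : Disjoint U I) (hU : U' = U ∪ I) (hq : q' = q + (ξ + A .stT s * v)) :
      Stacked d A nn (s + 1) U' q'

theorem Stacked.congr {A A' : Arr → ℕ → ℕ} {s : ℕ} {U : Finset ℕ} {q : ZMod p}
    (h : Stacked d A nn s U q) (hA : ∀ a ∈ nodeArrays, A' a = A a)
    (hN : ∀ i < s, A' .stN i = A .stN i) (hT : ∀ i < s, A' .stT i = A .stT i) :
    Stacked d A' nn s U q := by
  induction h with
  | nil => exact .nil
  | snoc h hn ht hL he hd hU hq ih =>
    have ih := ih (fun i hi => hN i (by omega)) fun i hi => hT i (by omega)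
    have e₁ := hN _ (Nat.lt_succ_self _)
    have e₂ := hT _ (Nat.lt_succ_self _)
    rw [← e₁] at hn he
    rw [← e₂] at ht hq
    exact .snoc ih hn ht hL (he.congr fun a ha i _ => by rw [hA a ha]) hd hU hq

theorem Stacked.push {A A' : Arr → ℕ → ℕ} {s L n t : ℕ} {U U' I : Finset ℕ} {q q' v ξ : ZMod p}
    (h : Stacked d A nn s U q) (hA : ∀ a ∈ nodeArrays, A' a = A a)
    (hN : A' .stN = Function.update (A .stN) s n) (hT : A' .stT = Function.update (A .stT) s t)
    (hn : n ≤ nn) (ht : t ≤ L) (hL : L < p) (he : Enc d A n v L ξ I) (hd : Disjoint U I)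
    (hU : U' = U ∪ I) (hq : q' = q + (ξ + t * v)) : Stacked d A' nn (s + 1) U' q' := by
  refine .snoc (h.congr hA ?_ ?_) (by simpa [hN]) (by simpa [hT]) hL (v := v) (ξ := ξ) ?_ hd hU
    (by simpa [hT])
  · intro i hi
    rw [hN, Function.update_of_ne hi.ne]
  · intro i hi
    rw [hT, Function.update_of_ne hi.ne]
  · rw [hN, Function.update_self]
    exact he.congr fun a ha i _ => by rw [hA a ha]

/-- The stacked trees use disjoint sets of indices, none of them empty by `Enc.nonempty`; hence the
stack never outgrows its array. -/
theorem Stacked.le_card {A : Arr → ℕ → ℕ} {s : ℕ} {U : Finset ℕ} {q : ZMod p}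
    (h : Stacked d A nn s U q) : s ≤ U.card := by
  induction h with
  | nil => exact Nat.zero_le _
  | snoc _ _ _ _ he hd hU _ ih =>
    rw [hU, Finset.card_union_of_disjoint hd]
    have := he.nonempty.card_pos
    omega

/-- The indices in `J` have been output, and the stack encodes a subset of `U` that completes `J`
to a subset with sum `τ`. -/
structure Expanding {p : ℕ} (d : ℕ → ZMod p) (τ : ZMod p) (nn : ℕ) (σ : State Var Arr)
    (U J : Finset ℕ) (q : ZMod p) : Prop where
  stack : Stacked d σ.arr nn (σ.var .sp) U q
  sub : U ⊆ Finset.Icc 1 (p - 1)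
  sub_out : J ⊆ Finset.Icc 1 (p - 1)
  disj : Disjoint U J
  out : ∀ k ∈ Finset.Icc 1 (p - 1), σ.arr .out k = if k ∈ J then 1 else 0
  sum : ∑ k ∈ J, d k + q = τ

/-- The node on top of the stack is expanded. -/
def expandBody : P :=
  .sp ::= Var.sp - 1 ;; .n ::= rd .stN Var.sp ;; .t ::= rd .stT Var.sp ;;
    ifte (isEq (rd .kind Var.n) 0)
      (ifte (isEq Var.t 0) .skip (wr .out (rd .idx Var.n) 1))
      (ifte (isEq (rd .kind Var.n) 1)
        (ifte (isLe Var.t (rd .lenA Var.n))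
          (push (rd .chA Var.n) Var.t)
          (wr .out (rd .idx Var.n) 1 ;; push (rd .chA Var.n) (rd .lenA Var.n)))
        (splitCoeff ;; push (rd .chA Var.n) Var.a ;; push (rd .chB Var.n) Var.b))

/-- The quantity `2 * U.card - sp` drops at every step: a leaf removes one index and one stack cell,
an extension removes one index, and a merge adds one stack cell. -/
theorem Expanding.wp_expandBody {U J : Finset ℕ} {q : ZMod p} (h : Expanding d τ nn σ U J q)
    (hp : 2 ≤ p) (hsp : 0 < σ.var .sp) (hnn : nn ≤ 2 * p) (hW : p ^ 6 < 2 ^ w) (hS : 2 * p < S) :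
    WP w S expandBody (fun time σ' => time ≤ 200 ∧ ∃ U' J' q', Expanding d τ nn σ' U' J' q' ∧
      2 * U'.card + σ.var .sp + 1 ≤ 2 * U.card + σ'.var .sp) σ := by
  have hpw := pow_chain hp
  obtain ⟨hst, hsub, hsub', hdisj, hout, hsum⟩ := h
  have hcard := hst.le_card
  have hcard' := Finset.card_le_card hsub
  rw [Nat.card_Icc, Nat.add_sub_cancel] at hcard'
  obtain ⟨s, hs⟩ := Nat.exists_eq_add_of_le' hsp
  rw [hs] at hst hcard ⊢
  obtain _ | @⟨_, L, U₀, _, I, q₀, _, g, o, hst, hn, ht, hL, he, hd, rfl, rfl⟩ := hst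
  have hnW : σ.arr .stN s < 2 ^ w := by omega
  generalize hN : σ.arr .stN s = n at *
  generalize hT : σ.arr .stT s = t at *
  simp only [expandBody, push, wp_seq, wp_assign, wp_store, wp_cond, wp_skip, eval_rules, ok_rules,
    cost_rules, hs, hN, hT, Nat.add_sub_cancel, Function.update_self, ne_eq, reduceCtorEq,
    not_false_eq_true, Function.update_of_ne]
  rw [Finset.card_union_of_disjoint hd] at hcard hcard' ⊢
  have hdI := Finset.disjoint_of_subset_left Finset.subset_union_right hdisj
  have hdU := Finset.disjoint_of_subset_left Finset.subset_union_left hdisj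
  have hemit : ∀ i ∈ I, 1 ≤ i ∧ i < p ∧ i ∉ U₀ ∧ i ∉ J ∧
      insert i J ⊆ Finset.Icc 1 (p - 1) ∧ ∀ k ∈ Finset.Icc 1 (p - 1),
        Function.update (σ.arr .out) i 1 k = if k ∈ insert i J then 1 else 0 := fun i hi => by
    have h₁ := hsub (Finset.mem_union_right _ hi)
    have h₂ := Finset.mem_Icc.1 h₁
    refine ⟨h₂.1, by omega, Finset.disjoint_right.1 hd hi, Finset.disjoint_left.1 hdI hi,
      Finset.insert_subset h₁ hsub', fun k hk => ?_⟩
    by_cases e : k = i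
    · simp [e]
    · simp [e, hout k hk]
  refine ⟨by and_intros <;> omega, by and_intros <;> omega, by and_intros <;> omega, ?_⟩
  cases he with
  | leaf hk hv hI =>
    obtain ⟨h₁, h₂, h₃, h₄, h₅, h₆⟩ := hemit (σ.arr .idx n) (by simp [hI])
    have hI1 : I.card = 1 := by rw [hI, Finset.card_singleton]
    rw [hk]
    refine ⟨by and_intros <;> omega, fun _ => ⟨by and_intros <;> omega, fun h0 => ?_, fun h0 => ?_⟩,
      fun h0 => absurd rfl h0⟩
    · subst h0
      refine ⟨by omega, U₀, J, q₀, ⟨by simpa using hst, Finset.union_subset_left hsub, hsub', hdU,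
        hout, ?_⟩, by omega⟩
      simpa using hsum
    · obtain rfl : t = 1 := by omega
      refine ⟨by and_intros <;> omega, by omega, U₀, insert (σ.arr .idx n) J, q₀, ⟨?_,
        Finset.union_subset_left hsub, h₅, Finset.disjoint_insert_right.2 ⟨h₃, hdU⟩,
        by simpa using h₆, ?_⟩, by omega⟩
      · simpa using hst.congr (A' := Function.update σ.arr .out
          (Function.update (σ.arr .out) (σ.arr .idx n) 1)) (by simp [nodeArrays]) (by simp)
              (by simp)
      · rw [Finset.sum_insert h₄, ← hsum, ← hv]
        push_cast
        ring
  | @extend _ _ _ _ I' _ hk hv hch hl hlp hi hI h' =>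
    obtain ⟨h₁, h₂, h₃, h₄, h₅, h₆⟩ := hemit (σ.arr .idx n) (by simp [hI])
    have hI1 : I.card = I'.card + 1 := by rw [hI, Finset.card_insert_of_notMem hi]
    have hsubI : I' ⊆ I := hI ▸ Finset.subset_insert _ _
    have hd' := Finset.disjoint_of_subset_right hsubI hd
    have hdJ := Finset.disjoint_of_subset_left hsubI hdI
    have hUI : U₀ ∪ I' ⊆ Finset.Icc 1 (p - 1) :=
      (Finset.union_subset_union_right hsubI).trans hsub
    have hcard₁ := Finset.card_union_of_disjoint hd'
    rw [hk]
    refine ⟨by and_intros <;> omega, fun h0 => absurd h0 (by omega), fun _ =>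
      ⟨by and_intros <;> omega, fun _ => ⟨by and_intros <;> omega, fun hle => ?_, fun hlt => ?_⟩,
      fun h0 => absurd rfl h0⟩⟩
    · refine ⟨by and_intros <;> omega, by and_intros <;> omega, by and_intros <;> omega, by omega,
        U₀ ∪ I', J, q₀ + (o + t * g), ⟨?_, hUI, hsub', Finset.disjoint_union_left.2 ⟨hdU, hdJ⟩,
        by simpa using hout, hsum⟩, by omega⟩
      exact hst.push (by simp [nodeArrays]) (by simp) (by simp) (by omega) hle hlp h' hd' rfl rfl
    · obtain rfl : t = σ.arr .lenA n + 1 := by omega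
      refine ⟨by and_intros <;> omega, by and_intros <;> omega, by and_intros <;> omega,
        by and_intros <;> omega, by omega, U₀ ∪ I', insert (σ.arr .idx n) J,
        q₀ + (o + σ.arr .lenA n * g), ⟨?_, hUI, h₅, ?_, by simpa using h₆, ?_⟩, by omega⟩
      · exact hst.push (by simp [nodeArrays]) (by simp) (by simp) (by omega) le_rfl hlp h' hd' rfl
          rfl
      · rw [Finset.disjoint_insert_right, Finset.mem_union, not_or]
        exact ⟨⟨h₃, hi⟩, Finset.disjoint_union_left.2 ⟨hdU, hdJ⟩⟩
      · rw [Finset.sum_insert h₄, ← hsum, ← hv]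
        push_cast
        ring
  | @merge _ _ v u _ ξ ζ _ I₁ I₂ _ hk ha hb hla hlb hx hxl hy hym hi hip hLm hv hw ho hdAB hU hA hB
      =>
    subst hU
    rw [Finset.disjoint_union_right] at hd
    have hI1 := hA.nonempty.card_pos
    have hI2 := hB.nonempty.card_pos
    rw [Finset.card_union_of_disjoint hdAB] at hcard hcard' ⊢
    rw [hk]
    refine ⟨by and_intros <;> omega, fun h0 => absurd h0 (by omega), fun _ =>
      ⟨by and_intros <;> omega, fun h0 => absurd h0 (by omega), fun _ => ?_⟩⟩
    refine (wp_splitCoeff (σ := ⟨Function.update (Function.update (Function.update σ.var .sp s)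
        .n n)
      .t t, σ.arr⟩) (n := n) (t := t) hp (by simp) (by simp) rfl rfl rfl rfl rfl hx hxl hla hy
      hym hlb hip hi (ht.trans hLm) (by omega) (by omega) hW).mono ?_
    rintro time σ' ⟨h₁, h₂, h₃, h₄, h₅, h₆, h₇⟩
    simp only [ne_eq, reduceCtorEq, not_false_eq_true, Function.update_self,
      Function.update_of_ne] at h₂ h₃ h₄ h₅ h₆ h₇
    generalize σ'.var .a = α at *
    generalize σ'.var .b = β at *
    simp only [h₂, h₃, h₄]
    iterate 6 refine ⟨by and_intros <;> omega, ?_⟩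
    refine ⟨by omega, U₀ ∪ (I₁ ∪ I₂), J, q₀ + (o + t * g), ⟨?_, hsub, hsub', hdisj,
      by simpa using hout, hsum⟩, ?_⟩
    · have h₈ := hst.push (A' := Function.update (Function.update σ.arr .stN
        (Function.update (σ.arr .stN) s (σ.arr .chA n))) .stT (Function.update (σ.arr .stT) s α))
        (by simp [nodeArrays]) (by simp) (by simp) (by omega) h₅ hla hA hd.1 rfl rfl
      refine h₈.push (by simp [nodeArrays]) (by simp) (by simp) (by omega) h₆ hlb (hB.congr ?_)
        (Finset.disjoint_union_left.2 ⟨hd.2, hdAB⟩) (Finset.union_assoc _ _ _).symm ?_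
      · simp [nodeArrays]
      · have := congrArg (Nat.cast : ℕ → ZMod p) h₇
        push_cast at this
        rw [ho, hv, hw]
        push_cast
        -- With `v = y * g` and `w = x * g`, both sides are the two offsets plus `(F + t) * g`, and
        -- `F + t = α * y + β * x`.
        linear_combination g * this
    · rw [Finset.card_union_of_disjoint (Finset.disjoint_union_right.2 hd),
        Finset.card_union_of_disjoint hdAB]
      omega

end Expand

/-! ### Assembling the phases. -/

section Assembly

variable {p w S nn : ℕ} {d : ℕ → ZMod p} {τ : ZMod p} {σ σ' : State Var Arr} {C : Finset ℕ}
  {I : ℕ → Finset ℕ}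

/-- The summand that component `c` contributes when component `sel` gets the coefficient `selt`. -/
def summand (p : ℕ) (σ : State Var Arr) (c : ℕ) : ZMod p :=
  (σ.arr .off c : ZMod p) +
    ((if c = σ.var .sel then σ.var .selt else 0 : ℕ) : ZMod p) * σ.arr .dir c

theorem wp_pushRoots (hf : Final d τ σ C I) (hp : p.Prime) (hs : σ.var .sel < p)
    (hsel : σ.var .selt < p)
    (hle : σ.var .sel ∈ C → σ.var .selt ≤ σ.arr .len (σ.var .sel)) (hsp : σ.var .sp = 0)
    (hj : σ.var .j = 1) (hW : p ^ 6 < 2 ^ w) (hS : 2 * p < S) :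
    WP w S (while' (isLt Var.j Var.p)
      (ifte (isEq (rd .act Var.j) 1)
          (ifte (isEq Var.j Var.sel) (push (rd .root Var.j) Var.selt) (push (rd .root Var.j) 0))
          .skip ;;
        .j ::= Var.j + 1))
      (fun time σ' => time ≤ 50 * p + 10 ∧ (∀ k ∈ Finset.Icc 1 (p - 1), σ'.arr .out k = 0) ∧
        ∃ U ⊆ Finset.Icc 1 (p - 1),
          Stacked d σ'.arr (2 * p) (σ'.var .sp) U (∑ c ∈ C, summand p σ c)) σ := by
  have hpw := pow_chain hp.two_le
  have hp2 := hp.two_le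
  have hC : C ⊆ Finset.range p := fun c hc => by
    have := (hf.forest.comp c hc).id_le
    exact Finset.mem_range.2 (by omega)
  have h0 : 0 ∉ C := fun h => by
    have := (hf.forest.comp 0 h).id_pos
    omega
  have hsub : ∀ j, ((Finset.range j).filter (· ∈ C)).biUnion I ⊆ Finset.Icc 1 (p - 1) :=
    fun j => Finset.biUnion_subset.2 fun c hc => (hf.forest.comp c (Finset.mem_filter.1 hc).2).sub
  refine wp_loop (fun c σ' => ∃ sp j N T,
    σ' = ⟨Function.update (Function.update σ.var .sp sp) .j j,
      Function.update (Function.update σ.arr .stN N) .stT T⟩ ∧ 1 ≤ j ∧ j ≤ p ∧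
    c = 50 * (p - j) ∧
    Stacked d σ'.arr (2 * p) sp (((Finset.range j).filter (· ∈ C)).biUnion I)
      (∑ c ∈ Finset.range j, if c ∈ C then summand p σ c else 0)) ?_
    ⟨0, 1, σ.arr .stN, σ.arr .stT, ?_, le_rfl, hp.one_lt.le, rfl, ?_⟩ ?_
  · rintro c _ ⟨sp, j, N, T, rfl, hj1, hjp, rfl, hst⟩
    have hcard := hst.le_card.trans (Finset.card_le_card (hsub j))
    rw [Nat.card_Icc, Nat.add_sub_cancel] at hcard
    simp only [push, wp_seq, wp_assign, wp_store, wp_cond, wp_skip, eval_rules, ok_rules,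
      cost_rules, hf.p_eq, Function.update_self, ne_eq, reduceCtorEq, not_false_eq_true,
      Function.update_of_ne]
    refine ⟨by and_intros <;> omega, fun hlt => ?_⟩
    have ha := hf.acts j hj1 hlt
    rw [ha]
    by_cases hjC : j ∈ C
    · rw [if_pos hjC]
      have cj := hf.forest.comp j hjC
      have hroot := cj.root_le
      have hdisj : Disjoint (((Finset.range j).filter (· ∈ C)).biUnion I) (I j) := by
        refine (Finset.disjoint_biUnion_left _ _ _).2 fun c hc => ?_
        obtain ⟨h₁, h₂⟩ := Finset.mem_filter.1 hc
        exact hf.forest.disj c h₂ j hjC (Finset.mem_range.1 h₁).ne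
      have hU : ((Finset.range (j + 1)).filter (· ∈ C)).biUnion I =
          ((Finset.range j).filter (· ∈ C)).biUnion I ∪ I j := by
        rw [Finset.range_add_one, Finset.filter_insert, if_pos hjC, Finset.biUnion_insert,
          Finset.union_comm]
      have hq : ∑ c ∈ Finset.range (j + 1), (if c ∈ C then summand p σ c else 0) =
          ∑ c ∈ Finset.range j, (if c ∈ C then summand p σ c else 0) +
            (σ.arr .off j + ((if j = σ.var .sel then σ.var .selt else 0 : ℕ) : ZMod p) *
              σ.arr .dir j) := by
        rw [Finset.sum_range_succ, if_pos hjC, summand]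
      have hnext : ∀ (t : ℕ) (A : Arr → ℕ → ℕ), t = (if j = σ.var .sel then σ.var .selt else 0) →
          (∀ a ∈ nodeArrays, A a = σ.arr a) → A .stN = Function.update N sp (σ.arr .root j) →
          A .stT = Function.update T sp t →
          Stacked d A (2 * p) (sp + 1) (((Finset.range (j + 1)).filter (· ∈ C)).biUnion I)
            (∑ c ∈ Finset.range (j + 1), if c ∈ C then summand p σ c else 0) :=
          fun t A ht hA hN hT => by
        refine hst.push (L := σ.arr .len j) (fun a ha => (hA a ha).trans ?_) (by simpa using hN)
          (by simpa using hT) hroot ?_ cj.len_lt (cj.enc.congr (by simp +contextual [nodeArrays]))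
          hdisj hU (ht ▸ hq)
        · revert a
          simp [nodeArrays]
        rw [ht]
        split_ifs with e
        · rw [e] at hjC ⊢
          exact hle hjC
        · omega
      refine ⟨by and_intros <;> omega, fun _ => ⟨by and_intros <;> omega, fun he => ?_,
        fun he => ?_⟩, fun h => absurd rfl h⟩
      · refine ⟨by and_intros <;> omega, by and_intros <;> omega, by and_intros <;> omega,
          by and_intros <;> omega, 50 * (p - (j + 1)), by omega, sp + 1, j + 1,
          Function.update N sp (σ.arr .root j), Function.update T sp (σ.var .selt), ?_, by omega,
          by omega, rfl, hnext _ _ (if_pos he).symm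
            (by simp [nodeArrays]) (by simp) (by simp)⟩
        congr 1
        · funext u
          cases u <;> simp
        · funext u
          cases u <;> simp
      · refine ⟨by and_intros <;> omega, by and_intros <;> omega, by and_intros <;> omega,
          by and_intros <;> omega, 50 * (p - (j + 1)), by omega, sp + 1, j + 1,
          Function.update N sp (σ.arr .root j), Function.update T sp 0, ?_, by omega,
          by omega, rfl, hnext _ _ (if_neg he).symm
            (by simp [nodeArrays]) (by simp) (by simp)⟩
        congr 1
        · funext u
          cases u <;> simp
        · funext u
          cases u <;> simp
    · rw [if_neg hjC]
      refine ⟨by and_intros <;> omega, fun h => absurd h (by omega), fun _ =>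
        ⟨by and_intros <;> omega, 50 * (p - (j + 1)), by omega, sp, j + 1, N, T, ?_, by omega,
        by omega, rfl, ?_⟩⟩
      · rw [Function.update_idem]
      · rw [Finset.range_add_one, Finset.filter_insert, if_neg hjC, ← Finset.range_add_one,
          Finset.sum_range_succ, if_neg hjC, add_zero]
        exact hst
  · rw [← hsp, ← hj]
    simp
  · simpa [Finset.filter_singleton, h0] using Stacked.nil
  · rintro c t _ ⟨sp, j, N, T, rfl, hj1, hjp, rfl, hst⟩ hb ht
    simp only [eval_rules, cost_rules, hf.p_eq, Function.update_self, ne_eq, reduceCtorEq,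
      not_false_eq_true, Function.update_of_ne] at hb ht
    obtain rfl : j = p := by omega
    rw [Finset.sum_ite_mem, Finset.inter_eq_right.2 hC] at hst
    refine ⟨by omega, by simpa using hf.out_eq, _, hsub _, by simpa using hst⟩

theorem Expanding.wp_expandLoop {U J : Finset ℕ} {q : ZMod p} (h : Expanding d τ nn σ U J q)
    (hp : 2 ≤ p) (hnn : nn ≤ 2 * p) (hW : p ^ 6 < 2 ^ w) (hS : 2 * p < S) :
    WP w S (while' (isLt 0 Var.sp) expandBody) (fun time σ' => time ≤ 500 * p ∧
      ∃ J ⊆ Finset.Icc 1 (p - 1),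
        (∀ k ∈ Finset.Icc 1 (p - 1), σ'.arr .out k = if k ∈ J then 1 else 0) ∧
        ∑ k ∈ J, d k = τ) σ := by
  have hpw := pow_chain hp
  have hcard : ∀ {U : Finset ℕ}, U ⊆ Finset.Icc 1 (p - 1) → U.card ≤ p - 1 := fun hU => by
    simpa using Finset.card_le_card hU
  -- One step with its test costs less than `220`. The subtraction is genuine since `sp ≤ U.card`,
  -- and it starts at no more than `2 * p`.
  refine wp_loop (fun c σ' => ∃ U J q, Expanding d τ nn σ' U J q ∧
    c = 220 * (2 * U.card - σ'.var .sp)) ?_ ⟨U, J, q, h, rfl⟩ ?_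
  · rintro c σ' ⟨U, J, q, h, rfl⟩
    have h₁ := h.stack.le_card
    have h₂ := hcard h.sub
    simp only [eval_rules, ok_rules, cost_rules]
    refine ⟨by omega, fun hsp => (h.wp_expandBody hp hsp hnn hW hS).mono ?_⟩
    rintro time σ'' ⟨ht, U', J', q', h', hle⟩
    have h₃ := h'.stack.le_card
    exact ⟨_, by omega, U', J', q', h', rfl⟩
  · rintro c t σ' ⟨U', J', q', h', rfl⟩ hb ht
    simp only [eval_rules, cost_rules] at hb ht
    have h₁ := hcard h.sub
    have hst := h'.stack
    obtain hs : σ'.var .sp = 0 := by omega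
    rw [hs] at hst
    cases hst
    refine ⟨by omega, J', h'.sub_out, h'.out, ?_⟩
    simpa using h'.sum

theorem Final.wp_reconstruct (hf : Final d τ σ C I) (hp : p.Prime) (hs : σ.var .sel < p)
    (hsel : σ.var .selt < p)
    (hle : σ.var .sel ∈ C → σ.var .selt ≤ σ.arr .len (σ.var .sel))
    (hsum : ∑ c ∈ C, summand p σ c = τ) (hW : p ^ 6 < 2 ^ w) (hS : 2 * p < S) :
    WP w S reconstruct (fun time σ' => time ≤ 600 * p ∧
      ∃ J ⊆ Finset.Icc 1 (p - 1),
        (∀ k ∈ Finset.Icc 1 (p - 1), σ'.arr .out k = if k ∈ J then 1 else 0) ∧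
        ∑ k ∈ J, d k = τ) σ := by
  have hpw := pow_chain hp.two_le
  have hp2 := hp.two_le
  simp only [reconstruct, wp_seq, wp_assign, eval_rules, ok_rules, cost_rules]
  refine ⟨by omega, by omega, ?_⟩
  refine (wp_pushRoots (σ := ⟨Function.update (Function.update σ.var .sp 0) .j 1, σ.arr⟩)
    (hf.of_eq rfl (by simp)) hp (by simpa using hs) (by simpa using hsel) (by simpa using hle)
        (by simp) (by simp) hW
    hS).mono ?_
  rintro t₁ σ₁ ⟨h₁, h₂, U, h₃, h₄⟩
  have h₅ : Expanding d τ (2 * p) σ₁ U ∅ _ := ⟨h₄, h₃, Finset.empty_subset _,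
    Finset.disjoint_empty_right _, by simpa using h₂, by simpa [summand] using hsum⟩
  refine (h₅.wp_expandLoop hp2 le_rfl hW hS).mono ?_
  rintro t₂ σ₂ ⟨h₆, h₇⟩
  exact ⟨by omega, h₇⟩

theorem wp_program [Fact p.Prime] (hp : p.Prime) (hd : ∀ k ∈ Finset.Icc 1 (p - 1), d k ≠ 0)
    (hσ : σ.var .p = p) (hτ : σ.var .tau = τ.val)
    (hin : ∀ k ∈ Finset.Icc 1 (p - 1), σ.arr .d k = (d k).val) (hW : p ^ 6 < 2 ^ w)
    (hS : 2 * p < S) :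
    WP w S program (fun time σ' => time ≤ 15000 * p ∧
      ∃ J ⊆ Finset.Icc 1 (p - 1),
        (∀ k ∈ Finset.Icc 1 (p - 1), σ'.arr .out k = if k ∈ J then 1 else 0) ∧
        ∑ k ∈ J, d k = τ) σ := by
  have hp2 := hp.two_le
  rw [program, wp_seq]
  refine (wp_setup hp2 hσ hτ hin hW (by omega)).mono ?_
  rintro t₁ σ₁ ⟨h₁, hF, ht, hI⟩
  rw [wp_seq]
  refine (hI.wp_mainLoop hF hp hd ht hW hS).mono ?_
  rintro t₂ σ₂ ⟨h₂, C, I, hf⟩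
  rw [wp_seq]
  refine (hf.wp_chooseCoeff hp hW hS).mono ?_
  rintro t₃ σ₃ ⟨h₃, hf', hs, hsel, hle, hsum⟩
  refine (hf'.wp_reconstruct hp hs hsel hle hsum hW hS).mono ?_
  rintro t₄ σ₄ ⟨h₄, h₅⟩
  exact ⟨by omega, h₅⟩

end Assembly

end PrimeTarget

theorem mainTheorem2 :
    ∃ c : ℕ, ∀ (p : ℕ), p.Prime → ∀ (d : ℕ → ZMod p) (τ : ZMod p),
      (∀ k ∈ Finset.Icc 1 (p - 1), d k ≠ 0) →
      ∀ σ : WordRAM.State PrimeTarget.Var PrimeTarget.Arr,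
        σ.var .p = p → σ.var .tau = τ.val →
        (∀ k ∈ Finset.Icc 1 (p - 1), σ.arr .d k = (d k).val) →
        ∃ (S time : ℕ) (σ' : WordRAM.State PrimeTarget.Var PrimeTarget.Arr),
          WordRAM.Exec (c * Nat.log 2 p) S PrimeTarget.program σ time σ' ∧
          time ≤ c * p ∧
          Fintype.card PrimeTarget.Arr * S + Fintype.card PrimeTarget.Var ≤ c * p ∧
          ∃ J ⊆ Finset.Icc 1 (p - 1),
            (∀ k ∈ Finset.Icc 1 (p - 1), σ'.arr .out k = if k ∈ J then 1 else 0) ∧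
            ∑ k ∈ J, d k = τ := by
  -- The running time dictates the constant, the main loop alone being allowed `13400 * p` steps.
  -- Words need only `6 * (Nat.log 2 p + 1)` bits, and memory only `20 * (2 * p + 1) + 36` cells.
  refine ⟨15000, fun p hp d τ hd σ hσ hτ hin => ?_⟩
  have : Fact p.Prime := ⟨hp⟩
  have hp2 := hp.two_le
  have hlog : 1 ≤ Nat.log 2 p := Nat.log_pos (by norm_num) hp2
  have hW : p ^ 6 < 2 ^ (15000 * Nat.log 2 p) :=
    calc p ^ 6 < (2 ^ (Nat.log 2 p + 1)) ^ 6 :=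
          Nat.pow_lt_pow_left (Nat.lt_pow_succ_log_self (by norm_num) p) (by norm_num)
      _ = 2 ^ ((Nat.log 2 p + 1) * 6) := (pow_mul _ _ _).symm
      _ ≤ 2 ^ (15000 * Nat.log 2 p) := Nat.pow_le_pow_right (by norm_num) (by omega)
  -- Arrays of `2 * p + 1` cells suffice because the node numbers, the largest indices used, stay at
  -- most `2 * p`.
  obtain ⟨time, σ', he, ht, hJ⟩ := PrimeTarget.wp_program (w := 15000 * Nat.log 2 p)
    (S := 2 * p + 1) hp hd hσ hτ hin hW (Nat.lt_succ_self _)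
  have hA : Fintype.card PrimeTarget.Arr = 20 := rfl
  have hV : Fintype.card PrimeTarget.Var = 36 := rfl
  exact ⟨2 * p + 1, time, σ', he, ht, by rw [hA, hV]; omega, hJ⟩
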